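/- Let $(M,g)$ be a smooth (Hausdorff, second countable) Lorentzian manifold of dimension $n+1$, with $g$ of signature $(-,+,\dots,+)$. A global time function is a smooth $\tau:M\to\mathbb R$ whose gradient is timelike everywhere; it defines the time orientation of $-\operatorname{grad}\tau$. Assume that $(M,g)$ is globally hyperbolic, i.e. that there is a global time function all of whose nonempty level sets have all of $M$ as domain of dependence, and that it satisfies the strong energy condition: $Ric(V,V)\ge 0$ for every timelike vector field $V$. Let $S=\tau^{-1}(a)$ be a time slice (a level set of a global time function $\tau$), with future-pointing unit normal $N$, and for $q\in S$ let $c_q$ be the geodesic with $c_q(0)=q$, $\dot c_q(0)=N_q$. Let $\exp(t,q)=c_q(t)$ be the exponential map of $S$, defined on the set of all $(t,q)\in\mathbb R\times S$ such that $c_q$ extends to the parameter $t$. The critical values of $\exp$ are the points conjugate to $S$. Near each point of $S$ the geodesics $c_q$ foliate an open set $V$; the expansion is $\theta=\operatorname{div}X$, where $X$ is the vector field on $V$ formed by their velocities. Let $p\in S$ be a point where $\theta(p)=\theta_0<0$, and suppose that $c_p$ can be extended to the parameter (proper time) $t_0=-\dfrac{n}{\theta_0}$. Then $c_p$ contains a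 point conjugate to $S$ at distance at most $t_0$ to the future of $S$: there is $t\in(0,t_0]$ such that $(t,p)$ is a critical point of $\exp$, i.e. $\exp$ is differentiable at $(t,p)$ and $d\exp_{(t,p)}:T_{(t,p)}(\mathbb R\times S)\to T_{c_p(t)}M$ is not onto; in particular $c_p(t)$ is conjugate to $S$. -/

import Mathlib

open Set Filter
open scoped Manifold ContDiff Topology

noncomputable section

/-- A Lorentzian metric, of signature `(- + ... +)`, on a smooth manifold of dimension `n + 1`:
a smooth symmetric 2-tensor field which has an orthonormal basis (with exactly one timelike
vector, the one of index `0`) at each point. -/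
structure LorentzMetric (n : ℕ) (M : Type*) [TopologicalSpace M]
    [ChartedSpace (EuclideanSpace ℝ (Fin (n + 1))) M] [IsManifold (𝓡 (n + 1)) ∞ M] where
  /-- the scalar product on each tangent space -/
  val (x : M) : TangentSpace (𝓡 (n + 1)) x →L[ℝ] TangentSpace (𝓡 (n + 1)) x →L[ℝ] ℝ
  symm (x : M) (v w : TangentSpace (𝓡 (n + 1)) x) : val x v w = val x w v
  signature (x : M) : ∃ b : Module.Basis (Fin (n + 1)) ℝ (TangentSpace (𝓡 (n + 1)) x),
    ∀ i j, val x (b i) (b j) = if i = j then (if i = 0 then -1 else 1) else 0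
  contMDiff : ContMDiff (𝓡 (n + 1))
    ((𝓡 (n + 1)).prod 𝓘(ℝ, EuclideanSpace ℝ (Fin (n + 1)) →L[ℝ]
      EuclideanSpace ℝ (Fin (n + 1)) →L[ℝ] ℝ)) ∞
    (fun x ↦ Bundle.TotalSpace.mk'
      (EuclideanSpace ℝ (Fin (n + 1)) →L[ℝ] EuclideanSpace ℝ (Fin (n + 1)) →L[ℝ] ℝ) x (val x))

namespace LorentzMetric

variable {n : ℕ} {M : Type*} [TopologicalSpace M]
  [ChartedSpace (EuclideanSpace ℝ (Fin (n + 1))) M] [IsManifold (𝓡 (n + 1)) ∞ M]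

/-! ### The Levi-Civita connection and the Ricci tensor, in charts

The coordinates are those of the preferred charts `extChartAt (𝓡 (n + 1)) x₀`; `y` is a point of
the coordinate space (only the points of the chart's target matter). -/

/-- The components `g_ij` of the metric in the chart at `x₀`. -/
def coordMetric (g : LorentzMetric n M) (x₀ : M) (i j : Fin (n + 1))
    (y : EuclideanSpace ℝ (Fin (n + 1))) : ℝ :=
  g.val ((extChartAt (𝓡 (n + 1)) x₀).symm y)
    (mfderiv 𝓘(ℝ, EuclideanSpace ℝ (Fin (n + 1))) (𝓡 (n + 1))
      (extChartAt (𝓡 (n + 1)) x₀).symm y (EuclideanSpace.single i (1 : ℝ)))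
    (mfderiv 𝓘(ℝ, EuclideanSpace ℝ (Fin (n + 1))) (𝓡 (n + 1))
      (extChartAt (𝓡 (n + 1)) x₀).symm y (EuclideanSpace.single j (1 : ℝ)))

/-- The components `g^ij` of the inverse metric. -/
def coordInverse (g : LorentzMetric n M) (x₀ : M) (i j : Fin (n + 1))
    (y : EuclideanSpace ℝ (Fin (n + 1))) : ℝ :=
  (Matrix.of fun k l ↦ g.coordMetric x₀ k l y)⁻¹ i j

/-- The partial derivative `∂_i f` of a function on the coordinate space. -/
def pd (i : Fin (n + 1)) (f : EuclideanSpace ℝ (Fin (n + 1)) → ℝ)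
    (y : EuclideanSpace ℝ (Fin (n + 1))) : ℝ :=
  fderiv ℝ f y (EuclideanSpace.single i (1 : ℝ))

/-- The Christoffel symbols `Γ^k_ij` of the Levi-Civita connection. -/
def christoffel (g : LorentzMetric n M) (x₀ : M) (k i j : Fin (n + 1))
    (y : EuclideanSpace ℝ (Fin (n + 1))) : ℝ :=
  (1 / 2) * ∑ l, g.coordInverse x₀ k l y *
    (pd i (g.coordMetric x₀ j l) y + pd j (g.coordMetric x₀ i l) y
      - pd l (g.coordMetric x₀ i j) y)

/-- The components `R_jk = ∂_i Γ^i_jk - ∂_j Γ^i_ik + Γ^i_im Γ^m_jk - Γ^i_jm Γ^m_ik` of the Ricci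
tensor, that is, of the trace of `V ↦ R(V, ∂_j) ∂_k`. -/
def coordRicci (g : LorentzMetric n M) (x₀ : M) (j k : Fin (n + 1))
    (y : EuclideanSpace ℝ (Fin (n + 1))) : ℝ :=
  ∑ i, (pd i (g.christoffel x₀ i j k) y - pd j (g.christoffel x₀ i i k) y
    + ∑ m, (g.christoffel x₀ i i m y * g.christoffel x₀ m j k y
      - g.christoffel x₀ i j m y * g.christoffel x₀ m i k y))

/-- The component `v^i` of a tangent vector `v` at `x` in the chart at `x₀`. -/
def coordVec (x₀ x : M) (v : TangentSpace (𝓡 (n + 1)) x) (i : Fin (n + 1)) : ℝ :=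
  let u : EuclideanSpace ℝ (Fin (n + 1)) :=
    mfderiv (𝓡 (n + 1)) 𝓘(ℝ, EuclideanSpace ℝ (Fin (n + 1))) (extChartAt (𝓡 (n + 1)) x₀) x v
  u i

/-- The Ricci tensor `Ric(v, w)` at `x`. -/
def ricci (g : LorentzMetric n M) (x : M) (v w : TangentSpace (𝓡 (n + 1)) x) : ℝ :=
  ∑ j, ∑ k, g.coordRicci x j k (extChartAt (𝓡 (n + 1)) x x) *
    coordVec x x v j * coordVec x x w k

/-- The divergence of a vector field `X` at `x`: the trace `∂_i X^i + Γ^i_ij X^j` of `∇ X`. -/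
def divergence (g : LorentzMetric n M) (X : ∀ x : M, TangentSpace (𝓡 (n + 1)) x) (x : M) : ℝ :=
  ∑ i, (pd i (fun y ↦ coordVec x ((extChartAt (𝓡 (n + 1)) x).symm y)
      (X ((extChartAt (𝓡 (n + 1)) x).symm y)) i) (extChartAt (𝓡 (n + 1)) x x)
    + ∑ j, g.christoffel x i i j (extChartAt (𝓡 (n + 1)) x x) * coordVec x x (X x) j)

/-! ### Curves, geodesics, and the strong energy condition -/

/-- The velocity vector of a curve. -/
def velocity (c : ℝ → M) (s : ℝ) : TangentSpace (𝓡 (n + 1)) (c s) :=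
  mfderiv 𝓘(ℝ, ℝ) (𝓡 (n + 1)) c s (1 : ℝ)

/-- `c` is a geodesic on the open set `J` of parameters: in each chart it solves the equation
`c''^k + Γ^k_ij c'^i c'^j = 0`. (A solution of class `C^2` is smooth.) -/
def IsGeodesicOn (g : LorentzMetric n M) (c : ℝ → M) (J : Set ℝ) : Prop :=
  ContMDiffOn 𝓘(ℝ, ℝ) (𝓡 (n + 1)) 2 c J ∧
  ∀ x₀ : M, ∀ s ∈ J, c s ∈ (extChartAt (𝓡 (n + 1)) x₀).source → ∀ k,
    deriv (deriv fun r ↦ extChartAt (𝓡 (n + 1)) x₀ (c r) k) s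
      + ∑ i, ∑ j, g.christoffel x₀ k i j (extChartAt (𝓡 (n + 1)) x₀ (c s)) *
        deriv (fun r ↦ extChartAt (𝓡 (n + 1)) x₀ (c r) i) s *
        deriv (fun r ↦ extChartAt (𝓡 (n + 1)) x₀ (c r) j) s = 0

/-- A tangent vector is timelike if `⟨v, v⟩ < 0`. -/
def IsTimelike (g : LorentzMetric n M) {x : M} (v : TangentSpace (𝓡 (n + 1)) x) : Prop :=
  g.val x v v < 0

/-- The strong energy condition: `Ric(V, V) ≥ 0` for any timelike (smooth) vector field `V`. -/
def StrongEnergyCondition (g : LorentzMetric n M) : Prop :=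
  ∀ V : ∀ x : M, TangentSpace (𝓡 (n + 1)) x,
    ContMDiff (𝓡 (n + 1)) (𝓡 (n + 1)).tangent ∞
      (fun x ↦ (⟨x, V x⟩ : TangentBundle (𝓡 (n + 1)) M)) →
    (∀ x, g.IsTimelike (V x)) → ∀ x, 0 ≤ g.ricci x (V x) (V x)

/-! ### Time functions and global hyperbolicity -/

theorem exists_repr (g : LorentzMetric n M) (x : M) (α : TangentSpace (𝓡 (n + 1)) x →L[ℝ] ℝ) :
    ∃ G : TangentSpace (𝓡 (n + 1)) x, ∀ v, g.val x G v = α v := by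
  obtain ⟨b, hb⟩ := g.signature x
  refine ⟨∑ i, ((if i = 0 then -1 else 1) * α (b i)) • b i, fun v ↦ ?_⟩
  have key : ((g.val x (∑ i, (((if i = 0 then -1 else 1 : ℝ)) * α (b i)) • b i) :
      TangentSpace (𝓡 (n + 1)) x →L[ℝ] ℝ) : TangentSpace (𝓡 (n + 1)) x →ₗ[ℝ] ℝ) =
      (α : TangentSpace (𝓡 (n + 1)) x →ₗ[ℝ] ℝ) := by
    refine b.ext fun j ↦ ?_
    simp only [map_sum, map_smul, ContinuousLinearMap.coe_coe, _root_.sum_apply,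
      _root_.smul_apply, hb, smul_eq_mul]
    rw [Finset.sum_eq_single j]
    · by_cases h : j = 0 <;> simp [h]
    · intro i _ hi
      simp [hi]
    · simp
  exact LinearMap.congr_fun key v

/-- The gradient of a function: the vector field with `⟨grad f, v⟩ = df(v)`. -/
def grad (g : LorentzMetric n M) (f : M → ℝ) (x : M) : TangentSpace (𝓡 (n + 1)) x :=
  Classical.choose (g.exists_repr x (mfderiv (𝓡 (n + 1)) 𝓘(ℝ, ℝ) f x))

theorem val_grad (g : LorentzMetric n M) (f : M → ℝ) (x : M)
    (v : TangentSpace (𝓡 (n + 1)) x) :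
    g.val x (g.grad f x) v = mfderiv (𝓡 (n + 1)) 𝓘(ℝ, ℝ) f x v :=
  Classical.choose_spec (g.exists_repr x (mfderiv (𝓡 (n + 1)) 𝓘(ℝ, ℝ) f x)) v

/-- A global time function: a smooth function with timelike gradient. -/
def IsTimeFunction (g : LorentzMetric n M) (τ : M → ℝ) : Prop :=
  ContMDiff (𝓡 (n + 1)) 𝓘(ℝ, ℝ) ∞ τ ∧ ∀ x, g.IsTimelike (g.grad τ x)

/-- A nonzero non-spacelike vector is future-pointing, for the time orientation defined by
`- grad τ`, if its product with `- grad τ` is negative. -/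
def IsFuturePointing (g : LorentzMetric n M) (τ : M → ℝ) {x : M}
    (v : TangentSpace (𝓡 (n + 1)) x) : Prop :=
  g.val x (-g.grad τ x) v < 0

/-- The interval `(A, B)` of real numbers, where possibly `A = -∞` or `B = ∞`. -/
def realIoo (A B : EReal) : Set ℝ := {s : ℝ | A < (s : EReal) ∧ (s : EReal) < B}

/-- `c` is a smooth future-directed causal curve on the interval `(A, B)`. -/
def IsCausalCurve (g : LorentzMetric n M) (τ : M → ℝ) (c : ℝ → M) (A B : EReal) : Prop :=
  ContMDiffOn 𝓘(ℝ, ℝ) (𝓡 (n + 1)) ∞ c (realIoo A B) ∧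
  ∀ s ∈ realIoo A B, g.val (c s) (velocity c s) (velocity c s) ≤ 0 ∧
    ((velocity c s : TangentSpace (𝓡 (n + 1)) (c s)) ≠ 0 → g.IsFuturePointing τ (velocity c s))

/-- The past domain of dependence `D⁻(S)`: every future-inextendible causal curve
starting at `x` (at parameter `0`) meets `S`. -/
def pastDomain (g : LorentzMetric n M) (τ : M → ℝ) (S : Set M) : Set M :=
  {x | ∀ (c : ℝ → M) (A B : EReal), A < 0 → 0 < B → g.IsCausalCurve τ c A B → c 0 = x →
    (¬ ∃ q, Tendsto c (comap ((↑) : ℝ → EReal) (𝓝[<] B)) (𝓝 q)) →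
    ∃ s ∈ realIoo A B, 0 ≤ s ∧ c s ∈ S}

/-- The future domain of dependence `D⁺(S)`: every past-inextendible causal curve
ending at `x` (at parameter `0`) meets `S`. -/
def futureDomain (g : LorentzMetric n M) (τ : M → ℝ) (S : Set M) : Set M :=
  {x | ∀ (c : ℝ → M) (A B : EReal), A < 0 → 0 < B → g.IsCausalCurve τ c A B → c 0 = x →
    (¬ ∃ q, Tendsto c (comap ((↑) : ℝ → EReal) (𝓝[>] A)) (𝓝 q)) →
    ∃ s ∈ realIoo A B, s ≤ 0 ∧ c s ∈ S}

/-- The time slice `τ = a`. -/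
def timeSlice (τ : M → ℝ) (a : ℝ) : Set M := {x | τ x = a}

/-- Global hyperbolicity: there is a global time function all of whose (nonempty) time slices have
the whole manifold as domain of dependence. -/
def GloballyHyperbolic (g : LorentzMetric n M) : Prop :=
  ∃ τ : M → ℝ, g.IsTimeFunction τ ∧
    ∀ a ∈ range τ, g.futureDomain τ (timeSlice τ a) ∪ g.pastDomain τ (timeSlice τ a) = univ

/-! ### Normal geodesics, conjugate points and the expansion -/

/-- The future-pointing unit normal `- grad τ / |grad τ|` of the time slices of `τ`. -/
def unitNormal (g : LorentzMetric n M) (τ : M → ℝ) (x : M) : TangentSpace (𝓡 (n + 1)) x :=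
  -(Real.sqrt |g.val x (g.grad τ x) (g.grad τ x)|)⁻¹ • g.grad τ x

/-- `c`, on the interval `(A, B)` containing `0`, is the geodesic `c_q` that starts at `q` with the
unit normal to the time slice through `q` as its initial velocity. -/
def IsNormalGeodesic (g : LorentzMetric n M) (τ : M → ℝ) (q : M) (c : ℝ → M) (A B : ℝ) : Prop :=
  A < 0 ∧ 0 < B ∧ g.IsGeodesicOn c (Ioo A B) ∧ c 0 = q ∧ velocity c 0 = g.unitNormal τ (c 0)

/-- The set of the `(t, q)` such that the normal geodesic `c_q` can be extended to parameter `t`. -/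
def expDomain (g : LorentzMetric n M) (τ : M → ℝ) : Set (ℝ × M) :=
  {z | ∃ (c : ℝ → M) (A B : ℝ), g.IsNormalGeodesic τ z.2 c A B ∧ z.1 ∈ Ioo A B}

open Classical in
/-- The exponential map `(t, q) ↦ c_q(t)` of the time slices of `τ`. It is defined for all the time
slices together, hence on a subset of `ℝ × M`; the exponential map of the time slice `S` is its
restriction to `ℝ × S`. (Outside of `expDomain` the value means nothing.) -/
def normalExp (g : LorentzMetric n M) (τ : M → ℝ) (z : ℝ × M) : M :=
  if h : z ∈ g.expDomain τ then Classical.choose h z.1 else z.2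

/-- `(t, q)` is a critical point of the exponential map of the time slice `S` through `q`: the
differential at `(t, q)`, restricted to `T_(t, q) (ℝ × S) = ℝ × ker (dτ)_q`, is not onto. -/
def IsCriticalPoint (g : LorentzMetric n M) (τ : M → ℝ) (t : ℝ) (q : M) : Prop :=
  (t, q) ∈ g.expDomain τ ∧
  MDifferentiableAt (𝓘(ℝ, ℝ).prod (𝓡 (n + 1))) (𝓡 (n + 1)) (g.normalExp τ) (t, q) ∧
  ¬ ∀ v : TangentSpace (𝓡 (n + 1)) (g.normalExp τ (t, q)),
    ∃ (s : ℝ) (w : TangentSpace (𝓡 (n + 1)) q),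
      mfderiv (𝓡 (n + 1)) 𝓘(ℝ, ℝ) τ q w = 0 ∧
      mfderiv (𝓘(ℝ, ℝ).prod (𝓡 (n + 1))) (𝓡 (n + 1)) (g.normalExp τ) (t, q) (s, w) = v

/-- The points conjugate to the time slice `τ = a`: the critical values of its exponential map. -/
def conjugatePoints (g : LorentzMetric n M) (τ : M → ℝ) (a : ℝ) : Set M :=
  {x | ∃ (t : ℝ) (q : M), q ∈ timeSlice τ a ∧ g.IsCriticalPoint τ t q ∧
    g.normalExp τ (t, q) = x}

/-- The normal geodesic `c_q` is defined and stays in `V` between the parameters `0` and `t`. -/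
def StaysIn (g : LorentzMetric n M) (τ : M → ℝ) (V : Set M) (t : ℝ) (q : M) : Prop :=
  ∀ s ∈ uIcc 0 t, (s, q) ∈ g.expDomain τ ∧ g.normalExp τ (s, q) ∈ V

/-- `X` is the vector field, on the open set `V`, tangent to the family of the
geodesics orthogonal to the time slice `τ = a`: these foliate `V`, and `X` is their velocity. -/
structure IsNormalGeodesicField (g : LorentzMetric n M) (τ : M → ℝ) (a : ℝ) (V : Set M)
    (X : ∀ x : M, TangentSpace (𝓡 (n + 1)) x) : Prop where
  isOpen : IsOpen V
  smooth : ContMDiffOn (𝓡 (n + 1)) (𝓡 (n + 1)).tangent ∞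
    (fun x ↦ (⟨x, X x⟩ : TangentBundle (𝓡 (n + 1)) M)) V
  foliated : ∀ x ∈ V, ∃ (t : ℝ) (q : M), q ∈ timeSlice τ a ∧ g.StaysIn τ V t q ∧
    g.normalExp τ (t, q) = x
  tangent : ∀ (t : ℝ) (q : M), q ∈ timeSlice τ a → g.StaysIn τ V t q →
    X (g.normalExp τ (t, q)) = velocity (fun s ↦ g.normalExp τ (s, q)) t

/-- The expansion of the family of geodesics orthogonal to the time slice `τ = a`, that is, the
divergence of their velocity field, has the value `θ` at `p`. -/
def HasExpansionAt (g : LorentzMetric n M) (τ : M → ℝ) (a : ℝ) (p : M) (θ : ℝ) : Prop :=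
  ∃ (V : Set M) (X : ∀ x : M, TangentSpace (𝓡 (n + 1)) x),
    p ∈ V ∧ g.IsNormalGeodesicField τ a V X ∧ g.divergence X p = θ

end LorentzMetric

end

/-!
The argument is by contradiction: if no parameter `t ∈ (0, -n / θ₀]` is critical, the expansion of
the normal geodesics stays finite along `c_p` up to `-n / θ₀`, and the Raychaudhuri inequality
forbids this.

Varying the initial point of `c_p` in the directions of the time slice gives Jacobi fields along
`c_p`; together with the velocity of `c_p` itself they form the Jacobi tensor `J` (`normalJacobi`).
It is the identity at `0`, and at a parameter that is not critical it is onto, hence invertible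
(`IsRegularAt.isUnit_normalJacobi`). With the covariant derivative `P` of `J`, the operator
`B = P J⁻¹` (`normalShape`) is the covariant derivative of the velocity field of the normal
geodesics, and its trace `θ` (`normalExpansion`) satisfies the traced Riccati equation
`θ' = -tr R(·, c') c' - tr B²` (`IsLeviCivitaOn.hasDerivAt_trace_riccati`).

Both terms on the right have a sign.
* `tr R(·, c') c' = Ric(c', c')` (`ricci_self_eq_trace`), which is nonnegative: the strong energy
  condition speaks of vector fields, but every timelike vector is the value of a timelike vector
  field, because the timelike vectors on one side of the time slices form a convex cone
  (`exists_timelike_extension`).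
* The Wronskian `⟨P a, J b⟩ - ⟨J a, P b⟩` is constant along `c_p`, by the pair symmetry of the
  curvature tensor, and vanishes at `0`, because the second fundamental form of the slice is
  symmetric (`IsLeviCivitaOn.metric_covariant_symm`). So `B` is symmetric for the metric. It also
  annihilates the unit timelike vector `c'`, hence it acts on the Euclidean space orthogonal to
  `c'`, of dimension `n`, and `θ² ≤ n tr B²` (`IsLorentzForm.trace_sq_le`).

Hence `n θ' + θ² ≤ 0`. At parameter `0` the value of `θ` is `div X = θ₀ < 0`
(`IsNormalGeodesicField.divergence_eq_normalExpansion`), so `1 / θ` starts at `1 / θ₀`, grows at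
least at the rate `1 / n`, and cannot remain negative up to `-n / θ₀` (`not_riccati_inequality`).

That a critical point is a point where the exponential map is differentiable, and that `J` makes
sense at all, rests on the differentiable dependence of geodesics on their initial values. The flow
of the geodesic equation in one chart is differentiable (`ContDiffOn.exists_local_flow`); passing
from chart to chart along `c_p` gives differentiability for as long as `c_p` is defined
(`IsTimeFunction.isRegularAt`). All tensors are computed in charts. Since the chart changes along
the curve, the quantities above carry the base point `x₀` of the chart, and those which are
differentiated along the whole curve are shown not to depend on it.
-/

noncomputable section

set_option maxSynthPendingDepth 3

/-! ### Lorentzian scalar products -/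

section LorentzForm

variable {n : ℕ} {E : Type*} [NormedAddCommGroup E] [NormedSpace ℝ E]

/-- A continuous symmetric bilinear form of signature `(- + ... +)` on a space of dimension
`n + 1`. -/
structure IsLorentzForm (n : ℕ) (G : E →L[ℝ] E →L[ℝ] ℝ) : Prop where
  symm (u v : E) : G u v = G v u
  signature : ∃ b : Module.Basis (Fin (n + 1)) ℝ E,
    ∀ i j, G (b i) (b j) = if i = j then (if i = 0 then -1 else 1) else 0

namespace IsLorentzForm

variable {G : E →L[ℝ] E →L[ℝ] ℝ}

lemma exists_coords (hG : IsLorentzForm n G) : ∃ b : Module.Basis (Fin (n + 1)) ℝ E,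
    ∀ u v, G u v = -(b.repr u 0 * b.repr v 0) + ∑ i : Fin n, b.repr u i.succ * b.repr v i.succ := by
  obtain ⟨b, hb⟩ := hG.signature
  refine ⟨b, fun u v ↦ ?_⟩
  conv_lhs => rw [← b.sum_repr u, ← b.sum_repr v]
  simp only [map_sum, map_smul, _root_.sum_apply, _root_.smul_apply, hb, smul_eq_mul]
  simp [Fin.sum_univ_succ, Fin.succ_ne_zero, mul_comm]

lemma nondegenerate (hG : IsLorentzForm n G) {u : E} (h : ∀ v, G u v = 0) : u = 0 := by
  obtain ⟨b, hb⟩ := hG.signature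
  apply b.repr.injective
  ext i
  have := h (b i)
  rw [← b.sum_repr u] at this
  simp only [map_sum, map_smul, _root_.sum_apply, _root_.smul_apply, hb, smul_eq_mul] at this
  rw [Finset.sum_eq_single i (by intro j _ hj; simp [hj]) (by simp)] at this
  by_cases hi : i = 0
  · simpa [hi] using this
  · simpa [hi] using this

/-- A nonzero vector orthogonal to a timelike vector is spacelike. -/
lemma pos_of_orthogonal (hG : IsLorentzForm n G) {u v : E} (hv : G v v < 0) (huv : G u v = 0)
    (hu : u ≠ 0) : 0 < G u u := by
  obtain ⟨b, hb⟩ := hG.exists_coords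
  rw [hb] at hv huv ⊢
  set u0 := b.repr u 0
  set v0 := b.repr v 0
  have hcs := Finset.sum_mul_sq_le_sq_mul_sq Finset.univ (fun i : Fin n ↦ b.repr u i.succ)
    (fun i : Fin n ↦ b.repr v i.succ)
  have e1 : ∑ i : Fin n, b.repr u i.succ * b.repr v i.succ = u0 * v0 := by linarith
  rw [e1] at hcs
  simp only [← pow_two] at hv ⊢
  set a := ∑ i : Fin n, b.repr u i.succ ^ 2 with ha
  set c := ∑ i : Fin n, b.repr v i.succ ^ 2 with hc
  have ha0 : 0 ≤ a := Finset.sum_nonneg fun i _ ↦ sq_nonneg _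
  have hc0 : 0 ≤ c := Finset.sum_nonneg fun i _ ↦ sq_nonneg _
  have hv0 : 0 < v0 ^ 2 := by linarith
  by_contra hcon
  have h1 : a ≤ u0 ^ 2 := by linarith
  have ha' : a = 0 := by
    by_contra hne
    have : 0 < a := lt_of_le_of_ne ha0 (Ne.symm hne)
    nlinarith
  have hu0 : u0 = 0 := by
    have hz : (u0 * v0) ^ 2 ≤ 0 := by simpa [ha'] using hcs
    have : u0 ^ 2 * v0 ^ 2 ≤ 0 := by nlinarith
    have : u0 ^ 2 ≤ 0 := by nlinarith
    nlinarith
  apply hu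
  apply b.repr.injective
  ext i
  refine Fin.cases ?_ (fun j ↦ ?_) i
  · simpa using hu0
  · have := (Finset.sum_eq_zero_iff_of_nonneg (fun i _ ↦ sq_nonneg _)).1 (ha.symm.trans ha') j
      (Finset.mem_univ j)
    simpa using this

/-- Two timelike vectors on the same side of a third one have negative product. -/
lemma neg_of_same_side (hG : IsLorentzForm n G) {t v w : E} (ht : G t t < 0) (hv : G v v < 0)
    (hw : G w w < 0) (htv : G t v < 0) (htw : G t w < 0) : G v w < 0 := by
  -- a combination of `v` and `w` with positive and negative coefficients is orthogonal to `t`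
  set z := G t w • v - G t v • w with hz
  have hzt : G z t = 0 := by
    simp only [hz, map_sub, map_smul, _root_.sub_apply, _root_.smul_apply, smul_eq_mul,
      hG.symm v t, hG.symm w t]
    ring
  have hzz : 0 ≤ G z z := by
    by_cases h : z = 0
    · simp [h]
    · exact (hG.pos_of_orthogonal ht hzt h).le
  simp only [hz, map_sub, map_smul, _root_.sub_apply, _root_.smul_apply, smul_eq_mul,
    hG.symm w v] at hzz
  by_contra hcon
  push Not at hcon
  have h1 : 0 < G t w * G t v := mul_pos_of_neg_of_neg htw htv
  have h2 : 0 < G t w ^ 2 := pow_two (G t w) ▸ mul_pos_of_neg_of_neg htw htw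
  have h3 : 0 < G t v ^ 2 := pow_two (G t v) ▸ mul_pos_of_neg_of_neg htv htv
  nlinarith [mul_nonneg h1.le hcon]

/-- For `v` with `G v v = -1`, the form `G + 2 G(·, v) G(·, v)` is positive definite. -/
lemma wick_pos (hG : IsLorentzForm n G) {v : E} (hv : G v v = -1) {u : E} (hu : u ≠ 0) :
    0 < G u u + 2 * G u v ^ 2 := by
  set w := u + G u v • v with hw
  have hwv : G w v = 0 := by simp [hw, hv]
  have hww : G w w = G u u + G u v ^ 2 := by
    simp [hw, hv, hG.symm v u]; ring
  by_cases h : w = 0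
  · have h0 : G u v ≠ 0 := by
      intro h0
      apply hu
      simpa [hw, h0] using h
    have : 0 < G u v ^ 2 := by positivity
    rw [h] at hww
    simp at hww
    linarith
  · have := hG.pos_of_orthogonal (by rw [hv]; norm_num) hwv h
    nlinarith [sq_nonneg (G u v)]

lemma finiteDimensional (hG : IsLorentzForm n G) : FiniteDimensional ℝ E := by
  obtain ⟨b, -⟩ := hG.signature
  exact b.finiteDimensional_of_finite

lemma finrank_eq (hG : IsLorentzForm n G) : Module.finrank ℝ E = n + 1 := by
  obtain ⟨b, -⟩ := hG.signature
  simpa using Module.finrank_eq_card_basis b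

/-- The square of an operator which is symmetric for `G` and annihilates a unit timelike vector has
nonnegative trace: the operator is also symmetric for a positive definite form. -/
lemma trace_sq_nonneg (hG : IsLorentzForm n G) {v : E} (hv : G v v = -1) (B : E →ₗ[ℝ] E)
    (hB : ∀ u w, G (B u) w = G u (B w)) (hBv : B v = 0) :
    0 ≤ LinearMap.trace ℝ E (B ∘ₗ B) := by
  have := hG.finiteDimensional
  have hBv' : ∀ u, G (B u) v = 0 := fun u ↦ by rw [hB, hBv, map_zero]
  let Q : LinearMap.BilinForm ℝ E := LinearMap.mk₂ ℝ (fun u w ↦ G u w + 2 * (G u v * G w v))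
    (by intros; simp; ring) (by intros; simp; ring) (by intros; simp; ring)
    (by intros; simp; ring)
  have hQ : ∀ u w, Q u w = G u w + 2 * (G u v * G w v) := fun u w ↦ rfl
  have hQs : LinearMap.IsSymm Q := ⟨fun u w ↦ by simp [hQ, hG.symm u w]; ring⟩
  obtain ⟨f, hf⟩ := LinearMap.BilinForm.exists_orthogonal_basis hQs
  have hfpos : ∀ i, 0 < Q (f i) (f i) := fun i ↦ by
    have := hG.wick_pos hv (f.ne_zero i)
    rw [hQ]; nlinarith
  have hcoef : ∀ u i, f.repr u i = Q u (f i) / Q (f i) (f i) := by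
    intro u i
    rw [eq_div_iff (hfpos i).ne']
    conv_rhs => rw [← f.sum_repr u]
    simp only [LinearMap.BilinForm.sum_left, LinearMap.BilinForm.smul_left]
    rw [Finset.sum_eq_single i]
    · intro j _ hj
      have : Q (f j) (f i) = 0 := hf hj
      simp [this]
    · simp
  rw [LinearMap.trace_eq_matrix_trace ℝ f, Matrix.trace]
  refine Finset.sum_nonneg fun i _ ↦ ?_
  rw [Matrix.diag_apply, LinearMap.toMatrix_apply, hcoef]
  refine div_nonneg ?_ (hfpos i).le
  have h1 : Q ((B ∘ₗ B) (f i)) (f i) = G (B (f i)) (B (f i)) := by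
    rw [hQ, LinearMap.comp_apply, hB, hBv']; ring
  rw [h1]
  by_cases h0 : B (f i) = 0
  · simp [h0]
  · exact (hG.pos_of_orthogonal (by rw [hv]; norm_num) (hBv' _) h0).le

/-- The Cauchy-Schwarz inequality of the Raychaudhuri equation: it is the discriminant inequality for
the trace of `(B - x P)²`, where `P` is the projection to the orthogonal complement of `v`. -/
lemma trace_sq_le (hG : IsLorentzForm n G) {v : E} (hv : G v v = -1) (B : E →ₗ[ℝ] E)
    (hB : ∀ u w, G (B u) w = G u (B w)) (hBv : B v = 0) :
    LinearMap.trace ℝ E B ^ 2 ≤ n * LinearMap.trace ℝ E (B ∘ₗ B) := by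
  have := hG.finiteDimensional
  have hBv' : ∀ u, G (B u) v = 0 := fun u ↦ by rw [hB, hBv, map_zero]
  -- the orthogonal projection to the orthogonal complement of `v`
  let S : E →ₗ[ℝ] E := ((G.flip v : E →L[ℝ] ℝ) : E →ₗ[ℝ] ℝ).smulRight v
  let P : E →ₗ[ℝ] E := LinearMap.id + S
  have hP : ∀ u, P u = u + G u v • v := fun u ↦ rfl
  have hPtr : LinearMap.trace ℝ E P = n := by
    simp only [P, map_add, S, LinearMap.trace_smulRight, LinearMap.trace_id, hG.finrank_eq]
    simp [hv]
  have hBP : B ∘ₗ P = B := by ext u; simp [hP, hBv]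
  have hPB : P ∘ₗ B = B := by ext u; simp [hP, hBv']
  have hPP : P ∘ₗ P = P := by ext u; simp [hP, hv]
  have key : ∀ x : ℝ, 0 ≤ n * (x * x) + (-2 * LinearMap.trace ℝ E B) * x
      + LinearMap.trace ℝ E (B ∘ₗ B) := by
    intro x
    have h := hG.trace_sq_nonneg hv (B - x • P) (fun u w ↦ by
      simp only [LinearMap.sub_apply, LinearMap.smul_apply, hP, map_sub, map_add, map_smul,
        _root_.sub_apply, _root_.add_apply, _root_.smul_apply, smul_eq_mul, hB, hG.symm v w]
      ring) (by simp [hP, hBv, hv])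
    have e : (B - x • P) ∘ₗ (B - x • P) = B ∘ₗ B - (2 * x) • B + (x * x) • P := by
      simp only [LinearMap.sub_comp, LinearMap.comp_sub, LinearMap.smul_comp, LinearMap.comp_smul,
        hBP, hPB, hPP]
      module
    rw [e] at h
    simp only [map_add, map_sub, map_smul, smul_eq_mul, hPtr] at h
    linarith
  have := discrim_le_zero key
  rw [discrim] at this
  nlinarith

end IsLorentzForm

end LorentzForm

/-! ### Metrics and their connections in coordinates -/

section LocalGeometry

variable {E F : Type*} [NormedAddCommGroup E] [NormedSpace ℝ E]
  [NormedAddCommGroup F] [NormedSpace ℝ F]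

/-- On the open set `U` of the coordinate space, `Γ` is the bilinear map of the Christoffel
symbols of the nondegenerate metric `G`, characterized as the torsion free metric connection. -/
structure IsLeviCivitaOn (G : E → E →L[ℝ] E →L[ℝ] ℝ) (Γ : E → E →L[ℝ] E →L[ℝ] E)
    (U : Set E) : Prop where
  isOpen : IsOpen U
  contDiffOn_metric : ContDiffOn ℝ ∞ G U
  contDiffOn_gamma : ContDiffOn ℝ ∞ Γ U
  metric_symm : ∀ y ∈ U, ∀ u v, G y u v = G y v u
  nondegenerate : ∀ y ∈ U, ∀ u, (∀ v, G y u v = 0) → u = 0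
  torsion_free : ∀ y ∈ U, ∀ u v, Γ y u v = Γ y v u
  compat : ∀ y ∈ U, ∀ w u v, fderiv ℝ G y w u v = G y (Γ y w u) v + G y u (Γ y w v)

/-- The curvature tensor `R(u, v) w` of the connection with Christoffel symbols `Γ`. -/
def curvature (Γ : E → E →L[ℝ] E →L[ℝ] E) (y u v w : E) : E :=
  fderiv ℝ Γ y u v w - fderiv ℝ Γ y v u w + Γ y u (Γ y v w) - Γ y v (Γ y u w)

namespace IsLeviCivitaOn

variable {G : E → E →L[ℝ] E →L[ℝ] ℝ} {Γ : E → E →L[ℝ] E →L[ℝ] E} {U : Set E}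

lemma contDiffAt_metric (h : IsLeviCivitaOn G Γ U) {y : E} (hy : y ∈ U) : ContDiffAt ℝ ∞ G y :=
  h.contDiffOn_metric.contDiffAt (h.isOpen.mem_nhds hy)

lemma contDiffAt_gamma (h : IsLeviCivitaOn G Γ U) {y : E} (hy : y ∈ U) : ContDiffAt ℝ ∞ Γ y :=
  h.contDiffOn_gamma.contDiffAt (h.isOpen.mem_nhds hy)

lemma hasFDerivAt_metric (h : IsLeviCivitaOn G Γ U) {y : E} (hy : y ∈ U) :
    HasFDerivAt G (fderiv ℝ G y) y :=
  ((h.contDiffAt_metric hy).differentiableAt (by simp)).hasFDerivAt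

lemma hasFDerivAt_gamma (h : IsLeviCivitaOn G Γ U) {y : E} (hy : y ∈ U) :
    HasFDerivAt Γ (fderiv ℝ Γ y) y :=
  ((h.contDiffAt_gamma hy).differentiableAt (by simp)).hasFDerivAt

/-- The product rule for the scalar product of two vector fields along a curve, in terms of their
covariant derivatives. -/
lemma hasDerivAt_metric (h : IsLeviCivitaOn G Γ U) {x A B : ℝ → E} {v A' B' : E} {t : ℝ}
    (hx : HasDerivAt x v t) (hA : HasDerivAt A A' t) (hB : HasDerivAt B B' t) (hxU : x t ∈ U) :
    HasDerivAt (fun s ↦ G (x s) (A s) (B s))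
      (G (x t) (A' + Γ (x t) v (A t)) (B t) + G (x t) (A t) (B' + Γ (x t) v (B t))) t := by
  have hg : HasDerivAt (fun s ↦ G (x s)) (fderiv ℝ G (x t) v) t :=
    (h.hasFDerivAt_metric hxU).comp_hasDerivAt t hx
  refine ((hg.clm_apply hA).clm_apply hB).congr_deriv ?_
  simp [h.compat _ hxU]
  ring

lemma curvature_swap (Γ : E → E →L[ℝ] E →L[ℝ] E) (y u v w : E) :
    curvature Γ y u v w = -curvature Γ y v u w := by
  simp only [curvature]; abel

lemma fderiv_gamma_symm (h : IsLeviCivitaOn G Γ U) {y : E} (hy : y ∈ U) (a u v : E) :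
    fderiv ℝ Γ y a u v = fderiv ℝ Γ y a v u := by
  have e : (fun z ↦ Γ z u v) =ᶠ[𝓝 y] fun z ↦ Γ z v u := by
    filter_upwards [h.isOpen.mem_nhds hy] with z hz using h.torsion_free z hz u v
  have h1 : ∀ u v, fderiv ℝ (fun z ↦ Γ z u v) y a = fderiv ℝ Γ y a u v := by
    intro u v
    have := ((h.hasFDerivAt_gamma hy).clm_apply (hasFDerivAt_const u y)).clm_apply
      (hasFDerivAt_const v y)
    rw [this.fderiv]
    simp
  rw [← h1, ← h1, e.fderiv_eq]

/-- The first Bianchi identity. -/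
lemma bianchi (h : IsLeviCivitaOn G Γ U) {y : E} (hy : y ∈ U) (u v w : E) :
    curvature Γ y u v w + curvature Γ y v w u + curvature Γ y w u v = 0 := by
  simp only [curvature, h.fderiv_gamma_symm hy _ v u, h.fderiv_gamma_symm hy _ w u,
    h.fderiv_gamma_symm hy _ w v, h.torsion_free y hy v u, h.torsion_free y hy w u,
    h.torsion_free y hy w v]
  abel

lemma metric_curvature_antisymm (h : IsLeviCivitaOn G Γ U) {y : E} (hy : y ∈ U) (a b u v : E) :
    G y (curvature Γ y a b u) v = -G y u (curvature Γ y a b v) := by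
  -- differentiate the compatibility condition and use that second derivatives commute
  have hcomm : fderiv ℝ (fderiv ℝ G) y a b = fderiv ℝ (fderiv ℝ G) y b a :=
    ((h.contDiffAt_metric hy).isSymmSndFDerivAt (by simpa using WithTop.coe_le_coe.2 (le_top : (2 : ℕ∞) ≤ ⊤))).eq a b
  have hG2 : HasFDerivAt (fderiv ℝ G) (fderiv ℝ (fderiv ℝ G) y) y :=
    (((h.contDiffAt_metric hy).fderiv_right (m := 1)
      (WithTop.coe_le_coe.2 (le_top : (1 + 1 : ℕ∞) ≤ ⊤))).differentiableAt
      (by simp)).hasFDerivAt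
  have key : ∀ a b, fderiv ℝ (fderiv ℝ G) y a b u v =
      fderiv ℝ G y a (Γ y b u) v + G y (fderiv ℝ Γ y a b u) v
      + fderiv ℝ G y a u (Γ y b v) + G y u (fderiv ℝ Γ y a b v) := by
    intro a b
    have hl : HasDerivAt (fun r : ℝ ↦ y + r • a) a 0 := by
      simpa using ((hasDerivAt_id (0 : ℝ)).smul_const a).const_add y
    have hy0 : y = y + (0 : ℝ) • a := by simp
    have d0 := HasFDerivAt.comp_hasDerivAt (0 : ℝ) (hy0 ▸ hG2) hl
    have dG := HasFDerivAt.comp_hasDerivAt (0 : ℝ) (hy0 ▸ h.hasFDerivAt_metric hy) hl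
    have dΓ := HasFDerivAt.comp_hasDerivAt (0 : ℝ) (hy0 ▸ h.hasFDerivAt_gamma hy) hl
    have dΓ1 := (dΓ.clm_apply (hasDerivAt_const _ b)).clm_apply (hasDerivAt_const _ u)
    have dΓ2 := (dΓ.clm_apply (hasDerivAt_const _ b)).clm_apply (hasDerivAt_const _ v)
    have dl := ((d0.clm_apply (hasDerivAt_const _ b)).clm_apply (hasDerivAt_const _ u)).clm_apply
      (hasDerivAt_const _ v)
    have dr := ((dG.clm_apply dΓ1).clm_apply (hasDerivAt_const _ v)).add
      ((dG.clm_apply (hasDerivAt_const _ u)).clm_apply dΓ2)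
    have hev : ∀ᶠ r in 𝓝 (0 : ℝ), y + r • a ∈ U :=
      hl.continuousAt.eventually_mem (by simpa using h.isOpen.mem_nhds hy)
    have := dl.unique (dr.congr_of_eventuallyEq (by
      filter_upwards [hev] with r hr
      simp [h.compat _ hr]))
    simpa [add_assoc] using this
  have h1 := key a b
  have h2 := key b a
  rw [hcomm, h2] at h1
  simp only [h.compat _ hy] at h1
  simp only [curvature, map_add, map_sub, _root_.add_apply, _root_.sub_apply]
  linarith

/-- The operator `R(·, v) v` is symmetric. -/
lemma metric_curvature_symm (h : IsLeviCivitaOn G Γ U) {y : E} (hy : y ∈ U) (a b v : E) :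
    G y (curvature Γ y a v v) b = G y a (curvature Γ y b v v) := by
  have anti := fun a b u v ↦ h.metric_curvature_antisymm hy a b u v
  have sw : ∀ a b u w, G y (curvature Γ y a b u) w = -G y (curvature Γ y b a u) w := by
    intro a b u w; rw [curvature_swap]; simp
  have bi : ∀ a b u w, G y (curvature Γ y a b u) w + G y (curvature Γ y b u a) w
      + G y (curvature Γ y u a b) w = 0 := by
    intro a b u w
    have := congrArg (fun z ↦ G y z w) (h.bianchi hy a b u)
    simpa using this
  have sy : ∀ a b u w, G y (curvature Γ y a b u) w = -G y (curvature Γ y a b w) u := by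
    intro a b u w; rw [anti, h.metric_symm y hy]
  rw [h.metric_symm y hy a]
  -- the octahedron argument for the pair symmetry of the curvature tensor
  linarith [bi a v v b, bi v b a v, bi b v v a, bi v a b v, bi a b v v, sy a v v b, sy v b v a,
    sy b v v a, sy v a v b, sw a v v b, sw b v v a, sy a b v v, sw a b v v, sw v v a b, sw v v b a,
    sy v b a v, sw v b a v, sy b a v v, sy v a b v, sw v a b v, sy a v b v, sy b v a v, sw b a v v]

/-- The transformation law of the Christoffel symbols under a change of coordinates `ψ`, from the
uniqueness of the torsion free metric connection. -/
lemma transition (h : IsLeviCivitaOn G Γ U) {G' : F → F →L[ℝ] F →L[ℝ] ℝ}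
    {Γ' : F → F →L[ℝ] F →L[ℝ] F} {U' : Set F} (h' : IsLeviCivitaOn G' Γ' U') {ψ : E → F} {y : E}
    (hy : y ∈ U) (hy' : ψ y ∈ U') (hψ : ContDiffAt ℝ 2 ψ y)
    (hG : ∀ᶠ z in 𝓝 y, ∀ u v, G z u v = G' (ψ z) (fderiv ℝ ψ z u) (fderiv ℝ ψ z v))
    (hsurj : Function.Surjective (fderiv ℝ ψ y)) (u v : E) :
    fderiv ℝ (fderiv ℝ ψ) y u v + Γ' (ψ y) (fderiv ℝ ψ y u) (fderiv ℝ ψ y v)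
      = fderiv ℝ ψ y (Γ y u v) := by
  set D := fderiv ℝ ψ y with hD
  set T : E → E → F := fun u v ↦ fderiv ℝ (fderiv ℝ ψ) y u v + Γ' (ψ y) (D u) (D v) - D (Γ y u v)
    with hT
  have hTsymm : ∀ u v, T u v = T v u := by
    intro u v
    have : fderiv ℝ (fderiv ℝ ψ) y u v = fderiv ℝ (fderiv ℝ ψ) y v u :=
      (hψ.isSymmSndFDerivAt (by simp)).eq u v
    simp only [hT, this, h.torsion_free y hy u v, h'.torsion_free _ hy' (D u)]
  have hψ1 : HasFDerivAt ψ D y := (hψ.differentiableAt (by simp)).hasFDerivAt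
  have hψ2 : HasFDerivAt (fderiv ℝ ψ) (fderiv ℝ (fderiv ℝ ψ) y) y :=
    ((hψ.fderiv_right (m := 1) (by norm_num)).differentiableAt (by simp)).hasFDerivAt
  have hanti : ∀ w u v, G' (ψ y) (T w u) (D v) + G' (ψ y) (D u) (T w v) = 0 := by
    intro w u v
    have hl : HasDerivAt (fun r : ℝ ↦ y + r • w) w 0 := by
      simpa using ((hasDerivAt_id (0 : ℝ)).smul_const w).const_add y
    have hy0 : y = y + (0 : ℝ) • w := by simp
    have dψ := HasFDerivAt.comp_hasDerivAt (0 : ℝ) (hy0 ▸ hψ1) hl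
    have dψ2 := HasFDerivAt.comp_hasDerivAt (0 : ℝ) (hy0 ▸ hψ2) hl
    have d1 := h.hasDerivAt_metric hl (hasDerivAt_const _ u) (hasDerivAt_const _ v) (by simpa using hy)
    have d2 := h'.hasDerivAt_metric dψ (dψ2.clm_apply (hasDerivAt_const _ u))
      (dψ2.clm_apply (hasDerivAt_const _ v)) (by simpa using hy')
    have hev := hl.continuousAt.eventually (by simpa using hG)
    have := d1.unique (d2.congr_of_eventuallyEq (by
      filter_upwards [hev] with r hr
      exact hr u v))
    have e := hG.self_of_nhds
    simp only [zero_smul, add_zero, zero_add, map_zero, Function.comp, e, ← hD] at this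
    simp only [hT, map_add, map_sub, _root_.add_apply, _root_.sub_apply] at this ⊢
    linarith
  have hzero : T u v = 0 := by
    apply h'.nondegenerate _ hy'
    intro z
    obtain ⟨w, rfl⟩ := hsurj z
    have sy : ∀ a b c, G' (ψ y) (D a) (T b c) = G' (ψ y) (T b c) (D a) :=
      fun a b c ↦ h'.metric_symm _ hy' _ _
    have h1 := hanti u v w
    have h2 := hanti v w u
    have h3 := hanti w u v
    rw [sy] at h1 h2 h3
    rw [hTsymm v w, hTsymm v u] at h2
    rw [hTsymm w u] at h3
    linarith
  exact sub_eq_zero.1 hzero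

end IsLeviCivitaOn

end LocalGeometry

/-! ### Differentiable dependence of integral curves on the initial value -/

section Flow

open Metric

variable {Z : Type*} [NormedAddCommGroup Z] [NormedSpace ℝ Z]

/-- Grönwall's inequality on both sides of the initial time, with an explicit constant. -/
lemma norm_le_of_norm_deriv_le_two_sided {f f' : ℝ → Z} {δ K ε D : ℝ} (hK : 0 < K) (hε : 0 ≤ ε)
    (hf : ∀ s ∈ Ioo (-δ) δ, HasDerivAt f (f' s) s) (h0 : ‖f 0‖ ≤ D)
    (hb : ∀ s ∈ Ioo (-δ) δ, ‖f' s‖ ≤ K * ‖f s‖ + ε) {s : ℝ} (hs : s ∈ Ioo (-δ) δ) :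
    ‖f s‖ ≤ D * Real.exp (K * δ) + ε / K * Real.exp (K * δ) := by
  have hD : 0 ≤ D := (norm_nonneg _).trans h0
  have main : ∀ (g g' : ℝ → Z), (∀ s ∈ Ioo (-δ) δ, HasDerivAt g (g' s) s) → ‖g 0‖ ≤ D →
      (∀ s ∈ Ioo (-δ) δ, ‖g' s‖ ≤ K * ‖g s‖ + ε) → ∀ s ∈ Ico 0 δ,
      ‖g s‖ ≤ D * Real.exp (K * δ) + ε / K * Real.exp (K * δ) := by
    intro g g' hg hg0 hgb s hs
    have hsub : Icc 0 s ⊆ Ioo (-δ) δ := fun r hr ↦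
      ⟨by have := hr.1; have := hs.1; have := hs.2; linarith, hr.2.trans_lt hs.2⟩
    have := norm_le_gronwallBound_of_norm_deriv_right_le (f := g) (f' := g') (a := 0) (b := s)
      (HasDerivAt.continuousOn fun r hr ↦ hg r (hsub hr))
      (fun r hr ↦ (hg r (hsub (Ico_subset_Icc_self hr))).hasDerivWithinAt) hg0
      (fun r hr ↦ hgb r (hsub (Ico_subset_Icc_self hr))) s ⟨hs.1, le_rfl⟩
    rw [gronwallBound_of_K_ne_0 hK.ne', sub_zero] at this
    have he : Real.exp (K * s) ≤ Real.exp (K * δ) :=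
      Real.exp_le_exp.2 (mul_le_mul_of_nonneg_left hs.2.le hK.le)
    have hεK : 0 ≤ ε / K := by positivity
    refine this.trans (add_le_add (mul_le_mul_of_nonneg_left he hD)
      (mul_le_mul_of_nonneg_left (by linarith) hεK))
  rcases le_or_gt 0 s with h | h
  · exact main f f' hf h0 hb s ⟨h, hs.2⟩
  · have := main (fun r ↦ f (-r)) (fun r ↦ -f' (-r)) (fun r hr ↦ by
        have hr' : -r ∈ Ioo (-δ) δ := ⟨by linarith [hr.2], by linarith [hr.1]⟩
        simpa [Function.comp_def] using (hf (-r) hr').scomp r (hasDerivAt_neg r)) (by simpa using h0)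
      (fun r hr ↦ by
        have hr' : -r ∈ Ioo (-δ) δ := ⟨by linarith [hr.2], by linarith [hr.1]⟩
        simpa using hb (-r) hr') (-s) ⟨by linarith, by linarith [hs.1]⟩
    simpa using this

/-- The local flow `Φ` of a vector field of class `C^2` is differentiable, and its derivative `Y`
with respect to the initial value solves the linearized equation. Here `Y` is obtained as part of
the flow of the equation together with its linearization, and Grönwall's inequality shows that it
is the derivative of `Φ`. -/
theorem ContDiffOn.exists_local_flow [CompleteSpace Z] {F : Z → Z} {Ω : Set Z} (hΩ : IsOpen Ω)
    (hF : ContDiffOn ℝ 2 F Ω) {z₀ : Z} (hz₀ : z₀ ∈ Ω) :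
    ∃ δ > 0, ∃ W : Set Z, IsOpen W ∧ z₀ ∈ W ∧ ∃ (Φ : ℝ → Z → Z) (Y : ℝ → Z → Z →L[ℝ] Z), ∀ z ∈ W,
      Φ 0 z = z ∧ ∀ s ∈ Ioo (-δ) δ, Φ s z ∈ Ω ∧
        HasDerivAt (fun s ↦ Φ s z) (F (Φ s z)) s ∧
        HasDerivAt (fun s ↦ Y s z) ((fderiv ℝ F (Φ s z)).comp (Y s z)) s ∧
        HasFDerivAt (fun q : ℝ × Z ↦ Φ q.1 q.2)
          (((1 : ℝ →L[ℝ] ℝ).smulRight (F (Φ s z))).coprod (Y s z)) (s, z) := by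
  have hF0 : ContDiffAt ℝ 2 F z₀ := hF.contDiffAt (hΩ.mem_nhds hz₀)
  have hF'0 : ContDiffAt ℝ 1 (fderiv ℝ F) z₀ := hF0.fderiv_right (by norm_num)
  -- the flow of the equation together with its linearization
  let FF : Z × (Z →L[ℝ] Z) → Z × (Z →L[ℝ] Z) := fun q ↦ (F q.1, (fderiv ℝ F q.1).comp q.2)
  have hFF : ContDiffAt ℝ 1 FF (z₀, ContinuousLinearMap.id ℝ Z) := by
    refine ContDiffAt.prodMk ?_ (ContDiffAt.clm_comp ?_ contDiffAt_snd)
    · exact (hF0.of_le (by norm_num)).comp (z₀, ContinuousLinearMap.id ℝ Z) contDiffAt_fst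
    · exact hF'0.comp (z₀, ContinuousLinearMap.id ℝ Z) contDiffAt_fst
  obtain ⟨ε, hε, a, r, L, K₀, hr, hpl⟩ := IsPicardLindelof.of_contDiffAt_one hFF
  obtain ⟨α, hα, hαc⟩ :=
    (hpl 0).exists_forall_mem_closedBall_eq_hasDerivWithinAt_continuousOn
  obtain ⟨K₁, s₁, hs₁, hK₁⟩ := (hF0.of_le (by norm_num : (1 : WithTop ℕ∞) ≤ 2)).exists_lipschitzOnWith
  obtain ⟨K₂, s₂, hs₂, hK₂⟩ := hF'0.exists_lipschitzOnWith
  obtain ⟨R, hR, hRs⟩ := Metric.mem_nhds_iff.1 (inter_mem (inter_mem hs₁ hs₂) (hΩ.mem_nhds hz₀))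
  have hαcont : ContinuousAt α ((z₀, ContinuousLinearMap.id ℝ Z), 0) := by
    apply hαc.continuousAt
    exact prod_mem_nhds (closedBall_mem_nhds _ (by exact_mod_cast hr))
      (Icc_mem_nhds (by simpa using hε) (by simpa using hε))
  have hα0 : α ((z₀, ContinuousLinearMap.id ℝ Z), 0) = (z₀, ContinuousLinearMap.id ℝ Z) := by
    simpa using (hα _ (mem_closedBall_self (by positivity))).1
  have hnear : ∀ᶠ q in 𝓝 ((z₀, ContinuousLinearMap.id ℝ Z), (0 : ℝ)), (α q).1 ∈ ball z₀ R := by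
    have : ContinuousAt (fun q ↦ (α q).1) ((z₀, ContinuousLinearMap.id ℝ Z), 0) :=
      continuousAt_fst.comp hαcont
    exact this.eventually_mem (by rw [hα0]; exact ball_mem_nhds _ hR)
  rw [nhds_prod_eq, eventually_prod_iff] at hnear
  obtain ⟨pa, hpa, pb, hpb, hab⟩ := hnear
  obtain ⟨δ₁, hδ₁, hδ₁b⟩ := Metric.eventually_nhds_iff_ball.1 hpb
  have hcont1 : ContinuousAt (fun z : Z ↦ (z, ContinuousLinearMap.id ℝ Z)) z₀ := by fun_prop
  obtain ⟨ρ, hρ, hρb⟩ := Metric.eventually_nhds_iff_ball.1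
    (hcont1.eventually (hpa.and (closedBall_mem_nhds _ (by exact_mod_cast hr : (0 : ℝ) < r))))
  set δ := min ε δ₁ with hδ
  have hδpos : 0 < δ := lt_min hε hδ₁
  let Φ : ℝ → Z → Z := fun s z ↦ (α ((z, ContinuousLinearMap.id ℝ Z), s)).1
  let Y : ℝ → Z → Z →L[ℝ] Z := fun s z ↦ (α ((z, ContinuousLinearMap.id ℝ Z), s)).2
  have hball : ∀ z ∈ ball z₀ ρ, ∀ s ∈ Ioo (-δ) δ, Φ s z ∈ ball z₀ R := by
    intro z hz s hs
    refine hab (hρb z hz).1 (hδ₁b s ?_)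
    rw [mem_ball_zero_iff, Real.norm_eq_abs, abs_lt]
    exact ⟨by linarith [hs.1, min_le_right ε δ₁], by linarith [hs.2, min_le_right ε δ₁]⟩
  have hinit : ∀ z ∈ ball z₀ ρ, Φ 0 z = z ∧ Y 0 z = ContinuousLinearMap.id ℝ Z := by
    intro z hz
    have := (hα _ (hρb z hz).2).1
    exact ⟨congrArg Prod.fst this, congrArg Prod.snd this⟩
  have hder : ∀ z ∈ ball z₀ ρ, ∀ s ∈ Ioo (-δ) δ,
      HasDerivAt (fun s ↦ α ((z, ContinuousLinearMap.id ℝ Z), s))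
        (FF (α ((z, ContinuousLinearMap.id ℝ Z), s))) s := by
    intro z hz s hs
    have h1 : -ε < s := by linarith [hs.1, min_le_left ε δ₁]
    have h2 : s < ε := by linarith [hs.2, min_le_left ε δ₁]
    exact ((hα _ (hρb z hz).2).2 s ⟨by simpa using h1.le, by simpa using h2.le⟩).hasDerivAt
      (Icc_mem_nhds (by simpa using h1) (by simpa using h2))
  have hΦ : ∀ z ∈ ball z₀ ρ, ∀ s ∈ Ioo (-δ) δ, HasDerivAt (fun s ↦ Φ s z) (F (Φ s z)) s :=
    fun z hz s hs ↦ (hasFDerivAt_fst.comp_hasDerivAt s (hder z hz s hs) :)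
  have hY : ∀ z ∈ ball z₀ ρ, ∀ s ∈ Ioo (-δ) δ,
      HasDerivAt (fun s ↦ Y s z) ((fderiv ℝ F (Φ s z)).comp (Y s z)) s :=
    fun z hz s hs ↦ (hasFDerivAt_snd.comp_hasDerivAt s (hder z hz s hs) :)
  have hdF : ∀ z ∈ ball z₀ R, HasFDerivAt F (fderiv ℝ F z) z := fun z hz ↦
    ((hF.contDiffAt (hΩ.mem_nhds (hRs hz).2)).differentiableAt (by norm_num)).hasFDerivAt
  have hLip : ∀ x ∈ ball z₀ R, ∀ y ∈ ball z₀ R, ‖F x - F y‖ ≤ (K₁ + 1) * ‖x - y‖ := by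
    intro x hx y hy
    have h := hK₁.dist_le_mul x (hRs hx).1.1 y (hRs hy).1.1
    rw [dist_eq_norm, dist_eq_norm] at h
    nlinarith [norm_nonneg (x - y)]
  have hnorm : ∀ x ∈ ball z₀ R, ‖fderiv ℝ F x‖ ≤ K₁ + 1 := by
    intro x hx
    have : ‖fderiv ℝ F x‖ ≤ K₁ :=
      norm_fderiv_le_of_lipschitzOn ℝ (isOpen_ball.mem_nhds hx) (hK₁.mono fun y hy ↦ (hRs hy).1.1)
    linarith
  have hquad : ∀ x ∈ ball z₀ R, ∀ y ∈ ball z₀ R,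
      ‖F y - F x - fderiv ℝ F x (y - x)‖ ≤ K₂ * ‖y - x‖ * ‖y - x‖ := by
    intro x hx y hy
    have hseg : segment ℝ x y ⊆ ball z₀ R := (convex_ball z₀ R).segment_subset hx hy
    refine (convex_segment x y).norm_image_sub_le_of_norm_hasFDerivWithin_le'
      (fun w hw ↦ (hdF w (hseg hw)).hasFDerivWithinAt) ?_ (left_mem_segment ℝ x y)
      (right_mem_segment ℝ x y)
    intro w hw
    have h := hK₂.dist_le_mul w (hRs (hseg hw)).1.2 x (hRs hx).1.2
    rw [dist_eq_norm, dist_eq_norm] at h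
    refine h.trans (mul_le_mul_of_nonneg_left ?_ K₂.2)
    exact norm_sub_le_of_mem_segment hw
  set K : ℝ := K₁ + 1 with hK
  have hKpos : 0 < K := by positivity
  set C := Real.exp (K * δ) with hC
  have hCpos : 0 < C := Real.exp_pos _
  have hlip : ∀ z ∈ ball z₀ ρ, ∀ w ∈ ball z₀ ρ, ∀ s ∈ Ioo (-δ) δ,
      ‖Φ s w - Φ s z‖ ≤ ‖w - z‖ * C := by
    intro z hz w hw s hs
    have := norm_le_of_norm_deriv_le_two_sided (f := fun s ↦ Φ s w - Φ s z)
      (f' := fun s ↦ F (Φ s w) - F (Φ s z)) (δ := δ) (ε := 0) (D := ‖w - z‖) hKpos le_rfl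
      (fun s hs ↦ (hΦ w hw s hs).sub (hΦ z hz s hs))
      (by rw [(hinit w hw).1, (hinit z hz).1])
      (fun s hs ↦ by
        rw [add_zero]
        exact hLip _ (hball w hw s hs) _ (hball z hz s hs)) hs
    simpa using this
  -- the remainder solves the linearized equation up to a quadratic error
  have hrem : ∀ z ∈ ball z₀ ρ, ∀ w ∈ ball z₀ ρ, ∀ s ∈ Ioo (-δ) δ,
      ‖Φ s w - Φ s z - Y s z (w - z)‖ ≤ (K₂ * C * C / K * C) * ‖w - z‖ ^ 2 := by
    intro z hz w hw s hs
    have := norm_le_of_norm_deriv_le_two_sided (f := fun s ↦ Φ s w - Φ s z - Y s z (w - z))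
      (f' := fun s ↦ F (Φ s w) - F (Φ s z) - fderiv ℝ F (Φ s z) (Y s z (w - z))) (δ := δ)
      (ε := K₂ * (‖w - z‖ * C) * (‖w - z‖ * C)) (D := 0) hKpos (by positivity)
      (fun s hs ↦ by
        have h1 := (hY z hz s hs).clm_apply (hasDerivAt_const s (w - z))
        simpa using ((hΦ w hw s hs).fun_sub (hΦ z hz s hs)).fun_sub h1)
      (by simp [(hinit w hw).1, (hinit z hz).1, (hinit z hz).2])
      (fun s hs ↦ by
        have e : F (Φ s w) - F (Φ s z) - fderiv ℝ F (Φ s z) (Y s z (w - z)) =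
            fderiv ℝ F (Φ s z) (Φ s w - Φ s z - Y s z (w - z)) +
            (F (Φ s w) - F (Φ s z) - fderiv ℝ F (Φ s z) (Φ s w - Φ s z)) := by
          rw [map_sub _ (Φ s w - Φ s z)]; abel
        rw [e]
        refine (norm_add_le _ _).trans (add_le_add ?_ ?_)
        · exact (ContinuousLinearMap.le_opNorm _ _).trans
            (mul_le_mul_of_nonneg_right (hnorm _ (hball z hz s hs)) (norm_nonneg _))
        · refine (hquad _ (hball z hz s hs) _ (hball w hw s hs)).trans ?_
          have := hlip z hz w hw s hs
          gcongr) hs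
    refine this.trans (le_of_eq ?_)
    rw [← hC]
    ring
  refine ⟨δ, hδpos, ball z₀ ρ, isOpen_ball, mem_ball_self hρ, Φ, Y, fun z hz ↦
    ⟨(hinit z hz).1, fun s hs ↦ ⟨(hRs (hball z hz s hs)).2, hΦ z hz s hs, hY z hz s hs, ?_⟩⟩⟩
  -- the derivative of the flow in both variables
  have e1 : (fun q : ℝ × Z ↦ Φ q.1 q.2 - Φ q.1 z - Y q.1 z (q.2 - z)) =o[𝓝 (s, z)]
      fun q ↦ q - (s, z) := by
    have hO : (fun q : ℝ × Z ↦ Φ q.1 q.2 - Φ q.1 z - Y q.1 z (q.2 - z)) =O[𝓝 (s, z)]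
        fun q ↦ ‖q - (s, z)‖ ^ 2 := by
      refine Asymptotics.IsBigO.of_bound (K₂ * C * C / K * C) ?_
      filter_upwards [prod_mem_nhds (Ioo_mem_nhds hs.1 hs.2) (isOpen_ball.mem_nhds hz)] with q hq
      refine (hrem z hz q.2 hq.2 q.1 hq.1).trans ?_
      rw [Real.norm_of_nonneg (by positivity)]
      have : ‖q.2 - z‖ ≤ ‖q - (s, z)‖ := norm_snd_le (q - (s, z))
      gcongr
    exact hO.trans_isLittleO (by simpa using Asymptotics.isLittleO_pow_sub_sub (s, z) one_lt_two)
  have e2 : HasFDerivAt (fun q : ℝ × Z ↦ Φ q.1 z)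
      (((1 : ℝ →L[ℝ] ℝ).smulRight (F (Φ s z))).comp (ContinuousLinearMap.fst ℝ ℝ Z)) (s, z) :=
    HasFDerivAt.comp (s, z) (f := Prod.fst) (hΦ z hz s hs).hasFDerivAt hasFDerivAt_fst
  have e3 : HasFDerivAt (fun q : ℝ × Z ↦ Y q.1 z (q.2 - z))
      ((Y s z).comp (ContinuousLinearMap.snd ℝ ℝ Z)) (s, z) := by
    have h1 : HasFDerivAt (fun q : ℝ × Z ↦ Y q.1 z)
        (((1 : ℝ →L[ℝ] ℝ).smulRight ((fderiv ℝ F (Φ s z)).comp (Y s z))).comp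
          (ContinuousLinearMap.fst ℝ ℝ Z)) (s, z) :=
      HasFDerivAt.comp (s, z) (f := Prod.fst) (hY z hz s hs).hasFDerivAt hasFDerivAt_fst
    refine (h1.clm_apply ((hasFDerivAt_snd (p := (s, z))).sub_const z)).congr_fderiv ?_
    ext <;> simp
  have e4 : HasFDerivAt (fun q : ℝ × Z ↦ Φ q.1 q.2 - Φ q.1 z - Y q.1 z (q.2 - z))
      (0 : ℝ × Z →L[ℝ] Z) (s, z) := by
    rw [hasFDerivAt_iff_isLittleO]
    refine e1.congr_left fun q ↦ ?_
    simp
  refine (((e4.add e2).add e3).congr_fderiv ?_).congr_of_eventuallyEq (Eventually.of_forall ?_)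
  · ext <;> simp
  · intro q
    simp only [Pi.add_apply]
    abel

end Flow

/-! ### The metric and the connection in a chart -/

/-- The coordinate space of a manifold of dimension `n + 1`. -/
abbrev CoordSpace (n : ℕ) : Type := EuclideanSpace ℝ (Fin (n + 1))

lemma contDiffOn_matrix_det {X : Type*} [NormedAddCommGroup X] [NormedSpace ℝ X] {m : ℕ}
    {A : X → Matrix (Fin m) (Fin m) ℝ} {s : Set X} {k : WithTop ℕ∞}
    (hA : ∀ i j, ContDiffOn ℝ k (fun x ↦ A x i j) s) : ContDiffOn ℝ k (fun x ↦ (A x).det) s := by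
  simp only [Matrix.det_apply]
  refine ContDiffOn.sum fun σ _ ↦ ContDiffOn.const_smul _ ?_
  exact contDiffOn_prod fun i _ ↦ hA _ _

lemma contDiffOn_matrix_inv {X : Type*} [NormedAddCommGroup X] [NormedSpace ℝ X] {m : ℕ}
    {A : X → Matrix (Fin m) (Fin m) ℝ} {s : Set X} {k : WithTop ℕ∞}
    (hA : ∀ i j, ContDiffOn ℝ k (fun x ↦ A x i j) s) (hdet : ∀ x ∈ s, (A x).det ≠ 0)
    (i j : Fin m) : ContDiffOn ℝ k (fun x ↦ (A x)⁻¹ i j) s := by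
  simp only [Matrix.inv_def, Matrix.smul_apply, Ring.inverse_eq_inv', smul_eq_mul]
  refine ((contDiffOn_matrix_det hA).inv hdet).mul ?_
  simp only [Matrix.adjugate_apply]
  refine contDiffOn_matrix_det fun i' j' ↦ ?_
  by_cases h : i' = j
  · simp only [Matrix.updateRow_apply, h, if_true]
    exact contDiffOn_const
  · simp only [Matrix.updateRow_apply, h, if_false]
    exact hA _ _

/-- The coordinate vectors. -/
abbrev coordBasis {n : ℕ} (i : Fin (n + 1)) : CoordSpace n := EuclideanSpace.single i (1 : ℝ)

lemma CoordSpace.sum_coords {n : ℕ} (u : CoordSpace n) : u = ∑ i, u i • coordBasis i := by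
  ext j
  simp [coordBasis, Finset.sum_apply, Pi.single_apply]

lemma CoordSpace.eq_of_isLinearMap {n : ℕ} {f f' : CoordSpace n → ℝ} (hf : IsLinearMap ℝ f)
    (hf' : IsLinearMap ℝ f') (h : ∀ i, f (coordBasis i) = f' (coordBasis i)) (u : CoordSpace n) :
    f u = f' u := by
  have e : ∀ {f : CoordSpace n → ℝ}, IsLinearMap ℝ f → f u = ∑ i, u i * f (coordBasis i) := by
    intro f hf
    conv_lhs => rw [u.sum_coords]
    change hf.mk' f _ = _
    rw [map_sum]
    simp
  rw [e hf, e hf']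
  simp [h]

namespace LorentzMetric

variable {n : ℕ} {M : Type*} [TopologicalSpace M]
  [ChartedSpace (EuclideanSpace ℝ (Fin (n + 1))) M] [IsManifold (𝓡 (n + 1)) ∞ M]

lemma isLorentzForm (g : LorentzMetric n M) (x : M) :
    IsLorentzForm (E := CoordSpace n) n (g.val x) :=
  ⟨g.symm x, g.signature x⟩

/-- The metric in the chart at `x₀`, as a field of bilinear forms on the coordinate space. -/
def chartMetric (g : LorentzMetric n M) (x₀ : M) (y : CoordSpace n) :
    CoordSpace n →L[ℝ] CoordSpace n →L[ℝ] ℝ :=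
  let D : CoordSpace n →L[ℝ] CoordSpace n :=
    mfderiv 𝓘(ℝ, CoordSpace n) (𝓡 (n + 1)) (extChartAt (𝓡 (n + 1)) x₀).symm y
  let B : CoordSpace n →L[ℝ] CoordSpace n →L[ℝ] ℝ := g.val ((extChartAt (𝓡 (n + 1)) x₀).symm y)
  B.bilinearComp D D

lemma chartMetric_apply (g : LorentzMetric n M) (x₀ : M) (y u v : CoordSpace n) :
    g.chartMetric x₀ y u v = g.val ((extChartAt (𝓡 (n + 1)) x₀).symm y)
      (mfderiv 𝓘(ℝ, CoordSpace n) (𝓡 (n + 1)) (extChartAt (𝓡 (n + 1)) x₀).symm y u)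
      (mfderiv 𝓘(ℝ, CoordSpace n) (𝓡 (n + 1)) (extChartAt (𝓡 (n + 1)) x₀).symm y v) := rfl

lemma chartMetric_symm (g : LorentzMetric n M) (x₀ : M) (y u v : CoordSpace n) :
    g.chartMetric x₀ y u v = g.chartMetric x₀ y v u := by
  rw [chartMetric_apply, chartMetric_apply, g.symm]

lemma coordMetric_eq (g : LorentzMetric n M) (x₀ : M) (i j : Fin (n + 1)) (y : CoordSpace n) :
    g.coordMetric x₀ i j y = g.chartMetric x₀ y (coordBasis i) (coordBasis j) := rfl

lemma isInvertible_mfderiv_symm (x₀ : M) {y : CoordSpace n}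
    (hy : y ∈ (extChartAt (𝓡 (n + 1)) x₀).target) :
    (mfderiv 𝓘(ℝ, CoordSpace n) (𝓡 (n + 1)) (extChartAt (𝓡 (n + 1)) x₀).symm y).IsInvertible := by
  have : IsManifold (𝓡 (n + 1)) 1 M := IsManifold.of_le (n := ∞) (by exact_mod_cast le_top)
  have := isInvertible_mfderivWithin_extChartAt_symm (I := 𝓡 (n + 1)) hy
  rwa [ModelWithCorners.range_eq_univ, mfderivWithin_univ] at this

lemma isLorentzForm_chartMetric (g : LorentzMetric n M) (x₀ : M) {y : CoordSpace n}
    (hy : y ∈ (extChartAt (𝓡 (n + 1)) x₀).target) : IsLorentzForm n (g.chartMetric x₀ y) := by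
  obtain ⟨e, he⟩ := isInvertible_mfderiv_symm x₀ hy
  obtain ⟨b, hb⟩ := g.signature ((extChartAt (𝓡 (n + 1)) x₀).symm y)
  refine ⟨fun u v ↦ g.symm _ _ _, b.map e.symm.toLinearEquiv, fun i j ↦ ?_⟩
  rw [chartMetric_apply, ← he, ← hb]
  exact congrArg₂ (fun a c ↦ g.val _ a c) (e.apply_symm_apply (b i)) (e.apply_symm_apply (b j))

lemma contMDiffOn_mfderiv_symm (x₀ : M) (u : CoordSpace n) :
    ContMDiffOn 𝓘(ℝ, CoordSpace n) (𝓡 (n + 1)).tangent ∞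
      (fun y ↦ (⟨(extChartAt (𝓡 (n + 1)) x₀).symm y,
        mfderiv 𝓘(ℝ, CoordSpace n) (𝓡 (n + 1)) (extChartAt (𝓡 (n + 1)) x₀).symm y u⟩ :
          TangentBundle (𝓡 (n + 1)) M)) (extChartAt (𝓡 (n + 1)) x₀).target := by
  have hopen : IsOpen (extChartAt (𝓡 (n + 1)) x₀).target := isOpen_extChartAt_target x₀
  have h1 := (contMDiffOn_extChartAt_symm (I := 𝓡 (n + 1)) (n := ∞) x₀).contMDiffOn_tangentMapWithin
    (m := ∞) (by simp) hopen.uniqueMDiffOn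
  have h2 : ContMDiffOn 𝓘(ℝ, CoordSpace n) 𝓘(ℝ, CoordSpace n).tangent ∞
      (fun y ↦ (⟨y, u⟩ : TangentBundle 𝓘(ℝ, CoordSpace n) (CoordSpace n)))
      (extChartAt (𝓡 (n + 1)) x₀).target :=
    contMDiffOn_vectorSpace_iff_contDiffOn.2 contDiffOn_const
  refine (h1.comp h2 fun y hy ↦ hy).congr fun y hy ↦ ?_
  simp only [Function.comp, tangentMapWithin]
  rw [mfderivWithin_of_isOpen hopen hy]

lemma contDiffOn_chartMetric (g : LorentzMetric n M) (x₀ : M) :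
    ContDiffOn ℝ ∞ (g.chartMetric x₀) (extChartAt (𝓡 (n + 1)) x₀).target := by
  refine contDiffOn_clm_apply.2 fun u ↦ contDiffOn_clm_apply.2 fun v ↦ ?_
  rw [← contMDiffOn_iff_contDiffOn]
  intro y hy
  have : ContMDiffWithinAt 𝓘(ℝ, CoordSpace n) ((𝓡 (n + 1)).prod 𝓘(ℝ)) ∞
      (fun y ↦ Bundle.TotalSpace.mk' ℝ (E := Bundle.Trivial M ℝ)
        ((extChartAt (𝓡 (n + 1)) x₀).symm y) (g.val ((extChartAt (𝓡 (n + 1)) x₀).symm y)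
          (mfderiv 𝓘(ℝ, CoordSpace n) (𝓡 (n + 1)) (extChartAt (𝓡 (n + 1)) x₀).symm y u)
          (mfderiv 𝓘(ℝ, CoordSpace n) (𝓡 (n + 1)) (extChartAt (𝓡 (n + 1)) x₀).symm y v)))
      (extChartAt (𝓡 (n + 1)) x₀).target y := by
    apply ContMDiffWithinAt.clm_bundle_apply₂ (F₁ := CoordSpace n) (F₂ := CoordSpace n)
    · exact ContMDiffAt.comp_contMDiffWithinAt y g.contMDiff.contMDiffAt
        (contMDiffOn_extChartAt_symm (I := 𝓡 (n + 1)) (n := ∞) x₀ y hy)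
    · exact contMDiffOn_mfderiv_symm x₀ u y hy
    · exact contMDiffOn_mfderiv_symm x₀ v y hy
  simp only [Bundle.contMDiffWithinAt_totalSpace] at this
  exact this.2

end LorentzMetric

namespace LorentzMetric

variable {n : ℕ} {M : Type*} [TopologicalSpace M]
  [ChartedSpace (EuclideanSpace ℝ (Fin (n + 1))) M] [IsManifold (𝓡 (n + 1)) ∞ M]

lemma contDiffOn_coordMetric (g : LorentzMetric n M) (x₀ : M) (i j : Fin (n + 1)) :
    ContDiffOn ℝ ∞ (g.coordMetric x₀ i j) (extChartAt (𝓡 (n + 1)) x₀).target := by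
  have := (contDiffOn_clm_apply.1 (contDiffOn_clm_apply.1 (g.contDiffOn_chartMetric x₀)
    (coordBasis i)) (coordBasis j))
  exact this

lemma hasFDerivAt_chartMetric (g : LorentzMetric n M) (x₀ : M) {y : CoordSpace n}
    (hy : y ∈ (extChartAt (𝓡 (n + 1)) x₀).target) :
    HasFDerivAt (g.chartMetric x₀) (fderiv ℝ (g.chartMetric x₀) y) y :=
  (((g.contDiffOn_chartMetric x₀).contDiffAt
    ((isOpen_extChartAt_target x₀).mem_nhds hy)).differentiableAt (by simp)).hasFDerivAt

lemma pd_coordMetric (g : LorentzMetric n M) (x₀ : M) {y : CoordSpace n}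
    (hy : y ∈ (extChartAt (𝓡 (n + 1)) x₀).target) (i j k : Fin (n + 1)) :
    pd i (g.coordMetric x₀ j k) y =
      fderiv ℝ (g.chartMetric x₀) y (coordBasis i) (coordBasis j) (coordBasis k) := by
  have := ((g.hasFDerivAt_chartMetric x₀ hy).clm_apply
    (hasFDerivAt_const (coordBasis j) y)).clm_apply (hasFDerivAt_const (coordBasis k) y)
  change fderiv ℝ (fun y ↦ g.chartMetric x₀ y (coordBasis j) (coordBasis k)) y _ = _
  rw [this.fderiv]
  simp

lemma det_coordMetric_ne_zero (g : LorentzMetric n M) (x₀ : M) {y : CoordSpace n}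
    (hy : y ∈ (extChartAt (𝓡 (n + 1)) x₀).target) :
    (Matrix.of fun k l ↦ g.coordMetric x₀ k l y).det ≠ 0 := by
  intro h0
  obtain ⟨v, hv, hv0⟩ := Matrix.exists_mulVec_eq_zero_iff.2 h0
  apply hv
  have : (∑ l, v l • (coordBasis l : CoordSpace n)) = 0 := by
    apply (g.isLorentzForm_chartMetric x₀ hy).nondegenerate
    refine CoordSpace.eq_of_isLinearMap (f' := fun _ ↦ 0) ⟨map_add _, map_smul _⟩
      ⟨by simp, by simp⟩ fun k ↦ ?_
    rw [(g.isLorentzForm_chartMetric x₀ hy).symm]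
    have := congrFun hv0 k
    simp only [Matrix.mulVec, dotProduct, Matrix.of_apply, Pi.zero_apply, coordMetric_eq] at this
    rw [← this]
    simp [mul_comm]
  funext l
  have := congrArg (fun w : CoordSpace n ↦ w l) this
  simpa [coordBasis, Finset.sum_apply, Pi.single_apply] using this

lemma contDiffOn_coordInverse (g : LorentzMetric n M) (x₀ : M) (i j : Fin (n + 1)) :
    ContDiffOn ℝ ∞ (g.coordInverse x₀ i j) (extChartAt (𝓡 (n + 1)) x₀).target :=
  contDiffOn_matrix_inv (fun k l ↦ g.contDiffOn_coordMetric x₀ k l)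
    (fun _ hy ↦ g.det_coordMetric_ne_zero x₀ hy) i j

lemma _root_.ContDiffOn.pd {f : CoordSpace n → ℝ} {s : Set (CoordSpace n)} (hs : IsOpen s)
    (hf : ContDiffOn ℝ ∞ f s) (i : Fin (n + 1)) :
    ContDiffOn ℝ ∞ (LorentzMetric.pd i f) s :=
  (hf.fderiv_of_isOpen hs (by simp)).clm_apply contDiffOn_const

lemma contDiffOn_christoffel (g : LorentzMetric n M) (x₀ : M) (k i j : Fin (n + 1)) :
    ContDiffOn ℝ ∞ (g.christoffel x₀ k i j) (extChartAt (𝓡 (n + 1)) x₀).target := by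
  have ho : IsOpen (extChartAt (𝓡 (n + 1)) x₀).target := isOpen_extChartAt_target x₀
  refine contDiffOn_const.mul (ContDiffOn.sum fun l _ ↦ (g.contDiffOn_coordInverse x₀ k l).mul ?_)
  exact (((g.contDiffOn_coordMetric x₀ j l).pd ho i).add
    ((g.contDiffOn_coordMetric x₀ i l).pd ho j)).sub ((g.contDiffOn_coordMetric x₀ i j).pd ho l)

/-- The Christoffel symbols in the chart at `x₀`, as a field of bilinear maps. -/
def chartGamma (g : LorentzMetric n M) (x₀ : M) (y : CoordSpace n) :
    CoordSpace n →L[ℝ] CoordSpace n →L[ℝ] CoordSpace n :=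
  ∑ k, ∑ i, ∑ j, g.christoffel x₀ k i j y •
    (EuclideanSpace.proj i : CoordSpace n →L[ℝ] ℝ).smulRight
      ((EuclideanSpace.proj j : CoordSpace n →L[ℝ] ℝ).smulRight (coordBasis k))

lemma chartGamma_apply (g : LorentzMetric n M) (x₀ : M) (y u v : CoordSpace n) (k : Fin (n + 1)) :
    g.chartGamma x₀ y u v k = ∑ i, ∑ j, g.christoffel x₀ k i j y * u i * v j := by
  simp only [chartGamma, _root_.sum_apply, _root_.smul_apply, ContinuousLinearMap.smulRight_apply]
  simp [coordBasis, Finset.sum_apply, Pi.single_apply, mul_assoc]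

lemma chartGamma_coordBasis (g : LorentzMetric n M) (x₀ : M) (y : CoordSpace n)
    (k i j : Fin (n + 1)) :
    g.chartGamma x₀ y (coordBasis i) (coordBasis j) k = g.christoffel x₀ k i j y := by
  rw [chartGamma_apply]
  simp [coordBasis]

lemma contDiffOn_chartGamma (g : LorentzMetric n M) (x₀ : M) :
    ContDiffOn ℝ ∞ (g.chartGamma x₀) (extChartAt (𝓡 (n + 1)) x₀).target :=
  ContDiffOn.sum fun k _ ↦ ContDiffOn.sum fun i _ ↦ ContDiffOn.sum fun j _ ↦
    (g.contDiffOn_christoffel x₀ k i j).smul contDiffOn_const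

lemma coordMetric_symm (g : LorentzMetric n M) (x₀ : M) (i j : Fin (n + 1)) :
    g.coordMetric x₀ i j = g.coordMetric x₀ j i := by
  funext y
  exact g.chartMetric_symm x₀ y _ _

lemma christoffel_symm (g : LorentzMetric n M) (x₀ : M) (k i j : Fin (n + 1)) (y : CoordSpace n) :
    g.christoffel x₀ k i j y = g.christoffel x₀ k j i y := by
  simp only [christoffel, g.coordMetric_symm x₀ i j, add_comm (pd i _ y)]

lemma chartGamma_symm (g : LorentzMetric n M) (x₀ : M) (y u v : CoordSpace n) :
    g.chartGamma x₀ y u v = g.chartGamma x₀ y v u := by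
  ext k
  rw [chartGamma_apply, chartGamma_apply, Finset.sum_comm]
  refine Finset.sum_congr rfl fun i _ ↦ Finset.sum_congr rfl fun j _ ↦ ?_
  rw [g.christoffel_symm]
  ring

/-- The Koszul formula. -/
lemma chartMetric_chartGamma (g : LorentzMetric n M) (x₀ : M) {y : CoordSpace n}
    (hy : y ∈ (extChartAt (𝓡 (n + 1)) x₀).target) (u v w : CoordSpace n) :
    g.chartMetric x₀ y (g.chartGamma x₀ y u v) w =
      (1 / 2) * (fderiv ℝ (g.chartMetric x₀) y u v w + fderiv ℝ (g.chartMetric x₀) y v u w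
        - fderiv ℝ (g.chartMetric x₀) y w u v) := by
  refine CoordSpace.eq_of_isLinearMap (f := fun u ↦ g.chartMetric x₀ y (g.chartGamma x₀ y u v) w)
    (f' := fun u ↦ (1 / 2) * (fderiv ℝ (g.chartMetric x₀) y u v w
      + fderiv ℝ (g.chartMetric x₀) y v u w - fderiv ℝ (g.chartMetric x₀) y w u v))
    ⟨by intros; simp, by intros; simp⟩ ⟨by intros; simp; ring, by intros; simp; ring⟩ (fun i ↦ ?_) u
  refine CoordSpace.eq_of_isLinearMap
    (f := fun v ↦ g.chartMetric x₀ y (g.chartGamma x₀ y (coordBasis i) v) w)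
    (f' := fun v ↦ (1 / 2) * (fderiv ℝ (g.chartMetric x₀) y (coordBasis i) v w
      + fderiv ℝ (g.chartMetric x₀) y v (coordBasis i) w
      - fderiv ℝ (g.chartMetric x₀) y w (coordBasis i) v))
    ⟨by intros; simp, by intros; simp⟩ ⟨by intros; simp; ring, by intros; simp; ring⟩ (fun j ↦ ?_) v
  refine CoordSpace.eq_of_isLinearMap
    (f := fun w ↦ g.chartMetric x₀ y (g.chartGamma x₀ y (coordBasis i) (coordBasis j)) w)
    (f' := fun w ↦ (1 / 2) * (fderiv ℝ (g.chartMetric x₀) y (coordBasis i) (coordBasis j) w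
      + fderiv ℝ (g.chartMetric x₀) y (coordBasis j) (coordBasis i) w
      - fderiv ℝ (g.chartMetric x₀) y w (coordBasis i) (coordBasis j)))
    ⟨by intros; simp, by intros; simp⟩ ⟨by intros; simp; ring, by intros; simp; ring⟩ (fun l ↦ ?_) w
  simp only [← g.pd_coordMetric x₀ hy]
  rw [(g.chartGamma x₀ y (coordBasis i) (coordBasis j)).sum_coords]
  simp only [chartGamma_coordBasis, map_sum, map_smul, _root_.sum_apply, _root_.smul_apply,
    smul_eq_mul, ← coordMetric_eq, christoffel]
  set A : Matrix (Fin (n + 1)) (Fin (n + 1)) ℝ := Matrix.of fun k l ↦ g.coordMetric x₀ k l y with hA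
  have hinv : A * A⁻¹ = 1 :=
    Matrix.mul_nonsing_inv A (isUnit_iff_ne_zero.2 (g.det_coordMetric_ne_zero x₀ hy))
  set S : Fin (n + 1) → ℝ := fun m ↦ pd i (g.coordMetric x₀ j m) y + pd j (g.coordMetric x₀ i m) y
      - pd m (g.coordMetric x₀ i j) y with hS
  have e : ∀ k, g.coordMetric x₀ k l y = A l k := fun k ↦ by
    rw [hA, Matrix.of_apply, g.coordMetric_symm x₀ l k]
  have e2 : ∀ k m, g.coordInverse x₀ k m y = A⁻¹ k m := fun k m ↦ rfl
  simp only [e, e2]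
  calc ∑ k, 1 / 2 * (∑ m, A⁻¹ k m * S m) * A l k
      = 1 / 2 * ∑ m, (∑ k, A l k * A⁻¹ k m) * S m := by
        simp only [Finset.mul_sum, Finset.sum_mul]
        rw [Finset.sum_comm]
        exact Finset.sum_congr rfl fun m _ ↦ Finset.sum_congr rfl fun k _ ↦ by ring
    _ = 1 / 2 * S l := by
        simp only [← Matrix.mul_apply, hinv, Matrix.one_apply]
        simp

lemma fderiv_chartMetric_symm (g : LorentzMetric n M) (x₀ : M) {y : CoordSpace n}
    (hy : y ∈ (extChartAt (𝓡 (n + 1)) x₀).target) (a b c : CoordSpace n) :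
    fderiv ℝ (g.chartMetric x₀) y a b c = fderiv ℝ (g.chartMetric x₀) y a c b := by
  have h1 : ∀ b c, fderiv ℝ (fun z ↦ g.chartMetric x₀ z b c) y a =
      fderiv ℝ (g.chartMetric x₀) y a b c := by
    intro b c
    have := ((g.hasFDerivAt_chartMetric x₀ hy).clm_apply (hasFDerivAt_const b y)).clm_apply
      (hasFDerivAt_const c y)
    rw [this.fderiv]
    simp
  have h2 : (fun z ↦ g.chartMetric x₀ z b c) = fun z ↦ g.chartMetric x₀ z c b := by
    funext z
    exact g.chartMetric_symm x₀ z b c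
  rw [← h1, ← h1, h2]

/-- In a chart, `chartGamma` is the Levi-Civita connection of `chartMetric`. -/
lemma isLeviCivitaOn (g : LorentzMetric n M) (x₀ : M) :
    IsLeviCivitaOn (g.chartMetric x₀) (g.chartGamma x₀) (extChartAt (𝓡 (n + 1)) x₀).target where
  isOpen := isOpen_extChartAt_target x₀
  contDiffOn_metric := g.contDiffOn_chartMetric x₀
  contDiffOn_gamma := g.contDiffOn_chartGamma x₀
  metric_symm y _ := g.chartMetric_symm x₀ y
  nondegenerate _ hy _ h := (g.isLorentzForm_chartMetric x₀ hy).nondegenerate h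
  torsion_free _ _ := g.chartGamma_symm x₀ _
  compat y hy w u v := by
    rw [g.chartMetric_symm x₀ y u, g.chartMetric_chartGamma x₀ hy, g.chartMetric_chartGamma x₀ hy,
      g.fderiv_chartMetric_symm x₀ hy w v u]
    ring

end LorentzMetric

/-! ### The Ricci curvature as a trace -/

/-- The operator `u ↦ R(u, v) v` of the Jacobi equation. -/
def jacobiOperator {E : Type*} [NormedAddCommGroup E] [NormedSpace ℝ E]
    (Γ : E → E →L[ℝ] E →L[ℝ] E) (y v : E) : E →L[ℝ] E :=
  ((fderiv ℝ Γ y).flip v).flip v - (fderiv ℝ Γ y v).flip v + (Γ y).flip (Γ y v v)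
    - (Γ y v).comp ((Γ y).flip v)

lemma jacobiOperator_apply {E : Type*} [NormedAddCommGroup E] [NormedSpace ℝ E]
    (Γ : E → E →L[ℝ] E →L[ℝ] E) (y v u : E) :
    jacobiOperator Γ y v u = curvature Γ y u v v := by
  simp [jacobiOperator, curvature]

namespace LorentzMetric

variable {n : ℕ} {M : Type*} [TopologicalSpace M]
  [ChartedSpace (EuclideanSpace ℝ (Fin (n + 1))) M] [IsManifold (𝓡 (n + 1)) ∞ M]

lemma trace_eq_sum (A : CoordSpace n →L[ℝ] CoordSpace n) :
    LinearMap.trace ℝ (CoordSpace n) A = ∑ i, A (coordBasis i) i := by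
  rw [LinearMap.trace_eq_matrix_trace ℝ (EuclideanSpace.basisFun (Fin (n + 1)) ℝ).toBasis,
    Matrix.trace]
  refine Finset.sum_congr rfl fun i _ ↦ ?_
  simp [LinearMap.toMatrix_apply, coordBasis]

lemma pd_christoffel (g : LorentzMetric n M) (x₀ : M) {y : CoordSpace n}
    (hy : y ∈ (extChartAt (𝓡 (n + 1)) x₀).target) (l k i j : Fin (n + 1)) :
    pd l (g.christoffel x₀ k i j) y =
      fderiv ℝ (g.chartGamma x₀) y (coordBasis l) (coordBasis i) (coordBasis j) k := by
  have h1 := (((g.isLeviCivitaOn x₀).hasFDerivAt_gamma hy).clm_apply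
    (hasFDerivAt_const (coordBasis i) y)).clm_apply (hasFDerivAt_const (coordBasis j) y)
  have h2 := (EuclideanSpace.proj k : CoordSpace n →L[ℝ] ℝ).hasFDerivAt.comp y h1
  have e : g.christoffel x₀ k i j = (EuclideanSpace.proj k : CoordSpace n →L[ℝ] ℝ) ∘
      fun y ↦ g.chartGamma x₀ y (coordBasis i) (coordBasis j) := by
    funext z
    exact (g.chartGamma_coordBasis x₀ z k i j).symm
  rw [pd, e, h2.fderiv]
  simp

lemma coordRicci_eq (g : LorentzMetric n M) (x₀ : M) {y : CoordSpace n}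
    (hy : y ∈ (extChartAt (𝓡 (n + 1)) x₀).target) (j k : Fin (n + 1)) :
    g.coordRicci x₀ j k y =
      ∑ i, curvature (g.chartGamma x₀) y (coordBasis i) (coordBasis j) (coordBasis k) i := by
  have hcomp : ∀ (a : Fin (n + 1)) (w : CoordSpace n) (i : Fin (n + 1)),
      g.chartGamma x₀ y (coordBasis a) w i = ∑ m, g.christoffel x₀ i a m y * w m := by
    intro a w i
    rw [chartGamma_apply, Finset.sum_eq_single a]
    · simp [coordBasis]
    · intro b _ hb
      simp [coordBasis, hb]
    · simp
  have hcb : ∀ x a, ∑ m, g.christoffel x₀ x a m y * (coordBasis k : CoordSpace n) m =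
      g.christoffel x₀ x a k y := fun x a ↦ by simp [coordBasis]
  refine Finset.sum_congr rfl fun i _ ↦ ?_
  simp only [curvature, PiLp.sub_apply, PiLp.add_apply, hcomp, ← g.pd_christoffel x₀ hy,
    Finset.sum_sub_distrib, hcb]
  ring

/-- The Ricci curvature is the trace of the operator of the Jacobi equation. -/
lemma ricci_self_eq_trace (g : LorentzMetric n M) (x : M) (v : TangentSpace (𝓡 (n + 1)) x) :
    g.ricci x v v = LinearMap.trace ℝ (CoordSpace n) (jacobiOperator (g.chartGamma x)
      (extChartAt (𝓡 (n + 1)) x x)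
      (mfderiv (𝓡 (n + 1)) 𝓘(ℝ, CoordSpace n) (extChartAt (𝓡 (n + 1)) x) x v) :
        CoordSpace n →L[ℝ] CoordSpace n) := by
  have hy := mem_extChartAt_target (I := 𝓡 (n + 1)) x
  set w : CoordSpace n := mfderiv (𝓡 (n + 1)) 𝓘(ℝ, CoordSpace n) (extChartAt (𝓡 (n + 1)) x) x v
    with hw
  set y := extChartAt (𝓡 (n + 1)) x x
  have hexp : ∀ i, curvature (g.chartGamma x) y (coordBasis i) w w i = ∑ j, ∑ k,
      curvature (g.chartGamma x) y (coordBasis i) (coordBasis j) (coordBasis k) i * w j * w k := by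
    intro i
    have h1 : ∀ u : CoordSpace n, curvature (g.chartGamma x) y (coordBasis i) u w i = ∑ k,
        curvature (g.chartGamma x) y (coordBasis i) u (coordBasis k) i * w k := by
      intro u
      conv_lhs => rw [w.sum_coords]
      simp only [curvature, map_sum, map_smul, PiLp.sub_apply,
        PiLp.add_apply, WithLp.ofLp_sum, Finset.sum_apply, PiLp.smul_apply, smul_eq_mul,
        ← Finset.sum_sub_distrib, ← Finset.sum_add_distrib]
      exact Finset.sum_congr rfl fun k _ ↦ by ring
    have h2 : ∀ k, curvature (g.chartGamma x) y (coordBasis i) w (coordBasis k) i = ∑ j,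
        curvature (g.chartGamma x) y (coordBasis i) (coordBasis j) (coordBasis k) i * w j := by
      intro k
      conv_lhs => rw [w.sum_coords]
      simp only [curvature, map_sum, map_smul, _root_.sum_apply, _root_.smul_apply, PiLp.sub_apply,
        PiLp.add_apply, WithLp.ofLp_sum, Finset.sum_apply, PiLp.smul_apply, smul_eq_mul,
        ← Finset.sum_sub_distrib, ← Finset.sum_add_distrib]
      exact Finset.sum_congr rfl fun k _ ↦ by ring
    rw [h1, Finset.sum_comm]
    refine Finset.sum_congr rfl fun k _ ↦ ?_
    rw [h2, Finset.sum_mul]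
  rw [trace_eq_sum]
  simp only [jacobiOperator_apply, hexp]
  rw [Finset.sum_comm]
  refine Finset.sum_congr rfl fun j _ ↦ ?_
  rw [Finset.sum_comm]
  refine Finset.sum_congr rfl fun k _ ↦ ?_
  rw [g.coordRicci_eq x hy, Finset.sum_mul, Finset.sum_mul]
  rfl

end LorentzMetric

/-! ### Changes of charts -/

section ChartChange

variable {n : ℕ} {M : Type*} [TopologicalSpace M]
  [ChartedSpace (EuclideanSpace ℝ (Fin (n + 1))) M]

/-- The change of coordinates from the chart at `x₀` to the chart at `x₁`. -/
def chartChange (x₀ x₁ : M) (y : CoordSpace n) : CoordSpace n :=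
  extChartAt (𝓡 (n + 1)) x₁ ((extChartAt (𝓡 (n + 1)) x₀).symm y)

/-- The part of the coordinate space where `chartChange x₀ x₁` is a change of coordinates. -/
def chartOverlap (x₀ x₁ : M) : Set (CoordSpace n) :=
  (extChartAt (𝓡 (n + 1)) x₀).target ∩
    (extChartAt (𝓡 (n + 1)) x₀).symm ⁻¹' (extChartAt (𝓡 (n + 1)) x₁).source

lemma isOpen_chartOverlap (x₀ x₁ : M) : IsOpen (chartOverlap (n := n) x₀ x₁) :=
  (continuousOn_extChartAt_symm x₀).isOpen_inter_preimage (isOpen_extChartAt_target x₀)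
    (isOpen_extChartAt_source x₁)

lemma chartChange_mem {x₀ x₁ : M} {y : CoordSpace n} (hy : y ∈ chartOverlap x₀ x₁) :
    chartChange x₀ x₁ y ∈ chartOverlap x₁ x₀ := by
  refine ⟨(extChartAt (𝓡 (n + 1)) x₁).map_source hy.2, ?_⟩
  rw [mem_preimage, chartChange, (extChartAt (𝓡 (n + 1)) x₁).left_inv hy.2]
  exact (extChartAt (𝓡 (n + 1)) x₀).map_target hy.1

lemma chartChange_chartChange {x₀ x₁ : M} {y : CoordSpace n} (hy : y ∈ chartOverlap x₀ x₁) :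
    chartChange x₁ x₀ (chartChange x₀ x₁ y) = y := by
  rw [chartChange, chartChange, (extChartAt (𝓡 (n + 1)) x₁).left_inv hy.2,
    (extChartAt (𝓡 (n + 1)) x₀).right_inv hy.1]

variable [IsManifold (𝓡 (n + 1)) ∞ M]

lemma mdifferentiableAt_extChartAt_symm (x₀ : M) {y : CoordSpace n}
    (hy : y ∈ (extChartAt (𝓡 (n + 1)) x₀).target) :
    MDifferentiableAt 𝓘(ℝ, CoordSpace n) (𝓡 (n + 1)) (extChartAt (𝓡 (n + 1)) x₀).symm y :=
  ((contMDiffOn_extChartAt_symm (I := 𝓡 (n + 1)) (n := ∞) x₀).contMDiffAt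
    ((isOpen_extChartAt_target x₀).mem_nhds hy)).mdifferentiableAt (by simp)

lemma contDiffOn_chartChange (x₀ x₁ : M) :
    ContDiffOn ℝ ∞ (chartChange (n := n) x₀ x₁) (chartOverlap x₀ x₁) := by
  rw [← contMDiffOn_iff_contDiffOn]
  have h1 := (contMDiffOn_extChartAt_symm (I := 𝓡 (n + 1)) (n := ∞) x₀)
  have h2 := (contMDiffOn_extChartAt (I := 𝓡 (n + 1)) (n := ∞) (x := x₁))
  refine h2.comp (h1.mono inter_subset_left) fun y hy ↦ ?_
  rw [← extChartAt_source (𝓡 (n + 1))]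
  exact hy.2

lemma contDiffAt_chartChange {x₀ x₁ : M} {y : CoordSpace n} (hy : y ∈ chartOverlap x₀ x₁) :
    ContDiffAt ℝ ∞ (chartChange (n := n) x₀ x₁) y :=
  (contDiffOn_chartChange x₀ x₁).contDiffAt ((isOpen_chartOverlap x₀ x₁).mem_nhds hy)

lemma fderiv_chartChange_comp {x₀ x₁ : M} {y : CoordSpace n} (hy : y ∈ chartOverlap x₀ x₁) :
    (fderiv ℝ (chartChange (n := n) x₁ x₀) (chartChange x₀ x₁ y)).comp
      (fderiv ℝ (chartChange (n := n) x₀ x₁) y) = ContinuousLinearMap.id ℝ _ := by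
  have h1 : DifferentiableAt ℝ (chartChange (n := n) x₀ x₁) y :=
    (contDiffAt_chartChange hy).differentiableAt (by simp)
  have h2 : DifferentiableAt ℝ (chartChange (n := n) x₁ x₀) (chartChange x₀ x₁ y) :=
    (contDiffAt_chartChange (chartChange_mem hy)).differentiableAt (by simp)
  rw [← fderiv_comp y h2 h1]
  have : chartChange x₁ x₀ ∘ chartChange x₀ x₁ =ᶠ[𝓝 y] id := by
    filter_upwards [(isOpen_chartOverlap x₀ x₁).mem_nhds hy] with z hz
      using chartChange_chartChange hz
  rw [this.fderiv_eq, fderiv_id]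

lemma fderiv_chartChange_surjective {x₀ x₁ : M} {y : CoordSpace n} (hy : y ∈ chartOverlap x₀ x₁) :
    Function.Surjective (fderiv ℝ (chartChange (n := n) x₀ x₁) y) := by
  intro v
  have h := fderiv_chartChange_comp (chartChange_mem hy)
  rw [chartChange_chartChange hy] at h
  exact ⟨_, DFunLike.congr_fun h v⟩

lemma mfderiv_symm_chartChange {x₀ x₁ : M} {y : CoordSpace n} (hy : y ∈ chartOverlap x₀ x₁)
    (u : CoordSpace n) :
    (mfderiv 𝓘(ℝ, CoordSpace n) (𝓡 (n + 1)) (extChartAt (𝓡 (n + 1)) x₁).symm (chartChange x₀ x₁ y)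
      (fderiv ℝ (chartChange (n := n) x₀ x₁) y u) : CoordSpace n) =
    mfderiv 𝓘(ℝ, CoordSpace n) (𝓡 (n + 1)) (extChartAt (𝓡 (n + 1)) x₀).symm y u := by
  have h1 : MDifferentiableAt 𝓘(ℝ, CoordSpace n) 𝓘(ℝ, CoordSpace n) (chartChange (n := n) x₀ x₁) y :=
    ((contDiffAt_chartChange hy).differentiableAt (by simp)).mdifferentiableAt
  have h2 := mdifferentiableAt_extChartAt_symm x₁ (chartChange_mem hy).1
  have h3 := mfderiv_comp y h2 h1
  have e : (extChartAt (𝓡 (n + 1)) x₁).symm ∘ chartChange x₀ x₁ =ᶠ[𝓝 y]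
      (extChartAt (𝓡 (n + 1)) x₀).symm := by
    filter_upwards [(isOpen_chartOverlap x₀ x₁).mem_nhds hy] with z hz
      using (extChartAt (𝓡 (n + 1)) x₁).left_inv hz.2
  rw [e.mfderiv_eq, mfderiv_eq_fderiv] at h3
  exact (DFunLike.congr_fun h3 u).symm

namespace LorentzMetric

lemma chartMetric_chartChange (g : LorentzMetric n M) {x₀ x₁ : M} {y : CoordSpace n}
    (hy : y ∈ chartOverlap x₀ x₁) (u v : CoordSpace n) :
    g.chartMetric x₀ y u v = g.chartMetric x₁ (chartChange x₀ x₁ y)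
      (fderiv ℝ (chartChange (n := n) x₀ x₁) y u) (fderiv ℝ (chartChange (n := n) x₀ x₁) y v) := by
  have e : (extChartAt (𝓡 (n + 1)) x₁).symm (chartChange x₀ x₁ y) =
      (extChartAt (𝓡 (n + 1)) x₀).symm y := (extChartAt (𝓡 (n + 1)) x₁).left_inv hy.2
  have key : ∀ (p q : M) (_ : p = q) (a b a' b' : CoordSpace n), a = a' → b = b' →
      (g.val p : CoordSpace n →L[ℝ] CoordSpace n →L[ℝ] ℝ) a b =
      (g.val q : CoordSpace n →L[ℝ] CoordSpace n →L[ℝ] ℝ) a' b' := by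
    rintro p q rfl a b a' b' rfl rfl
    rfl
  exact key _ _ e.symm _ _ _ _ (mfderiv_symm_chartChange hy u).symm
    (mfderiv_symm_chartChange hy v).symm

/-- The transformation law of the Christoffel symbols for changes of charts. -/
lemma chartGamma_chartChange (g : LorentzMetric n M) {x₀ x₁ : M} {y : CoordSpace n}
    (hy : y ∈ chartOverlap x₀ x₁) (u v : CoordSpace n) :
    fderiv ℝ (fderiv ℝ (chartChange (n := n) x₀ x₁)) y u v
      + g.chartGamma x₁ (chartChange x₀ x₁ y) (fderiv ℝ (chartChange (n := n) x₀ x₁) y u)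
        (fderiv ℝ (chartChange (n := n) x₀ x₁) y v)
      = fderiv ℝ (chartChange (n := n) x₀ x₁) y (g.chartGamma x₀ y u v) :=
  (g.isLeviCivitaOn x₀).transition (g.isLeviCivitaOn x₁) hy.1 (chartChange_mem hy).1
    ((contDiffAt_chartChange hy).of_le (by simpa using WithTop.coe_le_coe.2 (le_top : (2 : ℕ∞) ≤ ⊤)))
    (by filter_upwards [(isOpen_chartOverlap x₀ x₁).mem_nhds hy] with z hz u v
          using g.chartMetric_chartChange hz u v)
    (fderiv_chartChange_surjective hy) u v

end LorentzMetric

end ChartChange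

/-! ### The geodesic equation as a first order system -/

section GeodesicField

variable {E : Type*} [NormedAddCommGroup E] [NormedSpace ℝ E]

/-- The vector field on the space of positions and velocities whose integral curves are the
solutions of the geodesic equation. -/
def geodesicField (Γ : E → E →L[ℝ] E →L[ℝ] E) (z : E × E) : E × E := (z.2, -Γ z.1 z.2 z.2)

lemma IsLeviCivitaOn.contDiffOn_geodesicField {G : E → E →L[ℝ] E →L[ℝ] ℝ}
    {Γ : E → E →L[ℝ] E →L[ℝ] E} {U : Set E} (h : IsLeviCivitaOn G Γ U) :
    ContDiffOn ℝ ∞ (geodesicField Γ) (U ×ˢ univ) :=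
  contDiffOn_snd.prodMk (((h.contDiffOn_gamma.comp contDiffOn_fst fun _ hz ↦ hz.1).clm_apply
    contDiffOn_snd).clm_apply contDiffOn_snd).neg

/-- The linearized geodesic equation. -/
lemma IsLeviCivitaOn.fderiv_geodesicField {G : E → E →L[ℝ] E →L[ℝ] ℝ}
    {Γ : E → E →L[ℝ] E →L[ℝ] E} {U : Set E} (h : IsLeviCivitaOn G Γ U) {z : E × E} (hz : z.1 ∈ U)
    (w : E × E) : fderiv ℝ (geodesicField Γ) z w =
      (w.2, -(fderiv ℝ Γ z.1 w.1 z.2 z.2 + Γ z.1 w.2 z.2 + Γ z.1 z.2 w.2)) := by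
  have h1 : HasFDerivAt (fun z : E × E ↦ Γ z.1)
      ((fderiv ℝ Γ z.1).comp (ContinuousLinearMap.fst ℝ E E)) z :=
    HasFDerivAt.comp z (f := Prod.fst) (h.hasFDerivAt_gamma hz) hasFDerivAt_fst
  have h2 := (h1.clm_apply (hasFDerivAt_snd (p := z))).clm_apply (hasFDerivAt_snd (p := z))
  have h3 : HasFDerivAt (geodesicField Γ) _ z := (hasFDerivAt_snd (p := z)).prodMk h2.neg
  rw [h3.fderiv]
  simp
  abel

end GeodesicField

section Geodesics

variable {n : ℕ} {M : Type*} [TopologicalSpace M]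
  [ChartedSpace (EuclideanSpace ℝ (Fin (n + 1))) M]

/-- Position and velocity of a curve in the chart at `x₀`. -/
def chartState (x₀ : M) (c : ℝ → M) (s : ℝ) : CoordSpace n × CoordSpace n :=
  (extChartAt (𝓡 (n + 1)) x₀ (c s), deriv (fun r ↦ extChartAt (𝓡 (n + 1)) x₀ (c r)) s)

lemma chartState_congr {x₀ : M} {c c' : ℝ → M} {s : ℝ} (h : c =ᶠ[𝓝 s] c') :
    chartState (n := n) x₀ c s = chartState x₀ c' s := by
  have h' : (fun r ↦ extChartAt (𝓡 (n + 1)) x₀ (c r)) =ᶠ[𝓝 s]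
    fun r ↦ extChartAt (𝓡 (n + 1)) x₀ (c' r) := h.mono fun r hr ↦ by simp only [hr]
  rw [chartState, chartState, h'.deriv_eq, h.self_of_nhds]

lemma mem_chartOverlap {x₀ x₁ x : M} (h0 : x ∈ (extChartAt (𝓡 (n + 1)) x₀).source)
    (h1 : x ∈ (extChartAt (𝓡 (n + 1)) x₁).source) :
    extChartAt (𝓡 (n + 1)) x₀ x ∈ chartOverlap (n := n) x₀ x₁ := by
  refine ⟨(extChartAt (𝓡 (n + 1)) x₀).map_source h0, ?_⟩
  rw [mem_preimage, (extChartAt (𝓡 (n + 1)) x₀).left_inv h0]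
  exact h1

variable [IsManifold (𝓡 (n + 1)) ∞ M]

lemma contDiffAt_extChartAt_comp {x₀ : M} {c : ℝ → M} {s : ℝ} {k : WithTop ℕ∞} (hk : k ≤ ∞)
    (hc : ContMDiffAt 𝓘(ℝ, ℝ) (𝓡 (n + 1)) k c s)
    (hs : c s ∈ (extChartAt (𝓡 (n + 1)) x₀).source) :
    ContDiffAt ℝ k (fun r ↦ extChartAt (𝓡 (n + 1)) x₀ (c r)) s := by
  rw [extChartAt_source] at hs
  exact (ContMDiffAt.comp s ((contMDiffAt_extChartAt' hs).of_le hk) hc).contDiffAt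

lemma hasDerivAt_extChartAt_comp {x₀ : M} {c : ℝ → M} {s : ℝ}
    (hc : MDifferentiableAt 𝓘(ℝ, ℝ) (𝓡 (n + 1)) c s)
    (hs : c s ∈ (extChartAt (𝓡 (n + 1)) x₀).source) :
    HasDerivAt (fun r ↦ extChartAt (𝓡 (n + 1)) x₀ (c r))
      (mfderiv (𝓡 (n + 1)) 𝓘(ℝ, CoordSpace n) (extChartAt (𝓡 (n + 1)) x₀) (c s)
        (LorentzMetric.velocity (n := n) c s) : CoordSpace n) s := by
  have hs' := hs
  rw [extChartAt_source] at hs'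
  have : IsManifold (𝓡 (n + 1)) 1 M := IsManifold.of_le (n := ∞) (by exact_mod_cast le_top)
  have h1 := (mdifferentiableAt_extChartAt (I := 𝓡 (n + 1)) hs').hasMFDerivAt
  let D : ℝ →L[ℝ] CoordSpace n :=
    (mfderiv (𝓡 (n + 1)) 𝓘(ℝ, CoordSpace n) (extChartAt (𝓡 (n + 1)) x₀) (c s)).comp
      (mfderiv 𝓘(ℝ, ℝ) (𝓡 (n + 1)) c s)
  have h2 : HasFDerivAt (fun r ↦ extChartAt (𝓡 (n + 1)) x₀ (c r)) D s :=
    (h1.comp s hc.hasMFDerivAt).hasFDerivAt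
  exact h2.hasDerivAt

/-- The change of coordinates of the tangent bundle that belongs to a change of charts. -/
def tangentChange (x₀ x₁ : M) (z : CoordSpace n × CoordSpace n) : CoordSpace n × CoordSpace n :=
  (chartChange x₀ x₁ z.1, fderiv ℝ (chartChange x₀ x₁) z.1 z.2)

lemma hasFDerivAt_tangentChange {x₀ x₁ : M} {z : CoordSpace n × CoordSpace n}
    (hz : z.1 ∈ chartOverlap x₀ x₁) :
    ∃ L : CoordSpace n × CoordSpace n →L[ℝ] CoordSpace n × CoordSpace n,
      HasFDerivAt (tangentChange (n := n) x₀ x₁) L z ∧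
      ∀ w, L w = (fderiv ℝ (chartChange x₀ x₁) z.1 w.1,
        fderiv ℝ (fderiv ℝ (chartChange x₀ x₁)) z.1 w.1 z.2
          + fderiv ℝ (chartChange x₀ x₁) z.1 w.2) := by
  have h := contDiffAt_chartChange hz
  have h1 : HasFDerivAt (chartChange (n := n) x₀ x₁) (fderiv ℝ (chartChange x₀ x₁) z.1) z.1 :=
    (h.differentiableAt (by simp)).hasFDerivAt
  have h2 : HasFDerivAt (fderiv ℝ (chartChange (n := n) x₀ x₁))
      (fderiv ℝ (fderiv ℝ (chartChange x₀ x₁)) z.1) z.1 :=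
    ((h.fderiv_right (m := ∞) (by simp)).differentiableAt (by simp)).hasFDerivAt
  have h3 := HasFDerivAt.comp z (f := Prod.fst) h1 hasFDerivAt_fst
  have h4 := (HasFDerivAt.comp z (f := Prod.fst) h2 hasFDerivAt_fst).clm_apply
    (hasFDerivAt_snd (p := z))
  refine ⟨_, h3.prodMk h4, fun w ↦ ?_⟩
  simp [add_comm]

/-- Transformation of position and velocity under a change of charts. -/
lemma chartState_chartChange {x₀ x₁ : M} {c : ℝ → M} {s : ℝ}
    (hc : MDifferentiableAt 𝓘(ℝ, ℝ) (𝓡 (n + 1)) c s)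
    (h0 : c s ∈ (extChartAt (𝓡 (n + 1)) x₀).source)
    (h1 : c s ∈ (extChartAt (𝓡 (n + 1)) x₁).source) :
    chartState (n := n) x₁ c s = tangentChange x₀ x₁ (chartState x₀ c s) := by
  have hy := mem_chartOverlap h0 h1
  have h2 : HasFDerivAt (chartChange (n := n) x₀ x₁) (fderiv ℝ (chartChange x₀ x₁)
      (extChartAt (𝓡 (n + 1)) x₀ (c s))) (extChartAt (𝓡 (n + 1)) x₀ (c s)) :=
    ((contDiffAt_chartChange hy).differentiableAt (by simp)).hasFDerivAt
  have h3 := (hasDerivAt_extChartAt_comp hc h0).differentiableAt.hasDerivAt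
  have h4 := HasFDerivAt.comp_hasDerivAt s h2 h3
  have e : (fun r ↦ extChartAt (𝓡 (n + 1)) x₁ (c r)) =ᶠ[𝓝 s]
      chartChange (n := n) x₀ x₁ ∘ fun r ↦ extChartAt (𝓡 (n + 1)) x₀ (c r) := by
    filter_upwards [hc.continuousAt.eventually_mem ((isOpen_extChartAt_source x₀).mem_nhds h0)]
      with r hr
    simp only [Function.comp, chartChange]
    rw [(extChartAt (𝓡 (n + 1)) x₀).left_inv hr]
  exact Prod.ext e.self_of_nhds (e.deriv_eq.trans h4.deriv)

namespace LorentzMetric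

/-- The geodesic equation at one parameter, in all charts around the point of the curve. -/
def IsGeodesicAt (g : LorentzMetric n M) (c : ℝ → M) (s : ℝ) : Prop :=
  ContMDiffAt 𝓘(ℝ, ℝ) (𝓡 (n + 1)) 2 c s ∧
  ∀ x₀ : M, c s ∈ (extChartAt (𝓡 (n + 1)) x₀).source → ∀ k,
    deriv (deriv fun r ↦ extChartAt (𝓡 (n + 1)) x₀ (c r) k) s
      + ∑ i, ∑ j, g.christoffel x₀ k i j (extChartAt (𝓡 (n + 1)) x₀ (c s)) *
        deriv (fun r ↦ extChartAt (𝓡 (n + 1)) x₀ (c r) i) s *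
        deriv (fun r ↦ extChartAt (𝓡 (n + 1)) x₀ (c r) j) s = 0

lemma isGeodesicOn_iff (g : LorentzMetric n M) {c : ℝ → M} {J : Set ℝ} (hJ : IsOpen J) :
    g.IsGeodesicOn c J ↔ ∀ s ∈ J, g.IsGeodesicAt c s := by
  constructor
  · intro h s hs
    exact ⟨h.1.contMDiffAt (hJ.mem_nhds hs), fun x₀ hx₀ ↦ h.2 x₀ s hs hx₀⟩
  · intro h
    exact ⟨fun s hs ↦ (h s hs).1.contMDiffWithinAt, fun x₀ s hs hx₀ ↦ (h s hs).2 x₀ hx₀⟩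

lemma IsGeodesicAt.congr {g : LorentzMetric n M} {c c' : ℝ → M} {s : ℝ} (h : g.IsGeodesicAt c s)
    (he : c' =ᶠ[𝓝 s] c) : g.IsGeodesicAt c' s := by
  have hd : ∀ (x₀ : M) (k : Fin (n + 1)), (fun r ↦ extChartAt (𝓡 (n + 1)) x₀ (c' r) k) =ᶠ[𝓝 s]
      fun r ↦ extChartAt (𝓡 (n + 1)) x₀ (c r) k := fun x₀ k ↦ he.mono fun r hr ↦ by simp only [hr]
  refine ⟨h.1.congr_of_eventuallyEq he, fun x₀ hx₀ k ↦ ?_⟩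
  have h0 := he.self_of_nhds
  rw [h0] at hx₀ ⊢
  rw [(hd x₀ k).deriv.deriv_eq]
  simp only [(hd x₀ _).deriv_eq]
  exact h.2 x₀ hx₀ k

lemma IsGeodesicAt.mdifferentiableAt {g : LorentzMetric n M} {c : ℝ → M} {s : ℝ}
    (h : g.IsGeodesicAt c s) : MDifferentiableAt 𝓘(ℝ, ℝ) (𝓡 (n + 1)) c s :=
  h.1.mdifferentiableAt (by simp)

theorem two_le_infty : (2 : WithTop ℕ∞) ≤ ∞ := WithTop.coe_le_coe.2 (le_top : (2 : ℕ∞) ≤ ⊤)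

/-- For a curve of class `C^2`, the geodesic equation in the chart at `x₀` says that position and
velocity form an integral curve of `geodesicField`. -/
lemma hasDerivAt_chartState_iff (g : LorentzMetric n M) {c : ℝ → M} {s : ℝ} {x₀ : M}
    (hc : ContMDiffAt 𝓘(ℝ, ℝ) (𝓡 (n + 1)) 2 c s)
    (hs : c s ∈ (extChartAt (𝓡 (n + 1)) x₀).source) :
    HasDerivAt (chartState (n := n) x₀ c) (geodesicField (g.chartGamma x₀) (chartState x₀ c s)) s ↔
    ∀ k, deriv (deriv fun r ↦ extChartAt (𝓡 (n + 1)) x₀ (c r) k) s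
      + ∑ i, ∑ j, g.christoffel x₀ k i j (extChartAt (𝓡 (n + 1)) x₀ (c s)) *
        deriv (fun r ↦ extChartAt (𝓡 (n + 1)) x₀ (c r) i) s *
        deriv (fun r ↦ extChartAt (𝓡 (n + 1)) x₀ (c r) j) s = 0 := by
  have hx := contDiffAt_extChartAt_comp two_le_infty hc hs
  set x : ℝ → CoordSpace n := fun r ↦ extChartAt (𝓡 (n + 1)) x₀ (c r) with hxdef
  have hev : ∀ᶠ r in 𝓝 s, DifferentiableAt ℝ x r := by
    filter_upwards [hx.eventually (by simp)] with r hr using hr.differentiableAt (by simp)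
  have hcoord : ∀ {f : ℝ → CoordSpace n} {r : ℝ}, DifferentiableAt ℝ f r → ∀ k,
      deriv (fun r ↦ f r k) r = deriv f r k := fun hf k ↦
    ((EuclideanSpace.proj k : CoordSpace n →L[ℝ] ℝ).hasFDerivAt.comp_hasDerivAt _
      hf.hasDerivAt).deriv
  have hdx : DifferentiableAt ℝ (deriv x) s := by
    have := ((hx.fderiv_right (m := 1) (by norm_num)).clm_apply
      (contDiffAt_const (c := (1 : ℝ)))).differentiableAt (by simp)
    exact this
  have e1 : ∀ k, deriv (deriv fun r ↦ x r k) s = deriv (deriv x) s k := by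
    intro k
    have : deriv (fun r ↦ x r k) =ᶠ[𝓝 s] fun r ↦ deriv x r k :=
      hev.mono fun r hr ↦ hcoord hr k
    rw [this.deriv_eq, hcoord hdx]
  have e2 : ∀ k, ∑ i, ∑ j, g.christoffel x₀ k i j (x s) * deriv (fun r ↦ x r i) s *
      deriv (fun r ↦ x r j) s = g.chartGamma x₀ (x s) (deriv x s) (deriv x s) k := by
    intro k
    rw [chartGamma_apply]
    simp only [hcoord hev.self_of_nhds]
  have e3 : HasDerivAt (chartState (n := n) x₀ c) (deriv x s, deriv (deriv x) s) s :=
    hev.self_of_nhds.hasDerivAt.prodMk hdx.hasDerivAt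
  have e4 : (∀ k, deriv (deriv fun r ↦ x r k) s + ∑ i, ∑ j, g.christoffel x₀ k i j (x s) *
      deriv (fun r ↦ x r i) s * deriv (fun r ↦ x r j) s = 0) ↔
      deriv (deriv x) s = -g.chartGamma x₀ (x s) (deriv x s) (deriv x s) := by
    simp only [e1, e2]
    constructor
    · intro h
      ext k
      simpa using eq_neg_of_add_eq_zero_left (h k)
    · intro h k
      simp [h]
  refine Iff.trans ⟨fun h ↦ ?_, fun h ↦ ?_⟩ e4.symm
  · exact congrArg Prod.snd (e3.unique h)
  · rw [h] at e3
    exact e3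

end LorentzMetric
end Geodesics

namespace LorentzMetric

variable {n : ℕ} {M : Type*} [TopologicalSpace M]
  [ChartedSpace (EuclideanSpace ℝ (Fin (n + 1))) M] [IsManifold (𝓡 (n + 1)) ∞ M]

lemma IsGeodesicAt.hasDerivAt_chartState {g : LorentzMetric n M} {c : ℝ → M} {s : ℝ} {x₀ : M}
    (h : g.IsGeodesicAt c s) (hs : c s ∈ (extChartAt (𝓡 (n + 1)) x₀).source) :
    HasDerivAt (chartState (n := n) x₀ c)
      (geodesicField (g.chartGamma x₀) (chartState x₀ c s)) s :=
  (g.hasDerivAt_chartState_iff h.1 hs).2 (h.2 x₀ hs)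

/-- By the transformation law of the Christoffel symbols, it is enough to check the geodesic
equation in one chart. -/
lemma isGeodesicAt_of_hasDerivAt (g : LorentzMetric n M) {c : ℝ → M} {s : ℝ} {x₀ : M}
    (hc : ContMDiffAt 𝓘(ℝ, ℝ) (𝓡 (n + 1)) 2 c s)
    (hs : c s ∈ (extChartAt (𝓡 (n + 1)) x₀).source)
    (h : HasDerivAt (chartState (n := n) x₀ c)
      (geodesicField (g.chartGamma x₀) (chartState x₀ c s)) s) : g.IsGeodesicAt c s := by
  refine ⟨hc, fun x₁ hx₁ ↦ (g.hasDerivAt_chartState_iff hc hx₁).1 ?_⟩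
  have hmem : (chartState (n := n) x₀ c s).1 ∈ chartOverlap x₀ x₁ := mem_chartOverlap hs hx₁
  have ev : chartState (n := n) x₁ c =ᶠ[𝓝 s] tangentChange x₀ x₁ ∘ chartState x₀ c := by
    have : IsManifold (𝓡 (n + 1)) 2 M := IsManifold.of_le (n := ∞) two_le_infty
    filter_upwards [(contMDiffAt_iff_contMDiffAt_nhds (by simp)).1 hc,
      hc.continuousAt.eventually_mem ((isOpen_extChartAt_source x₀).mem_nhds hs),
      hc.continuousAt.eventually_mem ((isOpen_extChartAt_source x₁).mem_nhds hx₁)] with r h1 h2 h3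
    exact chartState_chartChange (h1.mdifferentiableAt (by simp)) h2 h3
  obtain ⟨L, hL, hLw⟩ := hasFDerivAt_tangentChange (z := chartState (n := n) x₀ c s) hmem
  have hd := (hL.comp_hasDerivAt s h).congr_of_eventuallyEq ev
  rw [hLw] at hd
  rw [ev.self_of_nhds]
  refine hd.congr_deriv (Prod.ext rfl ?_)
  simp only [geodesicField, tangentChange, Function.comp, map_neg]
  rw [← g.chartGamma_chartChange hmem (chartState x₀ c s).2 (chartState x₀ c s).2]
  abel

/-- Integral curves of `geodesicField` in the chart at `x₀` are geodesics. -/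
lemma isGeodesicAt_of_integralCurve (g : LorentzMetric n M) (x₀ : M)
    {z : ℝ → CoordSpace n × CoordSpace n} {J : Set ℝ} (hJ : IsOpen J)
    (hz : ∀ s ∈ J, (z s).1 ∈ (extChartAt (𝓡 (n + 1)) x₀).target)
    (hd : ∀ s ∈ J, HasDerivAt z (geodesicField (g.chartGamma x₀) (z s)) s) {s : ℝ} (hs : s ∈ J) :
    (extChartAt (𝓡 (n + 1)) x₀).symm (z s).1 ∈ (extChartAt (𝓡 (n + 1)) x₀).source ∧
    chartState (n := n) x₀ (fun s ↦ (extChartAt (𝓡 (n + 1)) x₀).symm (z s).1) s = z s ∧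
    g.IsGeodesicAt (fun s ↦ (extChartAt (𝓡 (n + 1)) x₀).symm (z s).1) s := by
  have hfst : ∀ s ∈ J, HasDerivAt (fun s ↦ (z s).1) (z s).2 s :=
    fun s hs ↦ (hasFDerivAt_fst.comp_hasDerivAt s (hd s hs) :)
  have hsrc : ∀ s ∈ J, (extChartAt (𝓡 (n + 1)) x₀).symm (z s).1 ∈
      (extChartAt (𝓡 (n + 1)) x₀).source :=
    fun s hs ↦ (extChartAt (𝓡 (n + 1)) x₀).map_target (hz s hs)
  have hst : ∀ s ∈ J, chartState (n := n) x₀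
      (fun s ↦ (extChartAt (𝓡 (n + 1)) x₀).symm (z s).1) s = z s := by
    intro s hs
    have e : (fun s ↦ extChartAt (𝓡 (n + 1)) x₀ ((extChartAt (𝓡 (n + 1)) x₀).symm (z s).1)) =ᶠ[𝓝 s]
        fun s ↦ (z s).1 := by
      filter_upwards [hJ.mem_nhds hs] with r hr
      rw [(extChartAt (𝓡 (n + 1)) x₀).right_inv (hz r hr)]
    exact Prod.ext e.self_of_nhds (e.deriv_eq.trans (hfst s hs).deriv)
  have hcont : ContinuousOn z J := fun r hr ↦ (hd r hr).continuousAt.continuousWithinAt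
  have hF := (g.isLeviCivitaOn x₀).contDiffOn_geodesicField
  have hz1 : ContDiffOn ℝ 1 z J := by
    rw [show (1 : WithTop ℕ∞) = 0 + 1 from (zero_add 1).symm, contDiffOn_succ_iff_deriv_of_isOpen hJ]
    refine ⟨fun r hr ↦ (hd r hr).differentiableAt.differentiableWithinAt, by simp, ?_⟩
    rw [contDiffOn_zero]
    exact (hF.continuousOn.comp hcont fun r hr ↦ ⟨hz r hr, trivial⟩).congr
      fun r hr ↦ (hd r hr).deriv
  have hx2 : ContDiffOn ℝ 2 (fun s ↦ (z s).1) J := by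
    rw [show (2 : WithTop ℕ∞) = 1 + 1 from one_add_one_eq_two.symm,
      contDiffOn_succ_iff_deriv_of_isOpen hJ]
    exact ⟨fun r hr ↦ (hfst r hr).differentiableAt.differentiableWithinAt, by simp,
      (contDiff_snd.comp_contDiffOn hz1).congr fun r hr ↦ (hfst r hr).deriv⟩
  refine ⟨hsrc s hs, hst s hs, ?_⟩
  refine g.isGeodesicAt_of_hasDerivAt (x₀ := x₀) ?_ (hsrc s hs) ?_
  · have h1 : ContMDiffAt 𝓘(ℝ, ℝ) 𝓘(ℝ, CoordSpace n) 2 (fun s ↦ (z s).1) s :=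
      (hx2.contDiffAt (hJ.mem_nhds hs)).contMDiffAt
    have h2 : ContMDiffAt 𝓘(ℝ, CoordSpace n) (𝓡 (n + 1)) 2 (extChartAt (𝓡 (n + 1)) x₀).symm
        (z s).1 :=
      ((contMDiffOn_extChartAt_symm (I := 𝓡 (n + 1)) (n := ∞) x₀).contMDiffAt
        ((isOpen_extChartAt_target x₀).mem_nhds (hz s hs))).of_le two_le_infty
    exact ContMDiffAt.comp s h2 h1
  · rw [hst s hs]
    exact (hd s hs).congr_of_eventuallyEq (by
      filter_upwards [hJ.mem_nhds hs] with r hr using hst r hr)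

/-! ### Uniqueness of geodesics -/

/-- Geodesics with the same position and velocity at one parameter agree near it. -/
lemma eventuallyEq_of_chartState_eq [T2Space M] (g : LorentzMetric n M) {c c' : ℝ → M} {s : ℝ}
    {x₀ : M} (h : ∀ᶠ r in 𝓝 s, g.IsGeodesicAt c r) (h' : ∀ᶠ r in 𝓝 s, g.IsGeodesicAt c' r)
    (hs : c s ∈ (extChartAt (𝓡 (n + 1)) x₀).source)
    (hs' : c' s ∈ (extChartAt (𝓡 (n + 1)) x₀).source)
    (heq : chartState (n := n) x₀ c s = chartState x₀ c' s) : c =ᶠ[𝓝 s] c' := by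
  have hopen : IsOpen ((extChartAt (𝓡 (n + 1)) x₀).target ×ˢ (univ : Set (CoordSpace n))) :=
    (isOpen_extChartAt_target x₀).prod isOpen_univ
  have hF : ContDiffAt ℝ 1 (geodesicField (g.chartGamma x₀)) (chartState x₀ c s) :=
    ((g.isLeviCivitaOn x₀).contDiffOn_geodesicField.contDiffAt
      (hopen.mem_nhds ⟨(extChartAt (𝓡 (n + 1)) x₀).map_source hs, trivial⟩)).of_le (by simp)
  obtain ⟨K, t, ht, hK⟩ := hF.exists_lipschitzOnWith
  have ev : ∀ {c : ℝ → M}, (∀ᶠ r in 𝓝 s, g.IsGeodesicAt c r) →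
      c s ∈ (extChartAt (𝓡 (n + 1)) x₀).source → t ∈ 𝓝 (chartState x₀ c s) →
      ∀ᶠ r in 𝓝 s, c r ∈ (extChartAt (𝓡 (n + 1)) x₀).source ∧ HasDerivAt (chartState (n := n) x₀ c)
      (geodesicField (g.chartGamma x₀) (chartState x₀ c r)) r ∧ chartState x₀ c r ∈ t := by
    intro c h hs ht
    have h1 := h.self_of_nhds.hasDerivAt_chartState hs
    filter_upwards [h, h.self_of_nhds.1.continuousAt.eventually_mem
      ((isOpen_extChartAt_source x₀).mem_nhds hs), h1.continuousAt.eventually_mem ht] with r h2 h3 h4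
    exact ⟨h3, h2.hasDerivAt_chartState h3, h4⟩
  have e1 := ev h hs ht
  have e2 := ev h' hs' (heq ▸ ht)
  have := ODE_solution_unique_of_eventually (v := fun _ ↦ geodesicField (g.chartGamma x₀))
    (s := fun _ ↦ t) (Eventually.of_forall fun _ ↦ hK) (e1.mono fun r hr ↦ hr.2)
    (e2.mono fun r hr ↦ hr.2) heq
  filter_upwards [this, e1, e2] with r h1 h2 h3
  exact (extChartAt (𝓡 (n + 1)) x₀).injOn h2.1 h3.1 (congrArg Prod.fst h1)

lemma IsGeodesicOn.isGeodesicAt {g : LorentzMetric n M} {c : ℝ → M} {A B s : ℝ}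
    (h : g.IsGeodesicOn c (Ioo A B)) (hs : s ∈ Ioo A B) : g.IsGeodesicAt c s :=
  (g.isGeodesicOn_iff isOpen_Ioo).1 h s hs

lemma IsGeodesicOn.eventually_isGeodesicAt {g : LorentzMetric n M} {c : ℝ → M} {A B s : ℝ}
    (h : g.IsGeodesicOn c (Ioo A B)) (hs : s ∈ Ioo A B) : ∀ᶠ r in 𝓝 s, g.IsGeodesicAt c r := by
  filter_upwards [isOpen_Ioo.mem_nhds hs] with r hr using h.isGeodesicAt hr

/-- Two geodesics which agree near one parameter agree on their common interval. -/
lemma IsGeodesicOn.eqOn [T2Space M] {g : LorentzMetric n M} {c c' : ℝ → M} {A B s : ℝ}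
    (h : g.IsGeodesicOn c (Ioo A B)) (h' : g.IsGeodesicOn c' (Ioo A B)) (hs : s ∈ Ioo A B)
    (heq : c =ᶠ[𝓝 s] c') : EqOn c c' (Ioo A B) := by
  set S : Set ℝ := {r | c =ᶠ[𝓝 r] c'} with hS
  have hSopen : IsOpen S := isOpen_iff_mem_nhds.2 fun r hr ↦ hr.eventually_nhds
  have hsub : Ioo A B ⊆ S := by
    refine isPreconnected_Ioo.subset_of_closure_inter_subset hSopen ⟨s, hs, heq⟩ ?_
    rintro r ⟨hr, hrI⟩
    have hfreq : ∃ᶠ q in 𝓝 r, q ∈ S := mem_closure_iff_frequently.1 hr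
    have g1 := h.isGeodesicAt hrI
    have g2 := h'.isGeodesicAt hrI
    have hcr : c r = c' r := by
      by_contra hne
      obtain ⟨U, V, hU, hV, hcU, hcV, hd⟩ := t2_separation hne
      refine hfreq ?_
      filter_upwards [g1.1.continuousAt.eventually_mem (hU.mem_nhds hcU),
        g2.1.continuousAt.eventually_mem (hV.mem_nhds hcV)] with q h1 h2 h3
      exact disjoint_left.1 hd h1 (h3.self_of_nhds ▸ h2)
    have hsrc : c r ∈ (extChartAt (𝓡 (n + 1)) (c r)).source := mem_extChartAt_source (c r)
    have hsrc' : c' r ∈ (extChartAt (𝓡 (n + 1)) (c r)).source := hcr ▸ hsrc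
    refine g.eventuallyEq_of_chartState_eq (h.eventually_isGeodesicAt hrI)
      (h'.eventually_isGeodesicAt hrI) hsrc hsrc' ?_
    by_contra hne
    obtain ⟨U, V, hU, hV, hcU, hcV, hd⟩ := t2_separation hne
    refine hfreq ?_
    filter_upwards [(g1.hasDerivAt_chartState hsrc).continuousAt.eventually_mem (hU.mem_nhds hcU),
      (g2.hasDerivAt_chartState hsrc').continuousAt.eventually_mem (hV.mem_nhds hcV)] with q h1 h2 h3
    exact disjoint_left.1 hd h1 ((chartState_congr (n := n) h3).symm ▸ h2)
  exact fun r hr ↦ (hsub hr).self_of_nhds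

open Classical in
/-- Two geodesics which agree near a common parameter can be joined. -/
lemma IsGeodesicOn.glue [T2Space M] {g : LorentzMetric n M} {c c' : ℝ → M} {A B A' B' s : ℝ}
    (h : g.IsGeodesicOn c (Ioo A B)) (h' : g.IsGeodesicOn c' (Ioo A' B')) (hs : s ∈ Ioo A B)
    (hs' : s ∈ Ioo A' B') (heq : c =ᶠ[𝓝 s] c') :
    ∃ c'' : ℝ → M, g.IsGeodesicOn c'' (Ioo (min A A') (max B B')) ∧ EqOn c'' c (Ioo A B) ∧
      EqOn c'' c' (Ioo A' B') := by
  have hsub : Ioo (max A A') (min B B') = Ioo A B ∩ Ioo A' B' := Ioo_inter_Ioo.symm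
  have e : EqOn c c' (Ioo A B ∩ Ioo A' B') := by
    rw [← hsub]
    refine IsGeodesicOn.eqOn (g := g) ((g.isGeodesicOn_iff isOpen_Ioo).2 fun r hr ↦ ?_)
      ((g.isGeodesicOn_iff isOpen_Ioo).2 fun r hr ↦ ?_) (s := s) ?_ heq
    · rw [hsub] at hr
      exact h.isGeodesicAt hr.1
    · rw [hsub] at hr
      exact h'.isGeodesicAt hr.2
    · rw [hsub]
      exact ⟨hs, hs'⟩
  let c'' : ℝ → M := fun r ↦ if r ∈ Ioo A B then c r else c' r
  have e1 : EqOn c'' c (Ioo A B) := fun r hr ↦ if_pos hr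
  have e2 : EqOn c'' c' (Ioo A' B') := by
    intro r hr
    by_cases hr' : r ∈ Ioo A B
    · exact (if_pos hr').trans (e ⟨hr', hr⟩)
    · exact if_neg hr'
  refine ⟨c'', (g.isGeodesicOn_iff isOpen_Ioo).2 fun r hr ↦ ?_, e1, e2⟩
  have hcases : r ∈ Ioo A B ∨ r ∈ Ioo A' B' := by
    simp only [mem_Ioo, min_lt_iff, lt_max_iff] at hr hs hs' ⊢
    rcases hr with ⟨h1, h2⟩
    by_contra hcon
    push Not at hcon
    rcases le_or_gt r s with h3 | h3
    · rcases h1 with h1 | h1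
      · linarith [hcon.1 h1]
      · linarith [hcon.2 h1]
    · have := hcon.1 (hs.1.trans h3)
      have := hcon.2 (hs'.1.trans h3)
      rcases h2 with h2 | h2 <;> linarith
  rcases hcases with hr | hr
  · exact (h.isGeodesicAt hr).congr (e1.eventuallyEq_of_mem (isOpen_Ioo.mem_nhds hr))
  · exact (h'.isGeodesicAt hr).congr (e2.eventuallyEq_of_mem (isOpen_Ioo.mem_nhds hr))

end LorentzMetric

/-! ### The unit normal in a chart -/

namespace LorentzMetric

variable {n : ℕ} {M : Type*} [TopologicalSpace M]
  [ChartedSpace (EuclideanSpace ℝ (Fin (n + 1))) M]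

/-- A vector field in the chart at `x₀`, as a function on the coordinate space. -/
def chartField (x₀ : M) (X : ∀ x : M, TangentSpace (𝓡 (n + 1)) x) (y : CoordSpace n) :
    CoordSpace n :=
  mfderiv (𝓡 (n + 1)) 𝓘(ℝ, CoordSpace n) (extChartAt (𝓡 (n + 1)) x₀)
    ((extChartAt (𝓡 (n + 1)) x₀).symm y) (X ((extChartAt (𝓡 (n + 1)) x₀).symm y))

variable [IsManifold (𝓡 (n + 1)) ∞ M]

lemma mfderiv_symm_mfderiv (x₀ : M) {x : M} (hx : x ∈ (extChartAt (𝓡 (n + 1)) x₀).source)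
    (v : CoordSpace n) :
    (mfderiv 𝓘(ℝ, CoordSpace n) (𝓡 (n + 1)) (extChartAt (𝓡 (n + 1)) x₀).symm
      (extChartAt (𝓡 (n + 1)) x₀ x) (mfderiv (𝓡 (n + 1)) 𝓘(ℝ, CoordSpace n)
        (extChartAt (𝓡 (n + 1)) x₀) x v : CoordSpace n) : CoordSpace n) = v := by
  have : IsManifold (𝓡 (n + 1)) 1 M := IsManifold.of_le (n := ∞) (by exact_mod_cast le_top)
  have h := mfderivWithin_extChartAt_symm_comp_mfderiv_extChartAt' (I := 𝓡 (n + 1)) hx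
  rw [ModelWithCorners.range_eq_univ, mfderivWithin_univ] at h
  exact DFunLike.congr_fun h v

lemma mfderiv_mfderiv_symm (x₀ : M) {y : CoordSpace n}
    (hy : y ∈ (extChartAt (𝓡 (n + 1)) x₀).target) (v : CoordSpace n) :
    (mfderiv (𝓡 (n + 1)) 𝓘(ℝ, CoordSpace n) (extChartAt (𝓡 (n + 1)) x₀)
      ((extChartAt (𝓡 (n + 1)) x₀).symm y) (mfderiv 𝓘(ℝ, CoordSpace n) (𝓡 (n + 1))
        (extChartAt (𝓡 (n + 1)) x₀).symm y v : CoordSpace n) : CoordSpace n) = v := by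
  have : IsManifold (𝓡 (n + 1)) 1 M := IsManifold.of_le (n := ∞) (by exact_mod_cast le_top)
  have h := mfderiv_extChartAt_comp_mfderivWithin_extChartAt_symm (I := 𝓡 (n + 1)) hy
  rw [ModelWithCorners.range_eq_univ, mfderivWithin_univ] at h
  exact DFunLike.congr_fun h v

lemma mfderiv_symm_chartField (x₀ : M) (X : ∀ x : M, TangentSpace (𝓡 (n + 1)) x)
    {y : CoordSpace n} (hy : y ∈ (extChartAt (𝓡 (n + 1)) x₀).target) :
    (mfderiv 𝓘(ℝ, CoordSpace n) (𝓡 (n + 1)) (extChartAt (𝓡 (n + 1)) x₀).symm y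
      (chartField x₀ X y) : CoordSpace n) = X ((extChartAt (𝓡 (n + 1)) x₀).symm y) := by
  have h := mfderiv_symm_mfderiv x₀ ((extChartAt (𝓡 (n + 1)) x₀).map_target hy)
    (X ((extChartAt (𝓡 (n + 1)) x₀).symm y))
  rw [(extChartAt (𝓡 (n + 1)) x₀).right_inv hy] at h
  exact h

lemma chartMetric_chartField (g : LorentzMetric n M) (x₀ : M)
    (X Y : ∀ x : M, TangentSpace (𝓡 (n + 1)) x)
    {y : CoordSpace n} (hy : y ∈ (extChartAt (𝓡 (n + 1)) x₀).target) :
    g.chartMetric x₀ y (chartField x₀ X y) (chartField x₀ Y y) =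
      g.val ((extChartAt (𝓡 (n + 1)) x₀).symm y) (X ((extChartAt (𝓡 (n + 1)) x₀).symm y))
        (Y ((extChartAt (𝓡 (n + 1)) x₀).symm y)) := by
  rw [chartMetric_apply]
  exact congrArg₂ (fun a b ↦ g.val _ a b) (mfderiv_symm_chartField x₀ X hy)
    (mfderiv_symm_chartField x₀ Y hy)

lemma fderiv_comp_extChartAt_symm {f : M → ℝ} (hf : ContMDiff (𝓡 (n + 1)) 𝓘(ℝ, ℝ) ∞ f) (x₀ : M)
    {y : CoordSpace n} (hy : y ∈ (extChartAt (𝓡 (n + 1)) x₀).target) (u : CoordSpace n) :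
    fderiv ℝ (fun y ↦ f ((extChartAt (𝓡 (n + 1)) x₀).symm y)) y u =
      mfderiv (𝓡 (n + 1)) 𝓘(ℝ, ℝ) f ((extChartAt (𝓡 (n + 1)) x₀).symm y)
        (mfderiv 𝓘(ℝ, CoordSpace n) (𝓡 (n + 1)) (extChartAt (𝓡 (n + 1)) x₀).symm y u) := by
  have h1 := (mdifferentiableAt_extChartAt_symm x₀ hy).hasMFDerivAt
  have h2 := ((hf ((extChartAt (𝓡 (n + 1)) x₀).symm y)).mdifferentiableAt (by simp)).hasMFDerivAt
  let D : CoordSpace n →L[ℝ] ℝ :=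
    (mfderiv (𝓡 (n + 1)) 𝓘(ℝ, ℝ) f ((extChartAt (𝓡 (n + 1)) x₀).symm y)).comp
      (mfderiv 𝓘(ℝ, CoordSpace n) (𝓡 (n + 1)) (extChartAt (𝓡 (n + 1)) x₀).symm y)
  have h3 : HasFDerivAt (fun y ↦ f ((extChartAt (𝓡 (n + 1)) x₀).symm y)) D y :=
    (h2.comp y h1).hasFDerivAt
  rw [h3.fderiv]
  rfl

lemma contDiffOn_comp_extChartAt_symm {f : M → ℝ} (hf : ContMDiff (𝓡 (n + 1)) 𝓘(ℝ, ℝ) ∞ f)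
    (x₀ : M) : ContDiffOn ℝ ∞ (fun y ↦ f ((extChartAt (𝓡 (n + 1)) x₀).symm y))
      (extChartAt (𝓡 (n + 1)) x₀).target := by
  rw [← contMDiffOn_iff_contDiffOn]
  exact hf.comp_contMDiffOn (contMDiffOn_extChartAt_symm (I := 𝓡 (n + 1)) (n := ∞) x₀)

lemma chartMetric_grad (g : LorentzMetric n M) {f : M → ℝ}
    (hf : ContMDiff (𝓡 (n + 1)) 𝓘(ℝ, ℝ) ∞ f) (x₀ : M) {y : CoordSpace n}
    (hy : y ∈ (extChartAt (𝓡 (n + 1)) x₀).target) (u : CoordSpace n) :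
    g.chartMetric x₀ y (chartField x₀ (g.grad f) y) u =
      fderiv ℝ (fun y ↦ f ((extChartAt (𝓡 (n + 1)) x₀).symm y)) y u := by
  rw [chartMetric_apply, fderiv_comp_extChartAt_symm hf x₀ hy, ← g.val_grad]
  exact congrArg (fun a ↦ g.val _ a _) (mfderiv_symm_chartField x₀ _ hy)

lemma contDiffOn_chartField_grad (g : LorentzMetric n M) {f : M → ℝ}
    (hf : ContMDiff (𝓡 (n + 1)) 𝓘(ℝ, ℝ) ∞ f) (x₀ : M) :
    ContDiffOn ℝ ∞ (chartField x₀ (g.grad f)) (extChartAt (𝓡 (n + 1)) x₀).target := by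
  set f' : CoordSpace n → ℝ := fun y ↦ f ((extChartAt (𝓡 (n + 1)) x₀).symm y)
  have e : ∀ y ∈ (extChartAt (𝓡 (n + 1)) x₀).target, chartField x₀ (g.grad f) y =
      ∑ i, (∑ j, g.coordInverse x₀ i j y * pd j f' y) • (coordBasis i : CoordSpace n) := by
    intro y hy
    set A : Matrix (Fin (n + 1)) (Fin (n + 1)) ℝ := Matrix.of fun k l ↦ g.coordMetric x₀ k l y
    have hinv : A⁻¹ * A = 1 :=
      Matrix.nonsing_inv_mul A (isUnit_iff_ne_zero.2 (g.det_coordMetric_ne_zero x₀ hy))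
    set v := chartField x₀ (g.grad f) y with hv
    have h1 : A.mulVec (fun k ↦ v k) = fun j ↦ pd j f' y := by
      ext j
      have := g.chartMetric_grad hf x₀ hy (coordBasis j)
      rw [pd, ← this, ← hv]
      conv_rhs => rw [v.sum_coords, g.chartMetric_symm]
      simp [Matrix.mulVec, dotProduct, A, coordMetric_eq, mul_comm]
    have h2 : (fun k ↦ v k) = A⁻¹.mulVec fun j ↦ pd j f' y := by
      rw [← h1, Matrix.mulVec_mulVec, hinv, Matrix.one_mulVec]
    conv_lhs => rw [v.sum_coords]
    refine Finset.sum_congr rfl fun i _ ↦ ?_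
    rw [show v i = _ from congrFun h2 i]
    rfl
  refine ContDiffOn.congr ?_ e
  have hs : ∀ i, ContDiffOn ℝ ∞ (fun y ↦ ∑ j, g.coordInverse x₀ i j y * pd j f' y)
      (extChartAt (𝓡 (n + 1)) x₀).target := fun i ↦
    ContDiffOn.sum fun j _ ↦ (g.contDiffOn_coordInverse x₀ i j).mul
      ((contDiffOn_comp_extChartAt_symm hf x₀).pd (isOpen_extChartAt_target x₀) j)
  exact ContDiffOn.sum fun i _ ↦ (hs i).smul contDiffOn_const

/-- The factor by which the unit normal differs from the gradient, in the chart at `x₀`. -/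
def chartLapse (g : LorentzMetric n M) (τ : M → ℝ) (x₀ : M) (y : CoordSpace n) : ℝ :=
  -(Real.sqrt |g.val ((extChartAt (𝓡 (n + 1)) x₀).symm y)
    (g.grad τ ((extChartAt (𝓡 (n + 1)) x₀).symm y))
    (g.grad τ ((extChartAt (𝓡 (n + 1)) x₀).symm y))|)⁻¹

lemma chartField_unitNormal (g : LorentzMetric n M) (τ : M → ℝ) (x₀ : M) (y : CoordSpace n) :
    chartField x₀ (g.unitNormal τ) y = g.chartLapse τ x₀ y • chartField x₀ (g.grad τ) y := by
  simp only [chartField, unitNormal, chartLapse]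
  exact map_smul _ _ _

variable {g : LorentzMetric n M} {τ : M → ℝ}

lemma IsTimeFunction.contDiffOn_chartLapse (hτ : g.IsTimeFunction τ) (x₀ : M) :
    ContDiffOn ℝ ∞ (g.chartLapse τ x₀) (extChartAt (𝓡 (n + 1)) x₀).target := by
  have h1 := g.contDiffOn_chartField_grad hτ.1 x₀
  have h2 : ContDiffOn ℝ ∞ (fun y ↦ -g.chartMetric x₀ y (chartField x₀ (g.grad τ) y)
      (chartField x₀ (g.grad τ) y)) (extChartAt (𝓡 (n + 1)) x₀).target :=
    (((g.contDiffOn_chartMetric x₀).clm_apply h1).clm_apply h1).neg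
  have hpos : ∀ y ∈ (extChartAt (𝓡 (n + 1)) x₀).target, 0 <
      -g.chartMetric x₀ y (chartField x₀ (g.grad τ) y) (chartField x₀ (g.grad τ) y) := by
    intro y hy
    rw [g.chartMetric_chartField x₀ _ _ hy, neg_pos]
    exact hτ.2 _
  refine (((h2.sqrt fun y hy ↦ (hpos y hy).ne').inv fun y hy ↦
    (Real.sqrt_pos.2 (hpos y hy)).ne').neg).congr fun y hy ↦ ?_
  rw [chartLapse, ← g.chartMetric_chartField x₀ _ _ hy, abs_of_neg (neg_pos.1 (hpos y hy))]
  rfl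

lemma IsTimeFunction.contDiffOn_chartField_unitNormal (hτ : g.IsTimeFunction τ) (x₀ : M) :
    ContDiffOn ℝ ∞ (chartField x₀ (g.unitNormal τ)) (extChartAt (𝓡 (n + 1)) x₀).target :=
  ((hτ.contDiffOn_chartLapse x₀).smul (g.contDiffOn_chartField_grad hτ.1 x₀)).congr
    fun y _ ↦ g.chartField_unitNormal τ x₀ y

lemma IsTimeFunction.chartLapse_neg (hτ : g.IsTimeFunction τ) (x₀ : M) (y : CoordSpace n) :
    g.chartLapse τ x₀ y < 0 := by
  rw [chartLapse, neg_lt_zero]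
  exact inv_pos.2 (Real.sqrt_pos.2 (abs_pos.2 (hτ.2 _).ne))

lemma IsTimeFunction.chartMetric_unitNormal (hτ : g.IsTimeFunction τ) (x₀ : M) {y : CoordSpace n}
    (hy : y ∈ (extChartAt (𝓡 (n + 1)) x₀).target) (u : CoordSpace n) :
    g.chartMetric x₀ y (chartField x₀ (g.unitNormal τ) y) u =
      g.chartLapse τ x₀ y * fderiv ℝ (fun y ↦ τ ((extChartAt (𝓡 (n + 1)) x₀).symm y)) y u := by
  rw [g.chartField_unitNormal, ← g.chartMetric_grad hτ.1 x₀ hy]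
  simp

lemma IsTimeFunction.chartMetric_unitNormal_self (hτ : g.IsTimeFunction τ) (x₀ : M)
    {y : CoordSpace n} (hy : y ∈ (extChartAt (𝓡 (n + 1)) x₀).target) :
    g.chartMetric x₀ y (chartField x₀ (g.unitNormal τ) y) (chartField x₀ (g.unitNormal τ) y)
      = -1 := by
  rw [g.chartField_unitNormal]
  simp only [map_smul, smul_apply, smul_eq_mul]
  rw [g.chartMetric_chartField x₀ _ _ hy, chartLapse]
  have h : g.val _ _ _ < 0 := hτ.2 ((extChartAt (𝓡 (n + 1)) x₀).symm y)
  have h2 := Real.mul_self_sqrt (abs_nonneg (g.val ((extChartAt (𝓡 (n + 1)) x₀).symm y)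
    (g.grad τ ((extChartAt (𝓡 (n + 1)) x₀).symm y))
    (g.grad τ ((extChartAt (𝓡 (n + 1)) x₀).symm y))))
  have h3 := (Real.sqrt_pos.2 (abs_pos.2 h.ne)).ne'
  rw [abs_of_neg h] at h2 h3 ⊢
  field_simp
  nlinarith

end LorentzMetric

/-! ### Normal geodesics and the exponential map -/

namespace LorentzMetric

variable {n : ℕ} {M : Type*} [TopologicalSpace M]
  [ChartedSpace (EuclideanSpace ℝ (Fin (n + 1))) M]

lemma chartField_extChartAt {x₀ x : M} (hx : x ∈ (extChartAt (𝓡 (n + 1)) x₀).source)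
    (X : ∀ x : M, TangentSpace (𝓡 (n + 1)) x) :
    chartField x₀ X (extChartAt (𝓡 (n + 1)) x₀ x) =
      mfderiv (𝓡 (n + 1)) 𝓘(ℝ, CoordSpace n) (extChartAt (𝓡 (n + 1)) x₀) x (X x) :=
  congrArg (fun z ↦ (mfderiv (𝓡 (n + 1)) 𝓘(ℝ, CoordSpace n) (extChartAt (𝓡 (n + 1)) x₀) z (X z) :
    CoordSpace n)) ((extChartAt (𝓡 (n + 1)) x₀).left_inv hx)

variable [IsManifold (𝓡 (n + 1)) ∞ M] {g : LorentzMetric n M} {τ : M → ℝ}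

/-- The curve `c_q` given by the exponential map. -/
abbrev normalCurve (g : LorentzMetric n M) (τ : M → ℝ) (q : M) : ℝ → M :=
  fun s ↦ g.normalExp τ (s, q)

lemma IsNormalGeodesic.congr {q : M} {c c' : ℝ → M} {A B : ℝ} (h : g.IsNormalGeodesic τ q c A B)
    (e : EqOn c' c (Ioo A B)) : g.IsNormalGeodesic τ q c' A B := by
  obtain ⟨hA, hB, hg, h0, hv⟩ := h
  have e0 : c' 0 = c 0 := e ⟨hA, hB⟩
  have ev : c' =ᶠ[𝓝 0] c := e.eventuallyEq_of_mem (isOpen_Ioo.mem_nhds ⟨hA, hB⟩)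
  refine ⟨hA, hB, (g.isGeodesicOn_iff isOpen_Ioo).2 fun s hs ↦
    (hg.isGeodesicAt hs).congr (e.eventuallyEq_of_mem (isOpen_Ioo.mem_nhds hs)), e0.trans h0, ?_⟩
  have h1 : (velocity (n := n) c' 0 : CoordSpace n) = velocity (n := n) c 0 :=
    congrArg (fun L : ℝ →L[ℝ] CoordSpace n ↦ L 1) ev.mfderiv_eq
  have h2 : (g.unitNormal τ (c' 0) : CoordSpace n) = g.unitNormal τ (c 0) :=
    congrArg (fun x ↦ (g.unitNormal τ x : CoordSpace n)) e0
  exact h1.trans (Eq.trans hv h2.symm)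

/-- The initial position and velocity of a normal geodesic. -/
lemma IsNormalGeodesic.chartState_zero {q x₀ : M} {c : ℝ → M} {A B : ℝ}
    (h : g.IsNormalGeodesic τ q c A B) (hq : q ∈ (extChartAt (𝓡 (n + 1)) x₀).source) :
    chartState (n := n) x₀ c 0 = (extChartAt (𝓡 (n + 1)) x₀ q,
      chartField x₀ (g.unitNormal τ) (extChartAt (𝓡 (n + 1)) x₀ q)) := by
  obtain ⟨hA, hB, hg, rfl, hv⟩ := h
  have h1 := hasDerivAt_extChartAt_comp (hg.isGeodesicAt ⟨hA, hB⟩).mdifferentiableAt hq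
  rw [hv, ← chartField_extChartAt hq (g.unitNormal τ)] at h1
  exact Prod.ext rfl h1.deriv

/-- A geodesic with the right initial values is a normal geodesic. -/
lemma isNormalGeodesic_of_chartState {q x₀ : M} {c : ℝ → M} {A B : ℝ} (hA : A < 0) (hB : 0 < B)
    (hg : g.IsGeodesicOn c (Ioo A B)) (hq : q ∈ (extChartAt (𝓡 (n + 1)) x₀).source)
    (h0 : c 0 = q) (h : chartState (n := n) x₀ c 0 = (extChartAt (𝓡 (n + 1)) x₀ q,
      chartField x₀ (g.unitNormal τ) (extChartAt (𝓡 (n + 1)) x₀ q))) :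
    g.IsNormalGeodesic τ q c A B := by
  subst h0
  refine ⟨hA, hB, hg, rfl, ?_⟩
  have h1 := (hasDerivAt_extChartAt_comp (hg.isGeodesicAt ⟨hA, hB⟩).mdifferentiableAt hq).deriv
  have h2 := congrArg Prod.snd h
  simp only [chartState] at h2
  rw [h1, chartField_extChartAt hq] at h2
  have h3 := mfderiv_symm_mfderiv x₀ hq (velocity (n := n) c 0)
  have h4 := mfderiv_symm_mfderiv x₀ hq (g.unitNormal τ (c 0))
  refine (h3.symm.trans ?_).trans h4
  exact congrArg (fun v ↦ (mfderiv 𝓘(ℝ, CoordSpace n) (𝓡 (n + 1))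
    (extChartAt (𝓡 (n + 1)) x₀).symm (extChartAt (𝓡 (n + 1)) x₀ (c 0)) v : CoordSpace n)) h2

variable [T2Space M]

lemma IsNormalGeodesic.eventuallyEq {q : M} {c c' : ℝ → M} {A B A' B' : ℝ}
    (h : g.IsNormalGeodesic τ q c A B) (h' : g.IsNormalGeodesic τ q c' A' B') :
    c =ᶠ[𝓝 0] c' := by
  have hq : q ∈ (extChartAt (𝓡 (n + 1)) q).source := mem_extChartAt_source q
  refine g.eventuallyEq_of_chartState_eq (x₀ := q)
    (h.2.2.1.eventually_isGeodesicAt ⟨h.1, h.2.1⟩) (h'.2.2.1.eventually_isGeodesicAt ⟨h'.1, h'.2.1⟩)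
    (by rwa [h.2.2.2.1]) (by rwa [h'.2.2.2.1]) ?_
  rw [h.chartState_zero hq, h'.chartState_zero hq]

/-- The exponential map is given by any normal geodesic. -/
lemma IsNormalGeodesic.normalExp_eq {q : M} {c : ℝ → M} {A B t : ℝ}
    (h : g.IsNormalGeodesic τ q c A B) (ht : t ∈ Ioo A B) : g.normalExp τ (t, q) = c t := by
  have hmem : (t, q) ∈ g.expDomain τ := ⟨c, A, B, h, ht⟩
  obtain ⟨A', B', h', ht'⟩ := Classical.choose_spec hmem
  rw [normalExp, dif_pos hmem]
  set c' := Classical.choose hmem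
  have hsub : Ioo (max A' A) (min B' B) = Ioo A' B' ∩ Ioo A B := Ioo_inter_Ioo.symm
  have key := IsGeodesicOn.eqOn (g := g) (c := c') (c' := c) (A := max A' A) (B := min B' B)
    ((g.isGeodesicOn_iff isOpen_Ioo).2 fun r hr ↦ h'.2.2.1.isGeodesicAt (hsub ▸ hr).1)
    ((g.isGeodesicOn_iff isOpen_Ioo).2 fun r hr ↦ h.2.2.1.isGeodesicAt (hsub ▸ hr).2)
    (s := 0) (hsub ▸ ⟨⟨h'.1, h'.2.1⟩, ⟨h.1, h.2.1⟩⟩) (h'.eventuallyEq h)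
  exact key (hsub ▸ ⟨ht', ht⟩)

lemma IsNormalGeodesic.normalCurve {q : M} {c : ℝ → M} {A B : ℝ}
    (h : g.IsNormalGeodesic τ q c A B) : g.IsNormalGeodesic τ q (g.normalCurve τ q) A B :=
  h.congr fun _ hs ↦ h.normalExp_eq hs

lemma exists_isNormalGeodesic_normalCurve {q : M} {t : ℝ} (h : (t, q) ∈ g.expDomain τ) :
    ∃ A B, g.IsNormalGeodesic τ q (g.normalCurve τ q) A B ∧ t ∈ Ioo A B := by
  obtain ⟨c, A, B, hc, ht⟩ := h
  exact ⟨A, B, hc.normalCurve, ht⟩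

/-- A geodesic which agrees with a normal geodesic near one parameter continues it. -/
lemma eventuallyEq_normalCurve {q : M} {γ : ℝ → M} {A' B' s : ℝ} (h : (s, q) ∈ g.expDomain τ)
    (hγ : g.IsGeodesicOn γ (Ioo A' B')) (hs : s ∈ Ioo A' B') (e : g.normalCurve τ q =ᶠ[𝓝 s] γ)
    {r : ℝ} (hr : r ∈ Ioo A' B') :
    (r, q) ∈ g.expDomain τ ∧ g.normalCurve τ q =ᶠ[𝓝 r] γ := by
  obtain ⟨A, B, hc, hsc⟩ := exists_isNormalGeodesic_normalCurve h
  obtain ⟨c, hcg, e1, e2⟩ := hc.2.2.1.glue hγ hsc hs e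
  have hsub1 : Ioo A B ⊆ Ioo (min A A') (max B B') :=
    Ioo_subset_Ioo (min_le_left _ _) (le_max_left _ _)
  have hsub2 : Ioo A' B' ⊆ Ioo (min A A') (max B B') :=
    Ioo_subset_Ioo (min_le_right _ _) (le_max_right _ _)
  have hcn := hc.congr e1
  have h0 := hsub1 ⟨hc.1, hc.2.1⟩
  have hcn' : g.IsNormalGeodesic τ q c (min A A') (max B B') :=
    ⟨h0.1, h0.2, hcg, hcn.2.2.2.1, hcn.2.2.2.2⟩
  refine ⟨⟨c, _, _, hcn', hsub2 hr⟩, ?_⟩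
  filter_upwards [isOpen_Ioo.mem_nhds hr] with r' hr'
  exact (hcn'.normalExp_eq (hsub2 hr')).trans (e2 hr')

/-! ### Dependence of the normal geodesics on the initial point -/

/-- Position and velocity, in the chart at `x₀`, of the normal geodesic that starts at the point
with coordinates `y` in the chart at `p`. -/
def normalState (g : LorentzMetric n M) (τ : M → ℝ) (p x₀ : M) (s : ℝ) (y : CoordSpace n) :
    CoordSpace n × CoordSpace n :=
  chartState x₀ (g.normalCurve τ ((extChartAt (𝓡 (n + 1)) p).symm y)) s

/-- Near `p` the normal geodesics reach parameter `s`, inside the chart at `x₀`, and depend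
differentiably on the initial point. -/
structure IsRegularAt (g : LorentzMetric n M) (τ : M → ℝ) (p x₀ : M) (s : ℝ) : Prop where
  eventually_mem : ∀ᶠ y in 𝓝 (extChartAt (𝓡 (n + 1)) p p),
    (s, (extChartAt (𝓡 (n + 1)) p).symm y) ∈ g.expDomain τ ∧
    g.normalExp τ (s, (extChartAt (𝓡 (n + 1)) p).symm y) ∈ (extChartAt (𝓡 (n + 1)) x₀).source
  differentiableAt : DifferentiableAt ℝ (g.normalState τ p x₀ s) (extChartAt (𝓡 (n + 1)) p p)

/-- The flow of the geodesic equation in a chart carries the states of all normal geodesics which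
pass through its domain. -/
lemma exists_local_flow_normalCurve (g : LorentzMetric n M) (τ : M → ℝ) (x₀ : M)
    {z₀ : CoordSpace n × CoordSpace n} (hz₀ : z₀.1 ∈ (extChartAt (𝓡 (n + 1)) x₀).target) :
    ∃ δ > 0, ∃ W : Set (CoordSpace n × CoordSpace n), IsOpen W ∧ z₀ ∈ W ∧
      ∃ (Φ : ℝ → CoordSpace n × CoordSpace n → CoordSpace n × CoordSpace n)
        (Y : ℝ → CoordSpace n × CoordSpace n →
          (CoordSpace n × CoordSpace n →L[ℝ] CoordSpace n × CoordSpace n)), ∀ z ∈ W,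
      (Φ 0 z = z ∧ ∀ s ∈ Ioo (-δ) δ, (Φ s z).1 ∈ (extChartAt (𝓡 (n + 1)) x₀).target ∧
        HasDerivAt (fun s ↦ Φ s z) (geodesicField (g.chartGamma x₀) (Φ s z)) s ∧
        HasDerivAt (fun s ↦ Y s z)
          ((fderiv ℝ (geodesicField (g.chartGamma x₀)) (Φ s z)).comp (Y s z)) s ∧
        HasFDerivAt (fun q : ℝ × (CoordSpace n × CoordSpace n) ↦ Φ q.1 q.2)
          (((1 : ℝ →L[ℝ] ℝ).smulRight (geodesicField (g.chartGamma x₀) (Φ s z))).coprod (Y s z))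
          (s, z)) ∧
      ∀ (q : M) (r : ℝ), (r, q) ∈ g.expDomain τ →
        g.normalExp τ (r, q) ∈ (extChartAt (𝓡 (n + 1)) x₀).source →
        chartState x₀ (g.normalCurve τ q) r = z → ∀ s, s - r ∈ Ioo (-δ) δ →
        (s, q) ∈ g.expDomain τ ∧ g.normalExp τ (s, q) ∈ (extChartAt (𝓡 (n + 1)) x₀).source ∧
        chartState x₀ (g.normalCurve τ q) s = Φ (s - r) z := by
  have hopen : IsOpen ((extChartAt (𝓡 (n + 1)) x₀).target ×ˢ (univ : Set (CoordSpace n))) :=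
    (isOpen_extChartAt_target x₀).prod isOpen_univ
  obtain ⟨δ, hδ, W, hW, hzW, Φ, Y, hΦ⟩ := ContDiffOn.exists_local_flow hopen
    ((g.isLeviCivitaOn x₀).contDiffOn_geodesicField.of_le two_le_infty) (z₀ := z₀) ⟨hz₀, trivial⟩
  refine ⟨δ, hδ, W, hW, hzW, Φ, Y, fun z hz ↦ ?_⟩
  obtain ⟨h0, hs⟩ := hΦ z hz
  refine ⟨⟨h0, fun s hs' ↦ ⟨(hs s hs').1.1, (hs s hs').2⟩⟩, ?_⟩
  intro q r hr hrs hrz s hsr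
  have hshift : ∀ s, s ∈ Ioo (r - δ) (r + δ) ↔ s - r ∈ Ioo (-δ) δ := by
    intro s
    simp only [mem_Ioo]
    constructor <;> rintro ⟨h1, h2⟩ <;> constructor <;> linarith
  have hint := fun s (hs' : s ∈ Ioo (r - δ) (r + δ)) ↦ g.isGeodesicAt_of_integralCurve x₀
    (z := fun s ↦ Φ (s - r) z) (J := Ioo (r - δ) (r + δ)) isOpen_Ioo
    (fun s hs' ↦ (hs _ ((hshift s).1 hs')).1.1)
    (fun s hs' ↦ (hs _ ((hshift s).1 hs')).2.1.comp_sub_const s r) hs'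
  set γ : ℝ → M := fun s ↦ (extChartAt (𝓡 (n + 1)) x₀).symm (Φ (s - r) z).1
  have hγ : g.IsGeodesicOn γ (Ioo (r - δ) (r + δ)) :=
    (g.isGeodesicOn_iff isOpen_Ioo).2 fun s hs' ↦ (hint s hs').2.2
  have hrI : r ∈ Ioo (r - δ) (r + δ) := ⟨by linarith, by linarith⟩
  obtain ⟨A, B, hc, hrc⟩ := exists_isNormalGeodesic_normalCurve hr
  have e : g.normalCurve τ q =ᶠ[𝓝 r] γ := by
    refine g.eventuallyEq_of_chartState_eq (x₀ := x₀) (hc.2.2.1.eventually_isGeodesicAt hrc)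
      (hγ.eventually_isGeodesicAt hrI) hrs (hint r hrI).1 ?_
    rw [(hint r hrI).2.1, hrz]
    simp [h0]
  have hsI := (hshift s).2 hsr
  obtain ⟨h1, h2⟩ := eventuallyEq_normalCurve hr hγ hrI e hsI
  refine ⟨h1, ?_, ?_⟩
  · rw [show g.normalExp τ (s, q) = γ s from h2.self_of_nhds]
    exact (hint s hsI).1
  · rw [chartState_congr (n := n) h2, (hint s hsI).2.1]

end LorentzMetric

namespace LorentzMetric

variable {n : ℕ} {M : Type*} [TopologicalSpace M]
  [ChartedSpace (EuclideanSpace ℝ (Fin (n + 1))) M]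
  [IsManifold (𝓡 (n + 1)) ∞ M] {g : LorentzMetric n M} {τ : M → ℝ}

lemma IsRegularAt.mem {p x₀ : M} {s : ℝ} (h : g.IsRegularAt τ p x₀ s) :
    (s, p) ∈ g.expDomain τ ∧ g.normalExp τ (s, p) ∈ (extChartAt (𝓡 (n + 1)) x₀).source := by
  have := h.eventually_mem.self_of_nhds
  rwa [extChartAt_to_inv] at this

lemma normalState_extChartAt (g : LorentzMetric n M) (τ : M → ℝ) (p x₀ : M) (s : ℝ) :
    g.normalState τ p x₀ s (extChartAt (𝓡 (n + 1)) p p) = chartState x₀ (g.normalCurve τ p) s := by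
  rw [normalState, extChartAt_to_inv]

variable [T2Space M]

/-- Regularity propagates along the flow of the geodesic equation, for a time which is locally
uniform, and the derivative with respect to the initial point solves the linearized equation. -/
lemma exists_isRegularAt_step (g : LorentzMetric n M) (τ : M → ℝ) (x₀ : M)
    {z₀ : CoordSpace n × CoordSpace n} (hz₀ : z₀.1 ∈ (extChartAt (𝓡 (n + 1)) x₀).target) :
    ∃ δ > 0, ∃ W : Set (CoordSpace n × CoordSpace n), IsOpen W ∧ z₀ ∈ W ∧
      ∀ (p : M) (r : ℝ), g.IsRegularAt τ p x₀ r →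
      g.normalState τ p x₀ r (extChartAt (𝓡 (n + 1)) p p) ∈ W →
      (∀ s, s - r ∈ Ioo (-δ) δ → g.IsRegularAt τ p x₀ s) ∧
      HasDerivAt (fun s ↦ fderiv ℝ (g.normalState τ p x₀ s) (extChartAt (𝓡 (n + 1)) p p))
        ((fderiv ℝ (geodesicField (g.chartGamma x₀))
          (g.normalState τ p x₀ r (extChartAt (𝓡 (n + 1)) p p))).comp
          (fderiv ℝ (g.normalState τ p x₀ r) (extChartAt (𝓡 (n + 1)) p p))) r ∧
      HasFDerivAt (fun q : ℝ × CoordSpace n ↦ g.normalState τ p x₀ q.1 q.2)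
        (((1 : ℝ →L[ℝ] ℝ).smulRight (geodesicField (g.chartGamma x₀)
          (g.normalState τ p x₀ r (extChartAt (𝓡 (n + 1)) p p)))).coprod
          (fderiv ℝ (g.normalState τ p x₀ r) (extChartAt (𝓡 (n + 1)) p p)))
        (r, extChartAt (𝓡 (n + 1)) p p) ∧
      ∀ᶠ q in 𝓝 (r, extChartAt (𝓡 (n + 1)) p p),
        g.normalExp τ (q.1, (extChartAt (𝓡 (n + 1)) p).symm q.2) ∈
          (extChartAt (𝓡 (n + 1)) x₀).source := by
  obtain ⟨δ, hδ, W, hW, hzW, Φ, Y, hΦ⟩ := exists_local_flow_normalCurve g τ x₀ hz₀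
  refine ⟨δ, hδ, W, hW, hzW, fun p r hreg hrW ↦ ?_⟩
  set y₀ := extChartAt (𝓡 (n + 1)) p p
  set S := g.normalState τ p x₀
  have hS : HasFDerivAt (S r) (fderiv ℝ (S r) y₀) y₀ := hreg.differentiableAt.hasFDerivAt
  have hev : ∀ᶠ y in 𝓝 y₀, ∀ s, s - r ∈ Ioo (-δ) δ →
      ((s, (extChartAt (𝓡 (n + 1)) p).symm y) ∈ g.expDomain τ ∧
      g.normalExp τ (s, (extChartAt (𝓡 (n + 1)) p).symm y) ∈
        (extChartAt (𝓡 (n + 1)) x₀).source) ∧ S s y = Φ (s - r) (S r y) := by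
    filter_upwards [hreg.eventually_mem, hS.continuousAt.eventually_mem (hW.mem_nhds hrW)]
      with y h1 h2 s hs
    have := (hΦ _ h2).2 _ r h1.1 h1.2 rfl s hs
    exact ⟨⟨this.1, this.2.1⟩, this.2.2⟩
  obtain ⟨⟨h0, hflow⟩, -⟩ := hΦ _ hrW
  have hDS : ∀ s, s - r ∈ Ioo (-δ) δ →
      HasFDerivAt (S s) ((Y (s - r) (S r y₀)).comp (fderiv ℝ (S r) y₀)) y₀ := by
    intro s hs
    have h1 := (hflow _ hs).2.2.2
    have h2 : HasFDerivAt (fun y ↦ (s - r, S r y)) _ y₀ := (hasFDerivAt_const (s - r) y₀).prodMk hS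
    have h3 := HasFDerivAt.comp y₀ h1 h2
    refine (h3.congr_of_eventuallyEq (hev.mono fun y hy ↦ (hy s hs).2)).congr_fderiv ?_
    ext w <;> simp
  have hI : Ioo (-δ) δ ∈ 𝓝 (0 : ℝ) := isOpen_Ioo.mem_nhds ⟨by linarith, hδ⟩
  have hr0 : r - r ∈ Ioo (-δ) δ := by simpa using hδ
  have hIr : ∀ᶠ s in 𝓝 r, s - r ∈ Ioo (-δ) δ := by
    have : ContinuousAt (fun s : ℝ ↦ s - r) r := by fun_prop
    exact this.eventually_mem (by simpa using hI)
  have hY0 : (Y 0 (S r y₀)).comp (fderiv ℝ (S r) y₀) = fderiv ℝ (S r) y₀ := by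
    have := (hDS r hr0).fderiv
    rw [sub_self] at this
    exact this.symm
  have hprod : ∀ᶠ q in 𝓝 (r, y₀), q.1 - r ∈ Ioo (-δ) δ ∧ ∀ s, s - r ∈ Ioo (-δ) δ →
      ((s, (extChartAt (𝓡 (n + 1)) p).symm q.2) ∈ g.expDomain τ ∧
      g.normalExp τ (s, (extChartAt (𝓡 (n + 1)) p).symm q.2) ∈
        (extChartAt (𝓡 (n + 1)) x₀).source) ∧ S s q.2 = Φ (s - r) (S r q.2) :=
    hIr.prod_nhds hev
  have h00 : (0 : ℝ) ∈ Ioo (-δ) δ := ⟨by linarith, hδ⟩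
  refine ⟨fun s hs ↦ ⟨hev.mono fun y hy ↦ (hy s hs).1, (hDS s hs).differentiableAt⟩, ?_, ?_, ?_⟩
  · have h1 := (hflow _ hr0).2.2.1.comp_sub_const r r
    have h2 := h1.clm_comp (hasDerivAt_const r (fderiv ℝ (S r) y₀))
    refine (h2.congr_of_eventuallyEq (hIr.mono fun s hs ↦ (hDS s hs).fderiv)).congr_deriv ?_
    rw [ContinuousLinearMap.comp_zero, add_zero, sub_self, h0, ContinuousLinearMap.comp_assoc, hY0]
  · have h1 := (hflow _ h00).2.2.2
    have h2' : HasFDerivAt (fun q : ℝ × CoordSpace n ↦ S r q.2)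
        ((fderiv ℝ (S r) y₀).comp (ContinuousLinearMap.snd ℝ ℝ (CoordSpace n))) (r, y₀) :=
      HasFDerivAt.comp (g := S r) (f := Prod.snd) (r, y₀) hS hasFDerivAt_snd
    have h2 : HasFDerivAt (fun q : ℝ × CoordSpace n ↦ (q.1 - r, S r q.2)) _ (r, y₀) :=
      (hasFDerivAt_fst.sub_const r).prodMk h2'
    rw [show ((0 : ℝ), S r y₀) = (fun q : ℝ × CoordSpace n ↦ (q.1 - r, S r q.2)) (r, y₀) by simp]
      at h1
    have h3 := HasFDerivAt.comp (r, y₀) h1 h2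
    refine (h3.congr_of_eventuallyEq (hprod.mono fun q hq ↦ (hq.2 q.1 hq.1).2)).congr_fderiv ?_
    rw [h0]
    have hY0' := fun w ↦ DFunLike.congr_fun hY0 w
    ext1
    · ext <;> simp
    · exact ContinuousLinearMap.ext fun w ↦ by simpa using hY0' w
  · exact hprod.mono fun q hq ↦ (hq.2 q.1 hq.1).1.2

/-- Regularity does not depend on the chart. -/
lemma IsRegularAt.change_chart {p x₀ x₁ : M} {s : ℝ} (h : g.IsRegularAt τ p x₀ s)
    (h1 : g.normalExp τ (s, p) ∈ (extChartAt (𝓡 (n + 1)) x₁).source) :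
    g.IsRegularAt τ p x₁ s ∧ g.normalState τ p x₁ s =ᶠ[𝓝 (extChartAt (𝓡 (n + 1)) p p)]
      tangentChange x₀ x₁ ∘ g.normalState τ p x₀ s := by
  set y₀ := extChartAt (𝓡 (n + 1)) p p
  have hmem := mem_chartOverlap h.mem.2 h1
  have hz : (g.normalState τ p x₀ s y₀).1 ∈ chartOverlap x₀ x₁ := by
    rw [normalState_extChartAt]
    exact hmem
  have hcont : ContinuousAt (fun y ↦ (g.normalState τ p x₀ s y).1) y₀ :=
    h.differentiableAt.continuousAt.fst
  have hsrc : ∀ᶠ y in 𝓝 y₀, ((s, (extChartAt (𝓡 (n + 1)) p).symm y) ∈ g.expDomain τ ∧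
      g.normalExp τ (s, (extChartAt (𝓡 (n + 1)) p).symm y) ∈ (extChartAt (𝓡 (n + 1)) x₀).source) ∧
      g.normalExp τ (s, (extChartAt (𝓡 (n + 1)) p).symm y) ∈ (extChartAt (𝓡 (n + 1)) x₁).source := by
    filter_upwards [h.eventually_mem, hcont.eventually_mem ((isOpen_chartOverlap x₀ x₁).mem_nhds hz)]
      with y h2 h3
    refine ⟨h2, ?_⟩
    have := h3.2
    rwa [mem_preimage, normalState, chartState, (extChartAt (𝓡 (n + 1)) x₀).left_inv h2.2] at this
  have hev : g.normalState τ p x₁ s =ᶠ[𝓝 y₀] tangentChange x₀ x₁ ∘ g.normalState τ p x₀ s := by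
    filter_upwards [hsrc] with y hy
    obtain ⟨A, B, hc, hs⟩ := exists_isNormalGeodesic_normalCurve hy.1.1
    exact chartState_chartChange (hc.2.2.1.isGeodesicAt hs).mdifferentiableAt hy.1.2 hy.2
  obtain ⟨L, hL, -⟩ := hasFDerivAt_tangentChange hz
  exact ⟨⟨hsrc.mono fun y hy ↦ ⟨hy.1.1, hy.2⟩,
    (hL.differentiableAt.comp y₀ h.differentiableAt).congr_of_eventuallyEq hev⟩, hev⟩

/-- At parameter `0` the normal geodesics are given by the unit normal field. -/
lemma IsTimeFunction.isRegularAt_zero (hτ : g.IsTimeFunction τ) (p : M) :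
    g.IsRegularAt τ p p 0 ∧ ∀ᶠ y in 𝓝 (extChartAt (𝓡 (n + 1)) p p),
      g.normalState τ p p 0 y = (y, chartField p (g.unitNormal τ) y) := by
  set y₀ := extChartAt (𝓡 (n + 1)) p p
  set N := chartField p (g.unitNormal τ)
  have hy₀ : y₀ ∈ (extChartAt (𝓡 (n + 1)) p).target := mem_extChartAt_target p
  have hT : (extChartAt (𝓡 (n + 1)) p).target ∈ 𝓝 y₀ := (isOpen_extChartAt_target p).mem_nhds hy₀
  have hN : DifferentiableAt ℝ N y₀ :=
    ((hτ.contDiffOn_chartField_unitNormal p).contDiffAt hT).differentiableAt (by simp)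
  have hopen : IsOpen ((extChartAt (𝓡 (n + 1)) p).target ×ˢ (univ : Set (CoordSpace n))) :=
    (isOpen_extChartAt_target p).prod isOpen_univ
  obtain ⟨δ, hδ, W, hW, hzW, Φ, Y, hΦ⟩ := ContDiffOn.exists_local_flow hopen
    ((g.isLeviCivitaOn p).contDiffOn_geodesicField.of_le two_le_infty) (z₀ := (y₀, N y₀))
    ⟨hy₀, trivial⟩
  have h00 : (0 : ℝ) ∈ Ioo (-δ) δ := ⟨by linarith, hδ⟩
  have hcont : ContinuousAt (fun y ↦ (y, N y)) y₀ := continuousAt_id.prodMk hN.continuousAt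
  have hgeod : ∀ᶠ y in 𝓝 y₀, y ∈ (extChartAt (𝓡 (n + 1)) p).target ∧
      ∃ c : ℝ → M, g.IsNormalGeodesic τ ((extChartAt (𝓡 (n + 1)) p).symm y) c (-δ) δ := by
    filter_upwards [hT, hcont.eventually_mem (hW.mem_nhds hzW)] with y hy hyW
    obtain ⟨h0, hs⟩ := hΦ _ hyW
    have hint := fun s (hs' : s ∈ Ioo (-δ) δ) ↦ g.isGeodesicAt_of_integralCurve p
      (z := fun s ↦ Φ s (y, N y)) (J := Ioo (-δ) δ) isOpen_Ioo
      (fun s hs' ↦ (hs _ hs').1.1) (fun s hs' ↦ (hs _ hs').2.1) hs'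
    refine ⟨hy, _, isNormalGeodesic_of_chartState (x₀ := p) (by linarith) hδ
      ((g.isGeodesicOn_iff isOpen_Ioo).2 fun s hs' ↦ (hint s hs').2.2)
      ((extChartAt (𝓡 (n + 1)) p).map_target hy) ?_ ?_⟩
    · simp only [h0]
    · rw [(hint 0 h00).2.1, h0, (extChartAt (𝓡 (n + 1)) p).right_inv hy]
  have hev : ∀ᶠ y in 𝓝 y₀, g.normalState τ p p 0 y = (y, N y) := by
    filter_upwards [hgeod] with y hy
    obtain ⟨hy, c, hc⟩ := hy
    rw [normalState, hc.normalCurve.chartState_zero ((extChartAt (𝓡 (n + 1)) p).map_target hy),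
      (extChartAt (𝓡 (n + 1)) p).right_inv hy]
  refine ⟨⟨?_, (differentiableAt_id.prodMk hN).congr_of_eventuallyEq hev⟩, hev⟩
  filter_upwards [hgeod] with y hy
  obtain ⟨hy, c, hc⟩ := hy
  refine ⟨⟨c, _, _, hc, h00⟩, ?_⟩
  rw [hc.normalExp_eq h00, hc.2.2.2.1]
  exact (extChartAt (𝓡 (n + 1)) p).map_target hy

/-- The normal geodesics depend differentiably on the initial point as long as they are defined. -/
lemma IsTimeFunction.isRegularAt (hτ : g.IsTimeFunction τ) {p : M} {c : ℝ → M} {A B : ℝ}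
    (hc : g.IsNormalGeodesic τ p c A B) {t : ℝ} (ht : t ∈ Ioo A B) {x₀ : M}
    (hx₀ : g.normalExp τ (t, p) ∈ (extChartAt (𝓡 (n + 1)) x₀).source) :
    g.IsRegularAt τ p x₀ t := by
  replace hc := hc.normalCurve
  set y₀ := extChartAt (𝓡 (n + 1)) p p
  have hcS : ∀ {x₀ : M} {t : ℝ}, t ∈ Ioo A B →
      g.normalExp τ (t, p) ∈ (extChartAt (𝓡 (n + 1)) x₀).source →
      ContinuousAt (fun s ↦ g.normalState τ p x₀ s y₀) t := by
    intro x₀ t ht hx₀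
    have := (hc.2.2.1.isGeodesicAt ht).hasDerivAt_chartState hx₀
    refine this.continuousAt.congr (Eventually.of_forall fun s ↦ ?_)
    exact (normalState_extChartAt g τ p x₀ s).symm
  have htarget : ∀ {x₀ : M} {t : ℝ}, g.normalExp τ (t, p) ∈ (extChartAt (𝓡 (n + 1)) x₀).source →
      (g.normalState τ p x₀ t y₀).1 ∈ (extChartAt (𝓡 (n + 1)) x₀).target := by
    intro x₀ t hx₀
    rw [normalState_extChartAt]
    exact (extChartAt (𝓡 (n + 1)) x₀).map_source hx₀
  -- the regular parameters form an open set which is closed in the interval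
  set R : Set ℝ := {t | ∃ x₀, g.IsRegularAt τ p x₀ t}
  have hRopen : IsOpen R := by
    refine isOpen_iff_mem_nhds.2 ?_
    rintro r ⟨x₀, hr⟩
    obtain ⟨δ, hδ, W, hW, hzW, hstep⟩ := exists_isRegularAt_step g τ x₀ (htarget hr.mem.2)
    have := (hstep p r hr hzW).1
    filter_upwards [isOpen_Ioo.mem_nhds (show r ∈ Ioo (r - δ) (r + δ) from
      ⟨by linarith, by linarith⟩)] with s hs
    exact ⟨x₀, this s ⟨by linarith [hs.1], by linarith [hs.2]⟩⟩
  have hsub : Ioo A B ⊆ R := by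
    refine isPreconnected_Ioo.subset_of_closure_inter_subset hRopen
      ⟨0, ⟨hc.1, hc.2.1⟩, p, (hτ.isRegularAt_zero p).1⟩ ?_
    rintro t ⟨htR, htI⟩
    set x₁ := g.normalExp τ (t, p)
    have hsrc : x₁ ∈ (extChartAt (𝓡 (n + 1)) x₁).source := mem_extChartAt_source x₁
    obtain ⟨δ, hδ, W, hW, hzW, hstep⟩ := exists_isRegularAt_step g τ x₁ (htarget hsrc)
    obtain ⟨r, ⟨x₀, hr⟩, hrδ, hrW, hrs⟩ := ((mem_closure_iff_frequently.1 htR).and_eventually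
      ((isOpen_Ioo.eventually_mem (show t ∈ Ioo (t - δ) (t + δ) from
        ⟨by linarith, by linarith⟩)).and (((hcS htI hsrc).eventually_mem (hW.mem_nhds hzW)).and
        ((hc.2.2.1.isGeodesicAt htI).1.continuousAt.eventually_mem
          ((isOpen_extChartAt_source x₁).mem_nhds hsrc))))).exists
    exact ⟨x₁, (hstep p r (hr.change_chart hrs).1 hrW).1 t
      ⟨by linarith [hrδ.2], by linarith [hrδ.1]⟩⟩
  obtain ⟨x₁, h1⟩ := hsub ht
  exact (h1.change_chart hx₀).1

end LorentzMetric

/-! ### The differential of the exponential map -/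

lemma HasMFDerivAt.prodMk_space {E H X E₁ E₂ : Type*} [NormedAddCommGroup E] [NormedSpace ℝ E]
    [TopologicalSpace H] [TopologicalSpace X] [ChartedSpace H X] {I : ModelWithCorners ℝ E H}
    [NormedAddCommGroup E₁] [NormedSpace ℝ E₁] [NormedAddCommGroup E₂] [NormedSpace ℝ E₂]
    {f : X → E₁} {f' : X → E₂} {x : X} {df : TangentSpace I x →L[ℝ] E₁}
    {df' : TangentSpace I x →L[ℝ] E₂} (hf : HasMFDerivAt I 𝓘(ℝ, E₁) f x df)
    (hf' : HasMFDerivAt I 𝓘(ℝ, E₂) f' x df') :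
    HasMFDerivAt I 𝓘(ℝ, E₁ × E₂) (fun y ↦ (f y, f' y)) x (df.prod df') :=
  ⟨hf.1.prodMk hf'.1, hf.2.prodMk hf'.2⟩

namespace LorentzMetric

variable {n : ℕ} {M : Type*} [TopologicalSpace M]
  [ChartedSpace (EuclideanSpace ℝ (Fin (n + 1))) M]
  [IsManifold (𝓡 (n + 1)) ∞ M] [T2Space M] {g : LorentzMetric n M} {τ : M → ℝ}

/-- The exponential map is differentiable at regular parameters; its differential is the velocity in
the direction of the parameter and the variation of the position in the directions of `M`. -/
lemma IsRegularAt.mfderiv_normalExp {p x₀ : M} {t : ℝ} (h : g.IsRegularAt τ p x₀ t) :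
    MDifferentiableAt (𝓘(ℝ, ℝ).prod (𝓡 (n + 1))) (𝓡 (n + 1)) (g.normalExp τ) (t, p) ∧
    ∀ (σ : ℝ) (w : TangentSpace (𝓡 (n + 1)) p),
      (mfderiv (𝓘(ℝ, ℝ).prod (𝓡 (n + 1))) (𝓡 (n + 1)) (g.normalExp τ) (t, p) (σ, w) :
        CoordSpace n) = mfderiv 𝓘(ℝ, CoordSpace n) (𝓡 (n + 1)) (extChartAt (𝓡 (n + 1)) x₀).symm
          (g.normalState τ p x₀ t (extChartAt (𝓡 (n + 1)) p p)).1
          (σ • (g.normalState τ p x₀ t (extChartAt (𝓡 (n + 1)) p p)).2 +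
            (fderiv ℝ (g.normalState τ p x₀ t) (extChartAt (𝓡 (n + 1)) p p)
              (mfderiv (𝓡 (n + 1)) 𝓘(ℝ, CoordSpace n) (extChartAt (𝓡 (n + 1)) p) p w)).1) := by
  set y₀ := extChartAt (𝓡 (n + 1)) p p with hy₀
  have hsrc := h.mem.2
  have htarget : (g.normalState τ p x₀ t y₀).1 ∈ (extChartAt (𝓡 (n + 1)) x₀).target := by
    rw [normalState_extChartAt]
    exact (extChartAt (𝓡 (n + 1)) x₀).map_source hsrc
  obtain ⟨δ, hδ, W, hW, hzW, hstep⟩ := exists_isRegularAt_step g τ x₀ htarget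
  obtain ⟨-, -, hjoint, hjsrc⟩ := hstep p t h hzW
  have : IsManifold (𝓡 (n + 1)) 1 M := IsManifold.of_le (n := ∞) (by exact_mod_cast le_top)
  have hφ := (mdifferentiableAt_extChartAt (I := 𝓡 (n + 1)) (mem_chart_source _ p)).hasMFDerivAt
  have h1 : HasMFDerivAt (𝓘(ℝ, ℝ).prod (𝓡 (n + 1))) 𝓘(ℝ, ℝ × CoordSpace n)
      (fun q : ℝ × M ↦ (q.1, extChartAt (𝓡 (n + 1)) p q.2)) (t, p) _ :=
    HasMFDerivAt.prodMk_space (hasMFDerivAt_fst (t, p))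
      (HasMFDerivAt.comp (t, p) hφ (hasMFDerivAt_snd (t, p)))
  have h2 : HasMFDerivAt 𝓘(ℝ, ℝ × CoordSpace n) 𝓘(ℝ, CoordSpace n)
      (fun q : ℝ × CoordSpace n ↦ (g.normalState τ p x₀ q.1 q.2).1) (t, y₀) _ :=
    (HasFDerivAt.comp (t, y₀) hasFDerivAt_fst hjoint).hasMFDerivAt
  have h3 := (mdifferentiableAt_extChartAt_symm x₀ htarget).hasMFDerivAt
  have h4 := HasMFDerivAt.comp (t, p) h3 (HasMFDerivAt.comp (t, p) h2 h1)
  have hcont : ContinuousAt (fun q : ℝ × M ↦ (q.1, extChartAt (𝓡 (n + 1)) p q.2)) (t, p) :=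
    h1.continuousAt
  have hev : g.normalExp τ =ᶠ[𝓝 (t, p)] (extChartAt (𝓡 (n + 1)) x₀).symm ∘
      ((fun q : ℝ × CoordSpace n ↦ (g.normalState τ p x₀ q.1 q.2).1) ∘
      fun q : ℝ × M ↦ (q.1, extChartAt (𝓡 (n + 1)) p q.2)) := by
    have hp : ∀ᶠ q : ℝ × M in 𝓝 (t, p), q.2 ∈ (extChartAt (𝓡 (n + 1)) p).source :=
      continuousAt_snd.eventually_mem ((isOpen_extChartAt_source p).mem_nhds
        (mem_extChartAt_source p))
    filter_upwards [hp, hcont.eventually hjsrc] with q hq hq'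
    simp only [Function.comp, normalState, chartState, (extChartAt (𝓡 (n + 1)) p).left_inv hq]
    simp only [(extChartAt (𝓡 (n + 1)) p).left_inv hq] at hq'
    exact ((extChartAt (𝓡 (n + 1)) x₀).left_inv hq').symm
  have h5 := h4.congr_of_eventuallyEq hev
  refine ⟨h5.mdifferentiableAt, fun σ w ↦ ?_⟩
  rw [h5.mfderiv]
  rfl

end LorentzMetric

/-! ### Jacobi tensors along a geodesic -/

section JacobiTensor

variable {E : Type*} [NormedAddCommGroup E] [NormedSpace ℝ E]

/-- Let `α` be a linear form and `N` a vector with `α N = 1`, and `D` the derivative of the states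
of a family of geodesics with respect to the initial point. The endomorphism sends `h` in the
kernel of `α` to the variation of the position in the direction `h`, and `N` to the velocity. -/
def jacobiTensor (α : E →L[ℝ] ℝ) (N : E) (z : E × E) (D : E →L[ℝ] E × E) : E →L[ℝ] E :=
  ((ContinuousLinearMap.fst ℝ E E).comp D).comp (ContinuousLinearMap.id ℝ E - α.smulRight N)
    + α.smulRight z.2

/-- The covariant derivative of `jacobiTensor` along the geodesic. -/
def jacobiTensorDeriv (Γ : E → E →L[ℝ] E →L[ℝ] E) (α : E →L[ℝ] ℝ) (N : E) (z : E × E)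
    (D : E →L[ℝ] E × E) : E →L[ℝ] E :=
  ((ContinuousLinearMap.snd ℝ E E).comp D
    + (Γ z.1 z.2).comp ((ContinuousLinearMap.fst ℝ E E).comp D)).comp
      (ContinuousLinearMap.id ℝ E - α.smulRight N)

lemma jacobiTensor_apply (α : E →L[ℝ] ℝ) (N : E) (z : E × E) (D : E →L[ℝ] E × E) (h : E) :
    jacobiTensor α N z D h = (D (h - α h • N)).1 + α h • z.2 := by
  simp [jacobiTensor]

lemma jacobiTensorDeriv_apply (Γ : E → E →L[ℝ] E →L[ℝ] E) (α : E →L[ℝ] ℝ) (N : E) (z : E × E)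
    (D : E →L[ℝ] E × E) (h : E) : jacobiTensorDeriv Γ α N z D h =
      (D (h - α h • N)).2 + Γ z.1 z.2 (D (h - α h • N)).1 := by
  simp [jacobiTensorDeriv]
  abel

namespace IsLeviCivitaOn

variable {G : E → E →L[ℝ] E →L[ℝ] ℝ} {Γ : E → E →L[ℝ] E →L[ℝ] E} {U : Set E}

lemma hasDerivAt_jacobiTensor (hG : IsLeviCivitaOn G Γ U) {z : ℝ → E × E}
    {D : ℝ → E →L[ℝ] E × E} {s : ℝ} (hzU : (z s).1 ∈ U)
    (hz : HasDerivAt z (geodesicField Γ (z s)) s)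
    (hD : HasDerivAt D ((fderiv ℝ (geodesicField Γ) (z s)).comp (D s)) s) (α : E →L[ℝ] ℝ) (N : E) :
    HasDerivAt (fun s ↦ jacobiTensor α N (z s) (D s))
      (jacobiTensorDeriv Γ α N (z s) (D s)
        - (Γ (z s).1 (z s).2).comp (jacobiTensor α N (z s) (D s))) s := by
  set Q : E →L[ℝ] E := ContinuousLinearMap.id ℝ E - α.smulRight N
  have hv : HasDerivAt (fun s ↦ (z s).2) (-Γ (z s).1 (z s).2 (z s).2) s :=
    (hasFDerivAt_snd.comp_hasDerivAt s hz :)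
  have h1 := ((hasDerivAt_const s (ContinuousLinearMap.fst ℝ E E)).clm_comp hD).clm_comp
    (hasDerivAt_const s Q)
  have h2 : HasDerivAt (fun s ↦ α.smulRight (z s).2) (α.smulRight (-Γ (z s).1 (z s).2 (z s).2)) s :=
    ((ContinuousLinearMap.smulRightL ℝ E E α).hasFDerivAt.comp_hasDerivAt s hv :)
  refine (h1.add h2).congr_deriv ?_
  refine ContinuousLinearMap.ext fun h ↦ ?_
  simp [jacobiTensor_apply, jacobiTensorDeriv_apply, hG.fderiv_geodesicField hzU, Q]
  abel

lemma hasDerivAt_jacobiTensorDeriv (hG : IsLeviCivitaOn G Γ U) {z : ℝ → E × E}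
    {D : ℝ → E →L[ℝ] E × E} {s : ℝ} (hzU : (z s).1 ∈ U)
    (hz : HasDerivAt z (geodesicField Γ (z s)) s)
    (hD : HasDerivAt D ((fderiv ℝ (geodesicField Γ) (z s)).comp (D s)) s) (α : E →L[ℝ] ℝ) (N : E) :
    HasDerivAt (fun s ↦ jacobiTensorDeriv Γ α N (z s) (D s))
      (-(Γ (z s).1 (z s).2).comp (jacobiTensorDeriv Γ α N (z s) (D s))
        - (jacobiOperator Γ (z s).1 (z s).2).comp (jacobiTensor α N (z s) (D s))) s := by
  set Q : E →L[ℝ] E := ContinuousLinearMap.id ℝ E - α.smulRight N with hQ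
  have hx : HasDerivAt (fun s ↦ (z s).1) (z s).2 s := (hasFDerivAt_fst.comp_hasDerivAt s hz :)
  have hv : HasDerivAt (fun s ↦ (z s).2) (-Γ (z s).1 (z s).2 (z s).2) s :=
    (hasFDerivAt_snd.comp_hasDerivAt s hz :)
  have hΓ : HasDerivAt (fun s ↦ Γ (z s).1) (fderiv ℝ Γ (z s).1 (z s).2) s :=
    (hG.hasFDerivAt_gamma hzU).comp_hasDerivAt s hx
  have h1 := (hasDerivAt_const s (ContinuousLinearMap.fst ℝ E E)).clm_comp hD
  have h2 := (hasDerivAt_const s (ContinuousLinearMap.snd ℝ E E)).clm_comp hD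
  have h3 := (h2.add ((hΓ.clm_apply hv).clm_comp h1)).clm_comp (hasDerivAt_const s Q)
  refine h3.congr_deriv (ContinuousLinearMap.ext fun h ↦ ?_)
  have t1 := hG.torsion_free _ hzU
  have t2 := hG.fderiv_gamma_symm hzU
  have e : (D s) h - α h • (D s) N = D s (Q h) := by simp [hQ]
  simp only [ContinuousLinearMap.comp_zero, ContinuousLinearMap.zero_comp, zero_add,
    ContinuousLinearMap.comp_apply, add_apply, neg_apply,
    sub_apply, jacobiTensor_apply, jacobiTensorDeriv_apply, jacobiOperator_apply,
    hG.fderiv_geodesicField hzU, curvature, map_add, map_smul, map_neg,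
    ContinuousLinearMap.coe_fst', ContinuousLinearMap.coe_snd']
  have hq : Q h = h - α h • N := by simp [hQ]
  rw [hq]
  set a := (D s (h - α h • N)).1
  set b := (D s (h - α h • N)).2
  rw [t1 b, t2 _ a (z s).2, t1 a (Γ _ _ _), t1 a (z s).2, t1 (z s).2 (Γ _ _ _)]
  have e0 : ∀ x y : E, x - x + y - y = 0 := fun x y ↦ by abel
  rw [e0, smul_zero, zero_apply]
  abel

/-- The Wronskian of two Jacobi fields is constant, by the pair symmetry of the curvature tensor. -/
lemma hasDerivAt_wronskian (hG : IsLeviCivitaOn G Γ U) {z : ℝ → E × E} {J P : ℝ → E →L[ℝ] E}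
    {s : ℝ} (hzU : (z s).1 ∈ U) (hz : HasDerivAt z (geodesicField Γ (z s)) s)
    (hJ : HasDerivAt J (P s - (Γ (z s).1 (z s).2).comp (J s)) s)
    (hP : HasDerivAt P (-(Γ (z s).1 (z s).2).comp (P s)
      - (jacobiOperator Γ (z s).1 (z s).2).comp (J s)) s) (a b : E) :
    HasDerivAt (fun s ↦ G (z s).1 (P s a) (J s b) - G (z s).1 (J s a) (P s b)) 0 s := by
  have hx : HasDerivAt (fun s ↦ (z s).1) (z s).2 s := (hasFDerivAt_fst.comp_hasDerivAt s hz :)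
  have hJ' := fun a ↦ hJ.clm_apply (hasDerivAt_const s a)
  have hP' := fun a ↦ hP.clm_apply (hasDerivAt_const s a)
  refine ((hG.hasDerivAt_metric hx (hP' a) (hJ' b) hzU).sub
    (hG.hasDerivAt_metric hx (hJ' a) (hP' b) hzU)).congr_deriv ?_
  have := hG.metric_curvature_symm hzU (J s a) (J s b) (z s).2
  simp [jacobiOperator_apply, this]
  ring

variable [FiniteDimensional ℝ E]

variable (E) in
/-- The trace, as a continuous linear form. -/
def _root_.ContinuousLinearMap.traceL : (E →L[ℝ] E) →L[ℝ] ℝ :=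
  ((LinearMap.trace ℝ E).comp (ContinuousLinearMap.coeLM ℝ)).toContinuousLinearMap

lemma _root_.ContinuousLinearMap.traceL_apply (A : E →L[ℝ] E) :
    ContinuousLinearMap.traceL E A = LinearMap.trace ℝ E A := rfl

lemma _root_.ContinuousLinearMap.traceL_mul_comm (A B : E →L[ℝ] E) :
    ContinuousLinearMap.traceL E (A * B) = ContinuousLinearMap.traceL E (B * A) :=
  LinearMap.trace_mul_comm ℝ _ _

/-- The trace of the Riccati equation for `P J⁻¹`. The term `Γv`, which turns derivatives of
coordinates into covariant derivatives, enters through a commutator and has no trace. -/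
lemma hasDerivAt_trace_riccati {Γv R : E →L[ℝ] E} {J P : ℝ → E →L[ℝ] E} {s : ℝ}
    (hJ : HasDerivAt J (P s - Γv.comp (J s)) s)
    (hP : HasDerivAt P (-Γv.comp (P s) - R.comp (J s)) s) (hu : IsUnit (J s)) :
    HasDerivAt (fun s ↦ ContinuousLinearMap.traceL E (P s * Ring.inverse (J s)))
      (-ContinuousLinearMap.traceL E R - ContinuousLinearMap.traceL E
        ((P s * Ring.inverse (J s)) * (P s * Ring.inverse (J s)))) s := by
  have : CompleteSpace E := FiniteDimensional.complete ℝ E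
  obtain ⟨u, hu⟩ := hu
  have hinv := hasFDerivAt_ringInverse (𝕜 := ℝ) u
  rw [hu] at hinv
  have h1 := hinv.comp_hasDerivAt s hJ
  have h2 : HasDerivAt (fun s ↦ P s * Ring.inverse (J s)) _ s := hP.mul h1
  refine ((ContinuousLinearMap.traceL E).hasFDerivAt.comp_hasDerivAt s h2).congr_deriv ?_
  rw [← hu, Ring.inverse_unit]
  change ContinuousLinearMap.traceL E ((-(Γv * P s) - R * ↑u) * ↑u⁻¹ +
    P s * (-(↑u⁻¹ * (P s - Γv * ↑u) * ↑u⁻¹))) = _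
  have e : (-(Γv * P s) - R * (↑u : E →L[ℝ] E)) * (↑u⁻¹ : E →L[ℝ] E) +
      P s * (-((↑u⁻¹ : E →L[ℝ] E) * (P s - Γv * ↑u) * (↑u⁻¹ : E →L[ℝ] E))) =
      -(Γv * (P s * ↑u⁻¹)) - R - (P s * ↑u⁻¹) * (P s * ↑u⁻¹) + (P s * ↑u⁻¹) * Γv := by
    have h3 : (↑u : E →L[ℝ] E) * (↑u⁻¹ : E →L[ℝ] E) = 1 := u.mul_inv
    have h4 : Γv * (↑u : E →L[ℝ] E) * (↑u⁻¹ : E →L[ℝ] E) = Γv := by rw [mul_assoc, h3, mul_one]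
    have h5 : R * (↑u : E →L[ℝ] E) * (↑u⁻¹ : E →L[ℝ] E) = R := by rw [mul_assoc, h3, mul_one]
    have h6 : P s * ((↑u⁻¹ : E →L[ℝ] E) * (Γv * ↑u * (↑u⁻¹ : E →L[ℝ] E))) = P s * ↑u⁻¹ * Γv := by
      rw [h4, mul_assoc]
    simp only [sub_mul, mul_sub, neg_mul, mul_neg, mul_assoc] at h4 h5 h6 ⊢
    rw [h5, h6]
    abel
  rw [e]
  simp only [map_add, map_sub, map_neg]
  rw [ContinuousLinearMap.traceL_mul_comm Γv]
  ring

end IsLeviCivitaOn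

/-- If the Wronskian vanishes, then `P J⁻¹` is symmetric and annihilates the velocity, so that its
trace is controlled by the trace of its square. -/
lemma IsLorentzForm.sq_trace_le_of_wronskian [FiniteDimensional ℝ E] {n : ℕ}
    {G : E →L[ℝ] E →L[ℝ] ℝ} (hG : IsLorentzForm n G) {J P : E →L[ℝ] E} (hJ : IsUnit J)
    (hW : ∀ a b, G (P a) (J b) - G (J a) (P b) = 0) {N v : E} (hJN : J N = v) (hPN : P N = 0)
    (hv : G v v = -1) :
    ContinuousLinearMap.traceL E (P * Ring.inverse J) ^ 2 ≤
      n * ContinuousLinearMap.traceL E ((P * Ring.inverse J) * (P * Ring.inverse J)) := by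
  have : CompleteSpace E := FiniteDimensional.complete ℝ E
  have hsurj : ∀ w, ∃ a, J a = w := (ContinuousLinearMap.isUnit_iff_bijective.1 hJ).2
  have hSJ : ∀ a, (P * Ring.inverse J) (J a) = P a := by
    intro a
    have : (P * Ring.inverse J) * J = P := by
      rw [mul_assoc, Ring.inverse_mul_cancel _ hJ, mul_one]
    exact DFunLike.congr_fun this a
  refine hG.trace_sq_le hv (P * Ring.inverse J : E →L[ℝ] E) (fun u w ↦ ?_) ?_
  · obtain ⟨a, rfl⟩ := hsurj u
    obtain ⟨b, rfl⟩ := hsurj w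
    have := hSJ a
    have := hSJ b
    simp only [ContinuousLinearMap.coe_coe, *]
    exact sub_eq_zero.1 (hW a b)
  · rw [← hJN]
    exact (hSJ N).trans hPN
end JacobiTensor

/-! ### The Jacobi tensor of the normal geodesics -/

namespace LorentzMetric

variable {n : ℕ} {M : Type*} [TopologicalSpace M]
  [ChartedSpace (EuclideanSpace ℝ (Fin (n + 1))) M]
  [IsManifold (𝓡 (n + 1)) ∞ M] {g : LorentzMetric n M} {τ : M → ℝ}

/-- The linear form `h ↦ -⟨N, h⟩` at `p`, in the chart at `p`: its kernel is the tangent space of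
the time slice, and its value at the unit normal `N` is `1`. -/
def normalForm (g : LorentzMetric n M) (τ : M → ℝ) (p : M) : CoordSpace n →L[ℝ] ℝ :=
  -g.chartMetric p (extChartAt (𝓡 (n + 1)) p p)
    (chartField p (g.unitNormal τ) (extChartAt (𝓡 (n + 1)) p p))

/-- The Jacobi tensor of the family of normal geodesics along `c_p`, completed by the velocity. Its
argument lives in the chart at `p` and its value in the chart at `x₀`. -/
def normalJacobi (g : LorentzMetric n M) (τ : M → ℝ) (p x₀ : M) (s : ℝ) :
    CoordSpace n →L[ℝ] CoordSpace n :=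
  jacobiTensor (g.normalForm τ p) (chartField p (g.unitNormal τ) (extChartAt (𝓡 (n + 1)) p p))
    (g.normalState τ p x₀ s (extChartAt (𝓡 (n + 1)) p p))
    (fderiv ℝ (g.normalState τ p x₀ s) (extChartAt (𝓡 (n + 1)) p p))

/-- The covariant derivative of `normalJacobi` along the geodesic. -/
def normalJacobiDeriv (g : LorentzMetric n M) (τ : M → ℝ) (p x₀ : M) (s : ℝ) :
    CoordSpace n →L[ℝ] CoordSpace n :=
  jacobiTensorDeriv (g.chartGamma x₀) (g.normalForm τ p)
    (chartField p (g.unitNormal τ) (extChartAt (𝓡 (n + 1)) p p))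
    (g.normalState τ p x₀ s (extChartAt (𝓡 (n + 1)) p p))
    (fderiv ℝ (g.normalState τ p x₀ s) (extChartAt (𝓡 (n + 1)) p p))

/-- The covariant derivative of the velocity field of the normal geodesics, as an endomorphism of
the tangent space at `c_p(s)`. It is `0` by convention where the Jacobi tensor is singular. -/
def normalShape (g : LorentzMetric n M) (τ : M → ℝ) (p x₀ : M) (s : ℝ) :
    CoordSpace n →L[ℝ] CoordSpace n :=
  g.normalJacobiDeriv τ p x₀ s * Ring.inverse (g.normalJacobi τ p x₀ s)

/-- The expansion of the normal geodesics along `c_p`. -/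
def normalExpansion (g : LorentzMetric n M) (τ : M → ℝ) (p x₀ : M) (s : ℝ) : ℝ :=
  ContinuousLinearMap.traceL (CoordSpace n) (g.normalShape τ p x₀ s)

/-- The Wronskian of two Jacobi fields of the family. -/
def normalWronskian (g : LorentzMetric n M) (τ : M → ℝ) (p : M) (a b : CoordSpace n) (x₀ : M)
    (s : ℝ) : ℝ :=
  let x := (g.normalState τ p x₀ s (extChartAt (𝓡 (n + 1)) p p)).1
  g.chartMetric x₀ x (g.normalJacobiDeriv τ p x₀ s a) (g.normalJacobi τ p x₀ s b)
    - g.chartMetric x₀ x (g.normalJacobi τ p x₀ s a) (g.normalJacobiDeriv τ p x₀ s b)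

/-- The square of the velocity of `c_p`. -/
def normalEnergy (g : LorentzMetric n M) (τ : M → ℝ) (p x₀ : M) (s : ℝ) : ℝ :=
  let z := g.normalState τ p x₀ s (extChartAt (𝓡 (n + 1)) p p)
  g.chartMetric x₀ z.1 z.2 z.2

lemma IsTimeFunction.normalForm_unitNormal (hτ : g.IsTimeFunction τ) (p : M) :
    g.normalForm τ p (chartField p (g.unitNormal τ) (extChartAt (𝓡 (n + 1)) p p)) = 1 := by
  rw [normalForm, neg_apply, hτ.chartMetric_unitNormal_self p (mem_extChartAt_target p), neg_neg]

lemma IsTimeFunction.normalForm_eq_zero_iff (hτ : g.IsTimeFunction τ) (p : M) (h : CoordSpace n) :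
    g.normalForm τ p h = 0 ↔ fderiv ℝ (fun y ↦ τ ((extChartAt (𝓡 (n + 1)) p).symm y))
      (extChartAt (𝓡 (n + 1)) p p) h = 0 := by
  rw [normalForm, neg_apply, hτ.chartMetric_unitNormal p (mem_extChartAt_target p), neg_eq_zero,
    mul_eq_zero, or_iff_right (hτ.chartLapse_neg p _).ne]

/-- The velocity is the Jacobi field that belongs to the unit normal. -/
lemma IsTimeFunction.normalJacobi_unitNormal (hτ : g.IsTimeFunction τ) (p x₀ : M) (s : ℝ) :
    g.normalJacobi τ p x₀ s (chartField p (g.unitNormal τ) (extChartAt (𝓡 (n + 1)) p p)) =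
      (g.normalState τ p x₀ s (extChartAt (𝓡 (n + 1)) p p)).2 := by
  rw [normalJacobi, jacobiTensor_apply, hτ.normalForm_unitNormal]
  simp

lemma IsTimeFunction.normalJacobiDeriv_unitNormal (hτ : g.IsTimeFunction τ) (p x₀ : M) (s : ℝ) :
    g.normalJacobiDeriv τ p x₀ s (chartField p (g.unitNormal τ) (extChartAt (𝓡 (n + 1)) p p))
      = 0 := by
  rw [normalJacobiDeriv, jacobiTensorDeriv_apply, hτ.normalForm_unitNormal]
  simp

lemma IsRegularAt.normalState_mem {p x₀ : M} {s : ℝ} (h : g.IsRegularAt τ p x₀ s) :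
    (g.normalState τ p x₀ s (extChartAt (𝓡 (n + 1)) p p)).1 ∈
      (extChartAt (𝓡 (n + 1)) x₀).target := by
  rw [normalState_extChartAt]
  exact (extChartAt (𝓡 (n + 1)) x₀).map_source h.mem.2

lemma isUnit_fderiv_chartChange {x₀ x₁ : M} {y : CoordSpace n} (hy : y ∈ chartOverlap x₀ x₁) :
    IsUnit (fderiv ℝ (chartChange (n := n) x₀ x₁) y) := by
  have h1 := fderiv_chartChange_comp hy
  have h2 := fderiv_chartChange_comp (chartChange_mem hy)
  rw [chartChange_chartChange hy] at h2
  exact ⟨⟨_, _, h2, h1⟩, rfl⟩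

lemma IsNormalGeodesic.hasDerivAt_normalState {p x₀ : M} {A B t : ℝ}
    (hc : g.IsNormalGeodesic τ p (g.normalCurve τ p) A B) (ht : t ∈ Ioo A B)
    (hx₀ : g.normalExp τ (t, p) ∈ (extChartAt (𝓡 (n + 1)) x₀).source) :
    HasDerivAt (fun s ↦ g.normalState τ p x₀ s (extChartAt (𝓡 (n + 1)) p p))
      (geodesicField (g.chartGamma x₀)
        (g.normalState τ p x₀ t (extChartAt (𝓡 (n + 1)) p p))) t := by
  simp only [normalState_extChartAt]
  exact (hc.2.2.1.isGeodesicAt ht).hasDerivAt_chartState hx₀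

lemma IsRegularAt.hasDerivAt_normalEnergy {p x₀ : M} {A B t : ℝ}
    (h : g.IsRegularAt τ p x₀ t)
    (hc : g.IsNormalGeodesic τ p (g.normalCurve τ p) A B) (ht : t ∈ Ioo A B) :
    HasDerivAt (g.normalEnergy τ p x₀) 0 t := by
  have hz := hc.hasDerivAt_normalState ht h.mem.2
  have hx := hasFDerivAt_fst.comp_hasDerivAt t hz
  have hv := hasFDerivAt_snd.comp_hasDerivAt t hz
  refine ((g.isLeviCivitaOn x₀).hasDerivAt_metric hx hv hv h.normalState_mem).congr_deriv ?_
  simp [geodesicField]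

/-- A quantity which does not depend on the chart and has derivative `0` is constant along the
geodesic. -/
lemma IsNormalGeodesic.eq_of_hasDerivAt_zero {p : M} {A B : ℝ}
    (hc : g.IsNormalGeodesic τ p (g.normalCurve τ p) A B) {f : M → ℝ → ℝ}
    (hf : ∀ t ∈ Ioo A B, ∀ x₀ x₁, g.normalExp τ (t, p) ∈ (extChartAt (𝓡 (n + 1)) x₀).source →
      g.normalExp τ (t, p) ∈ (extChartAt (𝓡 (n + 1)) x₁).source → f x₁ t = f x₀ t)
    (hd : ∀ t ∈ Ioo A B, HasDerivAt (f (g.normalExp τ (t, p))) 0 t) {t : ℝ} (ht : t ∈ Ioo A B)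
    {x₀ : M} (hx₀ : g.normalExp τ (t, p) ∈ (extChartAt (𝓡 (n + 1)) x₀).source) :
    f x₀ t = f p 0 := by
  have h0 : (0 : ℝ) ∈ Ioo A B := ⟨hc.1, hc.2.1⟩
  have hF : ∀ t ∈ Ioo A B, HasDerivAt (fun s ↦ f (g.normalExp τ (s, p)) s) 0 t := by
    intro t ht
    refine (hd t ht).congr_of_eventuallyEq ?_
    filter_upwards [isOpen_Ioo.mem_nhds ht, (hc.2.2.1.isGeodesicAt ht).1.continuousAt.eventually_mem
      ((isOpen_extChartAt_source _).mem_nhds (mem_extChartAt_source (I := 𝓡 (n + 1)) (g.normalExp τ (t, p))))]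
      with s hs hs'
    exact hf s hs _ _ hs' (mem_extChartAt_source _)
  have := isOpen_Ioo.is_const_of_deriv_eq_zero isPreconnected_Ioo
    (fun t ht ↦ (hF t ht).differentiableAt.differentiableWithinAt) (fun t ht ↦ (hF t ht).deriv) ht h0
  rw [hf t ht (g.normalExp τ (t, p)) x₀ (mem_extChartAt_source _) hx₀, this]
  exact congrArg (fun x ↦ f x 0) hc.2.2.2.1

variable [T2Space M]

/-- The Jacobi tensor and its covariant derivative transform like vectors. -/
lemma IsRegularAt.normalJacobi_chartChange {p x₀ x₁ : M} {s : ℝ} (h : g.IsRegularAt τ p x₀ s)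
    (h1 : g.normalExp τ (s, p) ∈ (extChartAt (𝓡 (n + 1)) x₁).source) :
    let y₀ := extChartAt (𝓡 (n + 1)) p p
    let z := g.normalState τ p x₀ s y₀
    let L := fderiv ℝ (chartChange (n := n) x₀ x₁) z.1
    z.1 ∈ chartOverlap x₀ x₁ ∧
    g.normalState τ p x₁ s y₀ = (chartChange x₀ x₁ z.1, L z.2) ∧
    g.normalJacobi τ p x₁ s = L * g.normalJacobi τ p x₀ s ∧
    g.normalJacobiDeriv τ p x₁ s = L * g.normalJacobiDeriv τ p x₀ s := by
  intro y₀ z L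
  obtain ⟨-, hev⟩ := h.change_chart h1
  have hz : z.1 ∈ chartOverlap x₀ x₁ := by
    simp only [z, y₀, normalState_extChartAt]
    exact mem_chartOverlap h.mem.2 h1
  obtain ⟨L', hL', hLw⟩ := hasFDerivAt_tangentChange hz
  have hD := (hL'.comp y₀ h.differentiableAt.hasFDerivAt).congr_of_eventuallyEq hev
  have hz1 : g.normalState τ p x₁ s y₀ = (chartChange x₀ x₁ z.1, L z.2) := hev.self_of_nhds
  have hJ1 : ∀ w, (fderiv ℝ (g.normalState τ p x₁ s) y₀ w).1 =
      L (fderiv ℝ (g.normalState τ p x₀ s) y₀ w).1 := by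
    intro w
    rw [hD.fderiv, ContinuousLinearMap.comp_apply, hLw]
  have hP1 : ∀ w, (fderiv ℝ (g.normalState τ p x₁ s) y₀ w).2 =
      fderiv ℝ (fderiv ℝ (chartChange x₀ x₁)) z.1 (fderiv ℝ (g.normalState τ p x₀ s) y₀ w).1 z.2
        + L (fderiv ℝ (g.normalState τ p x₀ s) y₀ w).2 := by
    intro w
    rw [hD.fderiv, ContinuousLinearMap.comp_apply, hLw]
  refine ⟨hz, hz1, ?_, ?_⟩
  · refine ContinuousLinearMap.ext fun w ↦ ?_
    rw [mul_apply_eq_comp, normalJacobi, normalJacobi, jacobiTensor_apply,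
      jacobiTensor_apply, hJ1, hz1]
    simp only [map_add, map_smul]
    rfl
  · refine ContinuousLinearMap.ext fun w ↦ ?_
    rw [mul_apply_eq_comp, normalJacobiDeriv, normalJacobiDeriv,
      jacobiTensorDeriv_apply, jacobiTensorDeriv_apply, hJ1, hP1, hz1]
    set w' := w - g.normalForm τ p w • chartField p (g.unitNormal τ) (extChartAt (𝓡 (n + 1)) p p)
    set a := (fderiv ℝ (g.normalState τ p x₀ s) y₀ w').1
    have e := g.chartGamma_chartChange hz a z.2
    have t0 := (g.isLeviCivitaOn x₀).torsion_free z.1 hz.1 z.2 a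
    have t1 := (g.isLeviCivitaOn x₁).torsion_free _ (chartChange_mem hz).1 (L z.2) (L a)
    rw [map_add, t0]
    change _ + g.chartGamma x₁ (chartChange x₀ x₁ z.1) (L z.2) (L a) = _
    rw [t1, ← e]
    abel

lemma IsRegularAt.normalExpansion_chartChange {p x₀ x₁ : M} {s : ℝ} (h : g.IsRegularAt τ p x₀ s)
    (h1 : g.normalExp τ (s, p) ∈ (extChartAt (𝓡 (n + 1)) x₁).source)
    (hu : IsUnit (g.normalJacobi τ p x₀ s)) :
    g.normalExpansion τ p x₁ s = g.normalExpansion τ p x₀ s := by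
  obtain ⟨hz, -, hJ, hP⟩ := h.normalJacobi_chartChange h1
  obtain ⟨u, hu⟩ := hu
  obtain ⟨l, hl⟩ := isUnit_fderiv_chartChange hz
  rw [← hl] at hJ hP
  rw [normalExpansion, normalShape, hJ, hP, normalExpansion, normalShape, ← hu, ← Units.val_mul,
    Ring.inverse_unit, Ring.inverse_unit, mul_inv_rev, Units.val_mul, mul_assoc,
    ContinuousLinearMap.traceL_mul_comm, mul_assoc, mul_assoc, Units.inv_mul, mul_one]

lemma IsRegularAt.normalWronskian_chartChange {p x₀ x₁ : M} {s : ℝ} (h : g.IsRegularAt τ p x₀ s)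
    (h1 : g.normalExp τ (s, p) ∈ (extChartAt (𝓡 (n + 1)) x₁).source) (a b : CoordSpace n) :
    g.normalWronskian τ p a b x₁ s = g.normalWronskian τ p a b x₀ s := by
  obtain ⟨hz, hz1, hJ, hP⟩ := h.normalJacobi_chartChange h1
  simp only [normalWronskian]
  rw [hz1, hJ, hP, g.chartMetric_chartChange hz, g.chartMetric_chartChange hz]
  rfl

lemma IsRegularAt.normalEnergy_chartChange {p x₀ x₁ : M} {s : ℝ} (h : g.IsRegularAt τ p x₀ s)
    (h1 : g.normalExp τ (s, p) ∈ (extChartAt (𝓡 (n + 1)) x₁).source) :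
    g.normalEnergy τ p x₁ s = g.normalEnergy τ p x₀ s := by
  obtain ⟨hz, hz1, -, -⟩ := h.normalJacobi_chartChange h1
  simp only [normalEnergy]
  rw [hz1, g.chartMetric_chartChange hz]

lemma IsRegularAt.hasDerivAt_fderiv {p x₀ : M} {t : ℝ} (h : g.IsRegularAt τ p x₀ t) :
    HasDerivAt (fun s ↦ fderiv ℝ (g.normalState τ p x₀ s) (extChartAt (𝓡 (n + 1)) p p))
      ((fderiv ℝ (geodesicField (g.chartGamma x₀))
        (g.normalState τ p x₀ t (extChartAt (𝓡 (n + 1)) p p))).comp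
        (fderiv ℝ (g.normalState τ p x₀ t) (extChartAt (𝓡 (n + 1)) p p))) t := by
  obtain ⟨δ, hδ, W, hW, hzW, hstep⟩ := exists_isRegularAt_step g τ x₀ h.normalState_mem
  exact (hstep p t h hzW).2.1

lemma IsRegularAt.hasDerivAt_normalJacobi {p x₀ : M} {A B t : ℝ} (h : g.IsRegularAt τ p x₀ t)
    (hc : g.IsNormalGeodesic τ p (g.normalCurve τ p) A B) (ht : t ∈ Ioo A B) :
    let z := g.normalState τ p x₀ t (extChartAt (𝓡 (n + 1)) p p)
    HasDerivAt (g.normalJacobi τ p x₀) (g.normalJacobiDeriv τ p x₀ t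
      - (g.chartGamma x₀ z.1 z.2).comp (g.normalJacobi τ p x₀ t)) t :=
  (g.isLeviCivitaOn x₀).hasDerivAt_jacobiTensor h.normalState_mem
    (hc.hasDerivAt_normalState ht h.mem.2) h.hasDerivAt_fderiv _ _

lemma IsRegularAt.hasDerivAt_normalJacobiDeriv {p x₀ : M} {A B t : ℝ}
    (h : g.IsRegularAt τ p x₀ t)
    (hc : g.IsNormalGeodesic τ p (g.normalCurve τ p) A B) (ht : t ∈ Ioo A B) :
    let z := g.normalState τ p x₀ t (extChartAt (𝓡 (n + 1)) p p)
    HasDerivAt (g.normalJacobiDeriv τ p x₀)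
      (-(g.chartGamma x₀ z.1 z.2).comp (g.normalJacobiDeriv τ p x₀ t)
      - (jacobiOperator (g.chartGamma x₀) z.1 z.2).comp (g.normalJacobi τ p x₀ t)) t :=
  (g.isLeviCivitaOn x₀).hasDerivAt_jacobiTensorDeriv h.normalState_mem
    (hc.hasDerivAt_normalState ht h.mem.2) h.hasDerivAt_fderiv _ _

lemma IsRegularAt.hasDerivAt_normalWronskian {p x₀ : M} {A B t : ℝ}
    (h : g.IsRegularAt τ p x₀ t)
    (hc : g.IsNormalGeodesic τ p (g.normalCurve τ p) A B) (ht : t ∈ Ioo A B)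
    (a b : CoordSpace n) : HasDerivAt (g.normalWronskian τ p a b x₀) 0 t :=
  (g.isLeviCivitaOn x₀).hasDerivAt_wronskian h.normalState_mem
    (hc.hasDerivAt_normalState ht h.mem.2) (h.hasDerivAt_normalJacobi hc ht)
    (h.hasDerivAt_normalJacobiDeriv hc ht) a b

/-- The trace of the Riccati equation, and the estimate of its quadratic term. -/
lemma IsRegularAt.exists_hasDerivAt_normalExpansion {p x₀ : M} {A B t : ℝ}
    (h : g.IsRegularAt τ p x₀ t) (hτ : g.IsTimeFunction τ)
    (hc : g.IsNormalGeodesic τ p (g.normalCurve τ p) A B) (ht : t ∈ Ioo A B)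
    (hu : IsUnit (g.normalJacobi τ p x₀ t)) (hW : ∀ a b, g.normalWronskian τ p a b x₀ t = 0)
    (hE : g.normalEnergy τ p x₀ t = -1) :
    let z := g.normalState τ p x₀ t (extChartAt (𝓡 (n + 1)) p p)
    ∃ θ' : ℝ, HasDerivAt (g.normalExpansion τ p x₀) θ' t ∧
      n * (θ' + ContinuousLinearMap.traceL (CoordSpace n)
        (jacobiOperator (g.chartGamma x₀) z.1 z.2)) + g.normalExpansion τ p x₀ t ^ 2 ≤ 0 := by
  intro z
  refine ⟨_, IsLeviCivitaOn.hasDerivAt_trace_riccati (h.hasDerivAt_normalJacobi hc ht)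
    (h.hasDerivAt_normalJacobiDeriv hc ht) hu, ?_⟩
  have := (g.isLorentzForm_chartMetric x₀ h.normalState_mem).sq_trace_le_of_wronskian hu hW
    (hτ.normalJacobi_unitNormal p x₀ t) (hτ.normalJacobiDeriv_unitNormal p x₀ t) hE
  rw [normalExpansion, normalShape]
  linarith

end LorentzMetric

/-! ### The initial values of the Jacobi tensor -/

section Slice

variable {E : Type*} [NormedAddCommGroup E] [NormedSpace ℝ E]
  {G : E → E →L[ℝ] E →L[ℝ] ℝ} {Γ : E → E →L[ℝ] E →L[ℝ] E} {U : Set E}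

lemma IsLeviCivitaOn.hasDerivAt_metric_line (hG : IsLeviCivitaOn G Γ U) {y : E} (hy : y ∈ U)
    {A B : E → E} {A' B' : E →L[ℝ] E} (hA : HasFDerivAt A A' y) (hB : HasFDerivAt B B' y) (u : E) :
    HasDerivAt (fun s : ℝ ↦ G (y + s • u) (A (y + s • u)) (B (y + s • u)))
      (G y (A' u + Γ y u (A y)) (B y) + G y (A y) (B' u + Γ y u (B y))) 0 := by
  have hx : HasDerivAt (fun s : ℝ ↦ y + s • u) u 0 := by
    simpa using ((hasDerivAt_id (0 : ℝ)).smul_const u).const_add y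
  have hA' : HasDerivAt (fun s : ℝ ↦ A (y + s • u)) (A' u) 0 := hA.hasLineDerivAt u
  have hB' : HasDerivAt (fun s : ℝ ↦ B (y + s • u)) (B' u) 0 := hB.hasLineDerivAt u
  simpa using hG.hasDerivAt_metric hx hA' hB' (by simpa using hy)

/-- The covariant derivative of a unit normal field has no normal component. -/
lemma IsLeviCivitaOn.metric_covariant_self (hG : IsLeviCivitaOn G Γ U) {y : E} (hy : y ∈ U)
    {N : E → E} {N' : E →L[ℝ] E} (hN : HasFDerivAt N N' y) {k : ℝ}
    (h : ∀ᶠ x in 𝓝 y, G x (N x) (N x) = k) (u : E) : G y (N' u + Γ y u (N y)) (N y) = 0 := by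
  have h1 := hG.hasDerivAt_metric_line hy hN hN u
  have hc : ContinuousAt (fun s : ℝ ↦ y + s • u) 0 := by fun_prop
  have hc' : Tendsto (fun s : ℝ ↦ y + s • u) (𝓝 0) (𝓝 y) := by simpa [ContinuousAt] using hc
  have h2 := (hasDerivAt_const (0 : ℝ) k).congr_of_eventuallyEq
    ((hc'.eventually h).mono fun s hs ↦ hs)
  have h3 := h1.unique h2
  rw [hG.metric_symm y hy (N y)] at h3
  linarith

/-- The second fundamental form of a level set is symmetric. -/
lemma IsLeviCivitaOn.metric_covariant_symm (hG : IsLeviCivitaOn G Γ U) {y : E} (hy : y ∈ U)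
    {N : E → E} {N' : E →L[ℝ] E} (hN : HasFDerivAt N N' y) {f τ : E → ℝ}
    (hf : DifferentiableAt ℝ f y) (hτ : ContDiffAt ℝ 2 τ y)
    (h : ∀ᶠ x in 𝓝 y, ∀ w, G x (N x) w = f x * fderiv ℝ τ x w) {u w : E}
    (hu : fderiv ℝ τ y u = 0) (hw : fderiv ℝ τ y w = 0) :
    G y (N' u + Γ y u (N y)) w = G y u (N' w + Γ y w (N y)) := by
  have hdτ : HasFDerivAt (fderiv ℝ τ) (fderiv ℝ (fderiv ℝ τ) y) y :=
    ((hτ.fderiv_right (m := 1) (by norm_num)).differentiableAt (by simp)).hasFDerivAt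
  have hsymm : fderiv ℝ (fderiv ℝ τ) y u w = fderiv ℝ (fderiv ℝ τ) y w u :=
    (hτ.isSymmSndFDerivAt (by simp)).eq u w
  have key : ∀ u w, fderiv ℝ τ y w = 0 → G y (N' u + Γ y u (N y)) w =
      f y * fderiv ℝ (fderiv ℝ τ) y u w - G y (N y) (Γ y u w) := by
    intro u w hw
    have h1 := hG.hasDerivAt_metric_line hy hN (hasFDerivAt_const w y) u
    have hx : HasDerivAt (fun s : ℝ ↦ y + s • u) u 0 := by
      simpa using ((hasDerivAt_id (0 : ℝ)).smul_const u).const_add y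
    have hf' : HasDerivAt (fun s : ℝ ↦ f (y + s • u)) (fderiv ℝ f y u) 0 :=
      hf.hasFDerivAt.hasLineDerivAt u
    have hτ' : HasDerivAt (fun s : ℝ ↦ fderiv ℝ τ (y + s • u)) (fderiv ℝ (fderiv ℝ τ) y u) 0 :=
      hdτ.hasLineDerivAt u
    have h2 := hf'.mul (hτ'.clm_apply (hasDerivAt_const (0 : ℝ) w))
    have hc' : Tendsto (fun s : ℝ ↦ y + s • u) (𝓝 0) (𝓝 y) := by
      simpa [ContinuousAt] using hx.continuousAt
    have h3 := h1.unique (h2.congr_of_eventuallyEq ((hc'.eventually h).mono fun s hs ↦ hs w))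
    simp only [zero_smul, add_zero, hw, mul_zero, map_zero, zero_add, zero_apply] at h3
    exact eq_sub_of_add_eq h3
  rw [key u w hw, hG.metric_symm y hy u, key w u hu, hsymm, hG.torsion_free y hy u w]

end Slice

namespace LorentzMetric

variable {n : ℕ} {M : Type*} [TopologicalSpace M]
  [ChartedSpace (EuclideanSpace ℝ (Fin (n + 1))) M]
  [IsManifold (𝓡 (n + 1)) ∞ M] {g : LorentzMetric n M} {τ : M → ℝ}

lemma IsTimeFunction.differentiableAt_chartField_unitNormal (hτ : g.IsTimeFunction τ) (p : M) :
    DifferentiableAt ℝ (chartField p (g.unitNormal τ)) (extChartAt (𝓡 (n + 1)) p p) :=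
  ((hτ.contDiffOn_chartField_unitNormal p).contDiffAt ((isOpen_extChartAt_target p).mem_nhds
    (mem_extChartAt_target p))).differentiableAt (by simp)

variable [T2Space M]

lemma IsTimeFunction.normalState_zero (hτ : g.IsTimeFunction τ) (p : M) :
    g.normalState τ p p 0 (extChartAt (𝓡 (n + 1)) p p) = (extChartAt (𝓡 (n + 1)) p p,
      chartField p (g.unitNormal τ) (extChartAt (𝓡 (n + 1)) p p)) :=
  (hτ.isRegularAt_zero p).2.self_of_nhds

lemma IsTimeFunction.fderiv_normalState_zero (hτ : g.IsTimeFunction τ) (p : M) (h : CoordSpace n) :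
    fderiv ℝ (g.normalState τ p p 0) (extChartAt (𝓡 (n + 1)) p p) h =
      (h, fderiv ℝ (chartField p (g.unitNormal τ)) (extChartAt (𝓡 (n + 1)) p p) h) := by
  have h1 := ((hasFDerivAt_id (extChartAt (𝓡 (n + 1)) p p)).prodMk
    (hτ.differentiableAt_chartField_unitNormal p).hasFDerivAt).congr_of_eventuallyEq
      (hτ.isRegularAt_zero p).2
  rw [h1.fderiv]
  rfl

lemma IsTimeFunction.normalJacobi_zero (hτ : g.IsTimeFunction τ) (p : M) :
    g.normalJacobi τ p p 0 = 1 := by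
  refine ContinuousLinearMap.ext fun h ↦ ?_
  rw [normalJacobi, jacobiTensor_apply, hτ.fderiv_normalState_zero, hτ.normalState_zero]
  simp

/-- The initial value of the covariant derivative of the Jacobi tensor is the covariant derivative
of the unit normal in the direction of the component `h'` tangent to the time slice. -/
lemma IsTimeFunction.normalJacobiDeriv_zero (hτ : g.IsTimeFunction τ) (p : M) (h : CoordSpace n) :
    let y₀ := extChartAt (𝓡 (n + 1)) p p
    let N := chartField p (g.unitNormal τ)
    let h' := h - g.normalForm τ p h • N y₀
    g.normalJacobiDeriv τ p p 0 h = fderiv ℝ N y₀ h' + g.chartGamma p y₀ h' (N y₀) := by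
  intro y₀ N h'
  rw [normalJacobiDeriv, jacobiTensorDeriv_apply, hτ.fderiv_normalState_zero, hτ.normalState_zero,
    (g.isLeviCivitaOn p).torsion_free _ (mem_extChartAt_target p)]

lemma IsTimeFunction.normalEnergy_zero (hτ : g.IsTimeFunction τ) (p : M) :
    g.normalEnergy τ p p 0 = -1 := by
  simp only [normalEnergy]
  rw [hτ.normalState_zero]
  exact hτ.chartMetric_unitNormal_self p (mem_extChartAt_target p)

/-- The Wronskian vanishes initially, by the symmetry of the second fundamental form. -/
lemma IsTimeFunction.normalWronskian_zero (hτ : g.IsTimeFunction τ) (p : M) (a b : CoordSpace n) :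
    g.normalWronskian τ p a b p 0 = 0 := by
  simp only [normalWronskian]
  rw [hτ.normalJacobi_zero, hτ.normalJacobiDeriv_zero, hτ.normalJacobiDeriv_zero,
    hτ.normalState_zero, one_apply_eq_self, one_apply_eq_self]
  set y₀ := extChartAt (𝓡 (n + 1)) p p
  set N := chartField p (g.unitNormal τ)
  have hy₀ : y₀ ∈ (extChartAt (𝓡 (n + 1)) p).target := mem_extChartAt_target p
  have hT := (isOpen_extChartAt_target (I := 𝓡 (n + 1)) p).mem_nhds hy₀
  have hG := g.isLeviCivitaOn p
  have hN : HasFDerivAt N (fderiv ℝ N y₀) y₀ :=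
    (hτ.differentiableAt_chartField_unitNormal p).hasFDerivAt
  have hself := hG.metric_covariant_self hy₀ hN (k := -1) (by
    filter_upwards [hT] with y hy using hτ.chartMetric_unitNormal_self p hy)
  have hker : ∀ h, fderiv ℝ (fun y ↦ τ ((extChartAt (𝓡 (n + 1)) p).symm y)) y₀
      (h - g.normalForm τ p h • N y₀) = 0 := by
    intro h
    rw [← hτ.normalForm_eq_zero_iff p, map_sub, map_smul, hτ.normalForm_unitNormal]
    simp
  have hsymm := hG.metric_covariant_symm hy₀ hN
    (((hτ.contDiffOn_chartLapse p).contDiffAt hT).differentiableAt (by simp))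
    (((contDiffOn_comp_extChartAt_symm hτ.1 p).contDiffAt hT).of_le two_le_infty)
    (by filter_upwards [hT] with y hy using hτ.chartMetric_unitNormal p hy) (hker a) (hker b)
  set a' := a - g.normalForm τ p a • N y₀ with ha'
  set b' := b - g.normalForm τ p b • N y₀ with hb'
  have ea : a = a' + g.normalForm τ p a • N y₀ := by rw [ha']; abel
  have eb : b = b' + g.normalForm τ p b • N y₀ := by rw [hb']; abel
  have s1 := hself a'
  have s2 := hself b'
  rw [hG.metric_symm y₀ hy₀] at s2
  rw [eb, ea]
  simp only [map_add, map_smul, add_apply, smul_apply] at s1 s2 hsymm ⊢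
  simp only [smul_eq_mul]
  linear_combination hsymm + g.normalForm τ p b * s1 - g.normalForm τ p a * s2

end LorentzMetric

/-! ### The expansion of the normal geodesic field -/

/-- A function which vanishes on a regular level set has a derivative which vanishes on the tangent
space of the level set: all points of the level set are extrema, with Lagrange multipliers. -/
lemma fderiv_eq_zero_of_eq_zero_on_level {E : Type*} [NormedAddCommGroup E] [NormedSpace ℝ E]
    [CompleteSpace E] {f τ : E → ℝ} {f' τ' : E →L[ℝ] ℝ} {y : E} (hf : HasStrictFDerivAt f f' y)
    (hτ : HasStrictFDerivAt τ τ' y) (hτ' : τ' ≠ 0) (h0 : ∀ᶠ x in 𝓝 y, τ x = τ y → f x = 0) {w : E}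
    (hw : τ' w = 0) : f' w = 0 := by
  have hmax : IsLocalExtrOn f {x | τ x = τ y} y := by
    refine Or.inl ?_
    filter_upwards [nhdsWithin_le_nhds h0, self_mem_nhdsWithin] with x hx hx'
    rw [hx hx', h0.self_of_nhds rfl]
  obtain ⟨a, b, hab, h⟩ := hmax.exists_multipliers_of_hasStrictFDerivAt_1d hτ hf
  have hb : b ≠ 0 := by
    rintro rfl
    have ha : a ≠ 0 := fun ha ↦ hab (by rw [ha]; rfl)
    rw [zero_smul, add_zero] at h
    exact hτ' ((smul_eq_zero.1 h).resolve_left ha)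
  have := DFunLike.congr_fun h w
  simp only [add_apply, smul_apply, smul_eq_mul, hw, mul_zero, zero_add, zero_apply] at this
  exact (mul_eq_zero.1 this).resolve_left hb

namespace LorentzMetric

variable {n : ℕ} {M : Type*} [TopologicalSpace M]
  [ChartedSpace (EuclideanSpace ℝ (Fin (n + 1))) M]
  [IsManifold (𝓡 (n + 1)) ∞ M] {g : LorentzMetric n M} {τ : M → ℝ}

lemma contDiffAt_chartField {X : ∀ x : M, TangentSpace (𝓡 (n + 1)) x} {p : M}
    (hX : ContMDiffAt (𝓡 (n + 1)) (𝓡 (n + 1)).tangent ∞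
      (fun x ↦ (⟨x, X x⟩ : TangentBundle (𝓡 (n + 1)) M)) p) :
    ContDiffAt ℝ ∞ (chartField p X) (extChartAt (𝓡 (n + 1)) p p) := by
  have hp : extChartAt (𝓡 (n + 1)) p p ∈ (extChartAt (𝓡 (n + 1)) p).target :=
    mem_extChartAt_target p
  have hT := (isOpen_extChartAt_target (I := 𝓡 (n + 1)) p).mem_nhds hp
  have h1 := (Bundle.contMDiffAt_section p).1 hX
  have h2 : ContMDiffAt 𝓘(ℝ, CoordSpace n) (𝓡 (n + 1)) ∞ (extChartAt (𝓡 (n + 1)) p).symm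
      (extChartAt (𝓡 (n + 1)) p p) :=
    (contMDiffOn_extChartAt_symm (I := 𝓡 (n + 1)) (n := ∞) p).contMDiffAt hT
  rw [← extChartAt_to_inv (I := 𝓡 (n + 1)) p] at h1
  have h3 := (h1.comp _ h2).contDiffAt
  refine h3.congr_of_eventuallyEq ?_
  filter_upwards [hT] with y hy
  have hy' : (extChartAt (𝓡 (n + 1)) p).symm y ∈ (chartAt (CoordSpace n) p).source := by
    rw [← extChartAt_source (𝓡 (n + 1))]
    exact (extChartAt (𝓡 (n + 1)) p).map_target hy
  have : IsManifold (𝓡 (n + 1)) 1 M := IsManifold.of_le (n := ∞) (by exact_mod_cast le_top)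
  have h4 := TangentBundle.continuousLinearMapAt_trivializationAt (I := 𝓡 (n + 1)) hy'
  set e := trivializationAt (CoordSpace n) (TangentSpace (𝓡 (n + 1)) : M → Type _) p with he
  have h5 : e.continuousLinearMapAt ℝ _ (X ((extChartAt (𝓡 (n + 1)) p).symm y)) =
      (e ⟨_, X ((extChartAt (𝓡 (n + 1)) p).symm y)⟩).2 := by
    rw [Bundle.Trivialization.continuousLinearMapAt_apply,
      Bundle.Trivialization.linearMapAt_apply, if_pos (by exact hy')]
  rw [Function.comp_apply, extChartAt_to_inv, ← he, ← h5]
  exact (DFunLike.congr_fun h4 (X ((extChartAt (𝓡 (n + 1)) p).symm y))).symm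

/-- The divergence is the trace of the covariant derivative. -/
lemma divergence_eq (g : LorentzMetric n M) {X : ∀ x : M, TangentSpace (𝓡 (n + 1)) x} {p : M}
    (hX : DifferentiableAt ℝ (chartField p X) (extChartAt (𝓡 (n + 1)) p p)) :
    g.divergence X p = ContinuousLinearMap.traceL (CoordSpace n)
      (fderiv ℝ (chartField p X) (extChartAt (𝓡 (n + 1)) p p)
        + (g.chartGamma p (extChartAt (𝓡 (n + 1)) p p)).flip
          (chartField p X (extChartAt (𝓡 (n + 1)) p p))) := by
  rw [ContinuousLinearMap.traceL_apply, trace_eq_sum, divergence]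
  refine Finset.sum_congr rfl fun i _ ↦ ?_
  have h1 : pd i (fun y ↦ coordVec p ((extChartAt (𝓡 (n + 1)) p).symm y)
      (X ((extChartAt (𝓡 (n + 1)) p).symm y)) i) (extChartAt (𝓡 (n + 1)) p p) =
      fderiv ℝ (chartField p X) (extChartAt (𝓡 (n + 1)) p p) (coordBasis i) i := by
    have := (EuclideanSpace.proj i : CoordSpace n →L[ℝ] ℝ).hasFDerivAt.comp
      (extChartAt (𝓡 (n + 1)) p p) hX.hasFDerivAt
    have h2 : HasFDerivAt (fun y ↦ coordVec p ((extChartAt (𝓡 (n + 1)) p).symm y)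
      (X ((extChartAt (𝓡 (n + 1)) p).symm y)) i) _ (extChartAt (𝓡 (n + 1)) p p) := this
    rw [pd, h2.fderiv]
    rfl
  have h2 : ∀ j, coordVec p p (X p) j = chartField p X (extChartAt (𝓡 (n + 1)) p p) j := by
    intro j
    rw [chartField_extChartAt (mem_extChartAt_source p)]
    rfl
  rw [h1]
  simp only [h2]
  rw [add_apply, ContinuousLinearMap.flip_apply, PiLp.add_apply]
  congr 1
  rw [chartGamma_apply]
  simp

variable [T2Space M]

lemma IsNormalGeodesicField.chartField_eq {a t : ℝ} {V : Set M}
    {X : ∀ x : M, TangentSpace (𝓡 (n + 1)) x} (hX : g.IsNormalGeodesicField τ a V X) {q x₀ : M}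
    (hq : τ q = a) (ht : g.StaysIn τ V t q)
    (hsrc : g.normalExp τ (t, q) ∈ (extChartAt (𝓡 (n + 1)) x₀).source) :
    chartField x₀ X (extChartAt (𝓡 (n + 1)) x₀ (g.normalExp τ (t, q))) =
      (chartState x₀ (g.normalCurve τ q) t).2 := by
  obtain ⟨A, B, hc, htI⟩ := exists_isNormalGeodesic_normalCurve (ht t right_mem_uIcc).1
  rw [chartField_extChartAt hsrc, hX.tangent t q hq ht]
  exact (hasDerivAt_extChartAt_comp (hc.2.2.1.isGeodesicAt htI).mdifferentiableAt hsrc).deriv.symm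

/-- The expansion `div X` is the initial value of the expansion along the geodesic. The field `X`
agrees with the unit normal on the time slice only, so the two have the same derivatives in
the directions of the slice; in the normal direction `X` is geodesic. -/
lemma IsNormalGeodesicField.divergence_eq_normalExpansion (hτ : g.IsTimeFunction τ) {a : ℝ}
    {V : Set M} {X : ∀ x : M, TangentSpace (𝓡 (n + 1)) x}
    (hX : g.IsNormalGeodesicField τ a V X) {p : M} (hpV : p ∈ V) (hp : τ p = a) :
    g.divergence X p = g.normalExpansion τ p p 0 := by
  set y₀ := extChartAt (𝓡 (n + 1)) p p with hy₀
  set N := chartField p (g.unitNormal τ) with hN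
  have hyT : y₀ ∈ (extChartAt (𝓡 (n + 1)) p).target := mem_extChartAt_target p
  have hT := (isOpen_extChartAt_target (I := 𝓡 (n + 1)) p).mem_nhds hyT
  have hpsrc : p ∈ (extChartAt (𝓡 (n + 1)) p).source := mem_extChartAt_source p
  have hXC : ContDiffAt ℝ ∞ (chartField p X) y₀ :=
    contDiffAt_chartField (hX.smooth.contMDiffAt (hX.isOpen.mem_nhds hpV))
  have hNC : ContDiffAt ℝ ∞ N y₀ :=
    (hτ.contDiffOn_chartField_unitNormal p).contDiffAt hT
  have hτC := (contDiffOn_comp_extChartAt_symm hτ.1 p).contDiffAt hT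
  obtain ⟨hreg, hst⟩ := hτ.isRegularAt_zero p
  -- the field agrees with the unit normal on the time slice
  have hslice : ∀ᶠ y in 𝓝 y₀, τ ((extChartAt (𝓡 (n + 1)) p).symm y) =
      τ ((extChartAt (𝓡 (n + 1)) p).symm y₀) → chartField p X y = N y := by
    have hVev : ∀ᶠ y in 𝓝 y₀, (extChartAt (𝓡 (n + 1)) p).symm y ∈ V :=
      (continuousAt_extChartAt_symm p).eventually_mem
        (by rw [extChartAt_to_inv]; exact hX.isOpen.mem_nhds hpV)
    filter_upwards [hreg.eventually_mem, hst, hVev, hT] with y h1 h2 h3 h4 h5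
    rw [hy₀, extChartAt_to_inv, hp] at h5
    set q := (extChartAt (𝓡 (n + 1)) p).symm y with hq
    obtain ⟨A, B, hc, -⟩ := exists_isNormalGeodesic_normalCurve h1.1
    have h0 : g.normalExp τ (0, q) = q := hc.2.2.2.1
    have hstay : g.StaysIn τ V 0 q := by
      intro s hs
      rw [uIcc_self, mem_singleton_iff] at hs
      rw [hs, h0]
      exact ⟨h1.1, h3⟩
    have := hX.chartField_eq h5 hstay h1.2
    rw [h0, hq, (extChartAt (𝓡 (n + 1)) p).right_inv h4] at this
    rw [this]
    exact congrArg Prod.snd h2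
  have hX0 : chartField p X y₀ = N y₀ := hslice.self_of_nhds rfl
  -- hence the derivatives agree on the tangent space of the time slice
  have hker : ∀ w, g.normalForm τ p w = 0 → fderiv ℝ (chartField p X) y₀ w = fderiv ℝ N y₀ w := by
    intro w hw
    rw [hτ.normalForm_eq_zero_iff] at hw
    ext i
    have h1 := (EuclideanSpace.proj i : CoordSpace n →L[ℝ] ℝ).hasStrictFDerivAt.comp y₀
      ((hXC.hasStrictFDerivAt (by simp)).sub (hNC.hasStrictFDerivAt (by simp)))
    have h2 := fderiv_eq_zero_of_eq_zero_on_level h1 (hτC.hasStrictFDerivAt (by simp)) (fun h0 ↦ by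
      have := (hτ.normalForm_eq_zero_iff p (N y₀)).2 (DFunLike.congr_fun h0 _)
      rw [hτ.normalForm_unitNormal] at this
      exact one_ne_zero this) (hslice.mono fun y hy hy' ↦ by simp [hy hy']) hw
    have h3 : fderiv ℝ (chartField p X) y₀ w i - fderiv ℝ N y₀ w i = 0 := h2
    exact sub_eq_zero.1 h3
  -- the field is geodesic
  have hgeo : fderiv ℝ (chartField p X) y₀ (N y₀) = -g.chartGamma p y₀ (N y₀) (N y₀) := by
    obtain ⟨A, B, hc, h0I⟩ := exists_isNormalGeodesic_normalCurve hreg.mem.1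
    have h0 : g.normalExp τ (0, p) = p := hc.2.2.2.1
    have hsrc : g.normalExp τ (0, p) ∈ (extChartAt (𝓡 (n + 1)) p).source := h0.symm ▸ hpsrc
    have hd := hc.hasDerivAt_normalState h0I hsrc
    rw [hτ.normalState_zero] at hd
    have hcc : ContinuousAt (g.normalCurve τ p) 0 := (hc.2.2.1.isGeodesicAt h0I).1.continuousAt
    have hV : ∀ᶠ s in 𝓝 (0 : ℝ), s ∈ Ioo A B ∧ g.normalExp τ (s, p) ∈ V ∧
        g.normalExp τ (s, p) ∈ (extChartAt (𝓡 (n + 1)) p).source :=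
      (isOpen_Ioo.eventually_mem h0I).and ((hcc.eventually_mem (hX.isOpen.mem_nhds
        (h0.symm ▸ hpV : g.normalExp τ (0, p) ∈ V))).and
        (hcc.eventually_mem ((isOpen_extChartAt_source p).mem_nhds hsrc)))
    obtain ⟨ε, hε, hball⟩ := Metric.eventually_nhds_iff.1 hV
    have hev : ∀ᶠ s in 𝓝 (0 : ℝ), chartField p X (g.normalState τ p p s y₀).1 =
        (g.normalState τ p p s y₀).2 := by
      filter_upwards [Metric.ball_mem_nhds (0 : ℝ) hε] with s hs
      have hs' : |s| < ε := by simpa using hs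
      have hstay : g.StaysIn τ V s p := by
        intro r hr
        have hrs : |r| ≤ |s| := by
          have := abs_sub_left_of_mem_uIcc hr
          simpa using this
        have := hball (y := r) (by simpa using hrs.trans_lt hs')
        exact ⟨⟨_, A, B, hc, this.1⟩, this.2.1⟩
      have := hX.chartField_eq hp hstay (hball (y := s) (by simpa using hs')).2.2
      rw [hy₀, normalState_extChartAt]
      exact this
    have h1 : HasDerivAt (fun s ↦ (g.normalState τ p p s y₀).1) (N y₀) 0 :=
      (hasFDerivAt_fst.comp_hasDerivAt (0 : ℝ) hd :)
    have h2 : HasDerivAt (fun s ↦ (g.normalState τ p p s y₀).2) (-g.chartGamma p y₀ (N y₀) (N y₀))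
        0 := (hasFDerivAt_snd.comp_hasDerivAt (0 : ℝ) hd :)
    have h3 : HasFDerivAt (chartField p X) (fderiv ℝ (chartField p X) y₀)
        (g.normalState τ p p 0 y₀).1 := by
      rw [hτ.normalState_zero]
      exact (hXC.differentiableAt (by simp)).hasFDerivAt
    exact ((h3.comp_hasDerivAt (0 : ℝ) h1).congr_of_eventuallyEq
      (hev.mono fun s hs ↦ hs.symm)).unique h2
  rw [g.divergence_eq (hXC.differentiableAt (by simp)), normalExpansion, normalShape,
    hτ.normalJacobi_zero, Ring.inverse_one, mul_one]
  congr 1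
  refine ContinuousLinearMap.ext fun h ↦ ?_
  rw [hτ.normalJacobiDeriv_zero, ← hker _ (by
    rw [map_sub, map_smul, hτ.normalForm_unitNormal]; simp)]
  simp only [map_sub, map_smul, add_apply, sub_apply, smul_apply, ContinuousLinearMap.flip_apply,
    ← hy₀, ← hN, hX0, hgeo, smul_neg]
  abel

end LorentzMetric

/-! ### The strong energy condition for single vectors -/

namespace LorentzMetric

variable {n : ℕ} {M : Type*} [TopologicalSpace M]
  [ChartedSpace (EuclideanSpace ℝ (Fin (n + 1))) M]
  [IsManifold (𝓡 (n + 1)) ∞ M] {g : LorentzMetric n M} {τ : M → ℝ}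

lemma contMDiffAt_of_chartField {X : ∀ x : M, TangentSpace (𝓡 (n + 1)) x} {p : M}
    (hX : ContDiffAt ℝ ∞ (chartField p X) (extChartAt (𝓡 (n + 1)) p p)) :
    ContMDiffAt (𝓡 (n + 1)) (𝓡 (n + 1)).tangent ∞
      (fun x ↦ (⟨x, X x⟩ : TangentBundle (𝓡 (n + 1)) M)) p := by
  refine (Bundle.contMDiffAt_section p).2 ?_
  have h1 := ContMDiffAt.comp p hX.contMDiffAt (contMDiffAt_extChartAt (I := 𝓡 (n + 1)) (n := ∞))
  refine h1.congr_of_eventuallyEq ?_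
  filter_upwards [(isOpen_extChartAt_source (I := 𝓡 (n + 1)) p).mem_nhds (mem_extChartAt_source p)]
    with x hx
  have hx' : x ∈ (chartAt (CoordSpace n) p).source := by
    rwa [← extChartAt_source (𝓡 (n + 1))]
  have : IsManifold (𝓡 (n + 1)) 1 M := IsManifold.of_le (n := ∞) (by exact_mod_cast le_top)
  have h4 := TangentBundle.continuousLinearMapAt_trivializationAt (I := 𝓡 (n + 1)) hx'
  set e := trivializationAt (CoordSpace n) (TangentSpace (𝓡 (n + 1)) : M → Type _) p with he
  have h5 : e.continuousLinearMapAt ℝ _ (X x) = (e ⟨x, X x⟩).2 := by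
    rw [Bundle.Trivialization.continuousLinearMapAt_apply,
      Bundle.Trivialization.linearMapAt_apply, if_pos (by exact hx')]
  rw [Function.comp_apply, chartField_extChartAt hx, ← h5]
  exact DFunLike.congr_fun h4 (X x)

lemma exists_contMDiffOn_extension (x : M) (v : TangentSpace (𝓡 (n + 1)) x) :
    ∃ X : ∀ y : M, TangentSpace (𝓡 (n + 1)) y, X x = v ∧
      ContMDiffOn (𝓡 (n + 1)) (𝓡 (n + 1)).tangent ∞
        (fun y ↦ (⟨y, X y⟩ : TangentBundle (𝓡 (n + 1)) M)) (extChartAt (𝓡 (n + 1)) x).source := by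
  set u : CoordSpace n := mfderiv (𝓡 (n + 1)) 𝓘(ℝ, CoordSpace n) (extChartAt (𝓡 (n + 1)) x) x v
  refine ⟨fun y ↦ (mfderiv 𝓘(ℝ, CoordSpace n) (𝓡 (n + 1)) (extChartAt (𝓡 (n + 1)) x).symm
    (extChartAt (𝓡 (n + 1)) x y) u : CoordSpace n),
    mfderiv_symm_mfderiv x (mem_extChartAt_source x) v, ?_⟩
  have h1 := contMDiffOn_extChartAt (I := 𝓡 (n + 1)) (n := ∞) (x := x)
  rw [← extChartAt_source (𝓡 (n + 1))] at h1
  refine ((contMDiffOn_mfderiv_symm x u).comp h1 fun y hy ↦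
    (extChartAt (𝓡 (n + 1)) x).map_source hy).congr fun y hy ↦ ?_
  simp only [Function.comp_apply]
  have key : ∀ (z : M), z = y → ∀ w : CoordSpace n,
      (⟨y, w⟩ : TangentBundle (𝓡 (n + 1)) M) = ⟨z, w⟩ := by
    rintro z rfl w
    rfl
  exact key _ ((extChartAt (𝓡 (n + 1)) x).left_inv hy) _

lemma continuousAt_val (g : LorentzMetric n M) {X Y : ∀ y : M, TangentSpace (𝓡 (n + 1)) y} {x : M}
    (hX : ContMDiffAt (𝓡 (n + 1)) (𝓡 (n + 1)).tangent ∞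
        (fun y ↦ (⟨y, X y⟩ : TangentBundle (𝓡 (n + 1)) M)) x)
    (hY : ContMDiffAt (𝓡 (n + 1)) (𝓡 (n + 1)).tangent ∞
        (fun y ↦ (⟨y, Y y⟩ : TangentBundle (𝓡 (n + 1)) M)) x) :
    ContinuousAt (fun y ↦ g.val y (X y) (Y y)) x := by
  have hT := (isOpen_extChartAt_target (I := 𝓡 (n + 1)) x).mem_nhds (mem_extChartAt_target x)
  have h1 := (((g.contDiffOn_chartMetric x).contDiffAt hT).clm_apply
    (contDiffAt_chartField hX)).clm_apply (contDiffAt_chartField hY)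
  have h2 := ContinuousAt.comp (x := x) h1.continuousAt (continuousAt_extChartAt (I := 𝓡 (n + 1)) x)
  refine h2.congr ?_
  filter_upwards [(isOpen_extChartAt_source (I := 𝓡 (n + 1)) x).mem_nhds (mem_extChartAt_source x)]
    with y hy
  rw [Function.comp_apply, g.chartMetric_chartField x _ _
    ((extChartAt (𝓡 (n + 1)) x).map_source hy), (extChartAt (𝓡 (n + 1)) x).left_inv hy]

lemma IsTimeFunction.contMDiff_grad (hτ : g.IsTimeFunction τ) (c : ℝ) :
    ContMDiff (𝓡 (n + 1)) (𝓡 (n + 1)).tangent ∞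
      (fun x ↦ (⟨x, c • g.grad τ x⟩ : TangentBundle (𝓡 (n + 1)) M)) := by
  intro x
  refine contMDiffAt_of_chartField ?_
  have hT := (isOpen_extChartAt_target (I := 𝓡 (n + 1)) x).mem_nhds (mem_extChartAt_target x)
  refine (((g.contDiffOn_chartField_grad hτ.1 x).contDiffAt hT).const_smul c).congr_of_eventuallyEq
    (Eventually.of_forall fun y ↦ ?_)
  exact map_smul _ _ _

/-- Every timelike vector is the value of a timelike vector field: such fields can be glued, since
the timelike vectors on one side of the time slices form a convex cone. -/
lemma exists_timelike_extension [T2Space M] [SecondCountableTopology M]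
    (hτ : g.IsTimeFunction τ) {x : M} {v : TangentSpace (𝓡 (n + 1)) x} (hv : g.IsTimelike v) :
    ∃ V : ∀ x : M, TangentSpace (𝓡 (n + 1)) x,
    ContMDiff (𝓡 (n + 1)) (𝓡 (n + 1)).tangent ∞
      (fun x ↦ (⟨x, V x⟩ : TangentBundle (𝓡 (n + 1)) M)) ∧
    (∀ x, g.IsTimelike (V x)) ∧ V x = v := by
  have : LocallyCompactSpace M := ChartedSpace.locallyCompactSpace (CoordSpace n) M
  have hne : g.val x (g.grad τ x) v ≠ 0 := by
    intro h0
    rw [g.symm] at h0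
    refine lt_asymm hv ((g.isLorentzForm x).pos_of_orthogonal (hτ.2 x) h0 ?_)
    rintro rfl
    exact lt_irrefl _ (hv.trans_eq (map_zero (g.val x 0)).symm)
  obtain ⟨ε, hε, hεv⟩ : ∃ ε : ℝ, ε * ε = 1 ∧ ε * g.val x (g.grad τ x) v < 0 := by
    rcases hne.lt_or_gt with h | h
    · exact ⟨1, by norm_num, by linarith⟩
    · exact ⟨-1, by norm_num, by linarith⟩
  have hgt : ∀ y, g.val y (ε • g.grad τ y) (ε • g.grad τ y) < 0 := by
    intro y
    have := hτ.2 y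
    rw [IsTimelike] at this
    simp only [map_smul, smul_apply, smul_eq_mul, ← mul_assoc, hε, one_mul]
    exact this
  obtain ⟨X, hXx, hX⟩ := exists_contMDiffOn_extension x v
  -- timelike vectors on the side of `v`, with the value `v` prescribed at `x`
  let t : ∀ y : M, Set (TangentSpace (𝓡 (n + 1)) y) := fun y ↦
    {w | (g.val y w w < 0 ∧ g.val y (ε • g.grad τ y) w < 0) ∧
      (y = x → (w : CoordSpace n) = (v : CoordSpace n))}
  have hconv : ∀ y, Convex ℝ (t y) := by
    rintro y w ⟨⟨h1, h2⟩, h3⟩ w' ⟨⟨h1', h2'⟩, h3'⟩ a b ha hb hab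
    have h4 := (g.isLorentzForm y).neg_of_same_side (hgt y) h1 h1' h2 h2'
    have h5 := g.symm y w' w
    refine ⟨⟨?_, ?_⟩, fun hy ↦ ?_⟩
    · simp only [map_add, map_smul, add_apply, smul_apply, smul_eq_mul, h5]
      have h4' : g.val y w w' < 0 := h4
      rcases ha.eq_or_lt with rfl | ha'
      · have : b = 1 := by linarith
        subst this
        simpa using h1'
      · nlinarith [mul_pos ha' ha', mul_nonneg ha hb, mul_nonneg hb hb]
    · simp only [map_add, map_smul, smul_eq_mul] at h2 h2' ⊢
      rcases ha.eq_or_lt with rfl | ha'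
      · have : b = 1 := by linarith
        subst this
        simpa using h2'
      · nlinarith
    · subst hy
      rw [h3 rfl, h3' rfl]
      exact Convex.combo_self hab v
  have hloc : ∀ x₀ : M, ∃ U ∈ 𝓝 x₀, ∃ s : ∀ y : M, TangentSpace (𝓡 (n + 1)) y,
      ContMDiffOn (𝓡 (n + 1)) (𝓡 (n + 1)).tangent ∞
        (fun y ↦ (⟨y, s y⟩ : TangentBundle (𝓡 (n + 1)) M)) U ∧ ∀ y ∈ U, s y ∈ t y := by
    intro x₀
    by_cases hx : x₀ = x
    · subst hx
      have hs := (isOpen_extChartAt_source (I := 𝓡 (n + 1)) x₀).mem_nhds (mem_extChartAt_source x₀)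
      have hXa := hX.contMDiffAt hs
      have h1 := (g.continuousAt_val hXa hXa).eventually_lt_const (u := 0)
        (by
          simp only [hXx]
          exact hv)
      have h2 := (g.continuousAt_val (hτ.contMDiff_grad ε x₀) hXa).eventually_lt_const (u := 0)
        (by simpa [hXx] using hεv)
      refine ⟨_, inter_mem hs (inter_mem h1 h2), X, hX.mono inter_subset_left,
        fun y hy ↦ ⟨hy.2, ?_⟩⟩
      rintro rfl
      exact hXx
    · refine ⟨{x}ᶜ, isOpen_compl_singleton.mem_nhds hx, fun y ↦ ε • g.grad τ y,
        (hτ.contMDiff_grad ε).contMDiffOn, fun y hy ↦ ⟨⟨hgt y, hgt y⟩, fun h ↦ absurd h hy⟩⟩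
  obtain ⟨s, hs⟩ := exists_contMDiffSection_forall_mem_convex_of_local (n := ⊤) (𝓡 (n + 1))
    (fun y : M ↦ TangentSpace (𝓡 (n + 1)) y) t hconv hloc
  exact ⟨s, s.contMDiff, fun y ↦ (hs y).1.1, (hs x).2 rfl⟩

lemma StrongEnergyCondition.ricci_nonneg [T2Space M] [SecondCountableTopology M]
    (hsec : g.StrongEnergyCondition) (hτ : g.IsTimeFunction τ) {x : M}
    {v : TangentSpace (𝓡 (n + 1)) x} (hv : g.IsTimelike v) : 0 ≤ g.ricci x v v := by
  obtain ⟨V, hV, hVt, rfl⟩ := exists_timelike_extension hτ hv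
  exact hsec V hV hVt x

end LorentzMetric

/-! ### The Riccati inequality -/

/-- A solution of the Riccati inequality with negative initial value `θ₀` does not exist up to the
time `-n / θ₀`: the reciprocal `1 / θ`, which is negative, grows at least at the rate `1 / n`. -/
lemma not_riccati_inequality {θ : ℝ → ℝ} {θ₀ : ℝ} {n : ℕ} (hneg : θ₀ < 0) (h0 : θ 0 = θ₀)
    (h : ∀ t ∈ Icc (0 : ℝ) (-n / θ₀), ∃ θ', HasDerivAt θ θ' t ∧ n * θ' + θ t ^ 2 ≤ 0) : False := by
  set T : ℝ := -n / θ₀ with hT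
  have hT0 : 0 ≤ T := div_nonneg_of_nonpos (by simp) hneg.le
  -- for `n = 0` the inequality says `θ 0 = 0`
  rcases Nat.eq_zero_or_pos n with rfl | hn
  · obtain ⟨θ', -, h1⟩ := h 0 ⟨le_rfl, hT0⟩
    rw [h0, Nat.cast_zero, zero_mul, zero_add] at h1
    nlinarith
  have hn' : (0 : ℝ) < n := Nat.cast_pos.2 hn
  choose! θ' hd hθ' using h
  have hnonpos : ∀ t ∈ Icc 0 T, θ' t ≤ 0 := fun t ht ↦ by
    have := hθ' t ht
    by_contra hcon
    nlinarith [mul_pos hn' (not_le.1 hcon), sq_nonneg (θ t)]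
  have hanti : AntitoneOn θ (Icc 0 T) := by
    refine antitoneOn_of_deriv_nonpos (convex_Icc 0 T)
      (fun t ht ↦ (hd t ht).continuousAt.continuousWithinAt) (fun t ht ↦ ?_) (fun t ht ↦ ?_)
    · exact (hd t (interior_subset ht)).differentiableAt.differentiableWithinAt
    · rw [(hd t (interior_subset ht)).deriv]
      exact hnonpos t (interior_subset ht)
  have hlt : ∀ t ∈ Icc 0 T, θ t < 0 := fun t ht ↦
    ((hanti ⟨le_rfl, hT0⟩ ht ht.1).trans_eq h0).trans_lt hneg
  have hu : ∀ t ∈ Icc 0 T, HasDerivAt (fun t ↦ (θ t)⁻¹ - t / n) (-θ' t / θ t ^ 2 - 1 / n) t :=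
    fun t ht ↦ ((hd t ht).inv (hlt t ht).ne).sub ((hasDerivAt_id t).div_const _)
  have hmono : MonotoneOn (fun t ↦ (θ t)⁻¹ - t / n) (Icc 0 T) := by
    refine monotoneOn_of_deriv_nonneg (convex_Icc 0 T)
      (fun t ht ↦ (hu t ht).continuousAt.continuousWithinAt) (fun t ht ↦ ?_) (fun t ht ↦ ?_)
    · exact (hu t (interior_subset ht)).differentiableAt.differentiableWithinAt
    · have ht' := interior_subset ht
      rw [(hu t ht').deriv, sub_nonneg, div_le_div_iff₀ hn' (even_two.pow_pos (hlt t ht').ne)]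
      linarith [hθ' t ht']
  have h1 : (θ 0)⁻¹ - 0 / n ≤ (θ T)⁻¹ - T / n :=
    hmono ⟨le_rfl, hT0⟩ ⟨hT0, le_rfl⟩ hT0
  have h2 : T / n = -θ₀⁻¹ := by
    rw [hT]
    field_simp
  rw [h0, h2, zero_div] at h1
  linarith [inv_lt_zero.2 (hlt T ⟨hT0, le_rfl⟩)]

/-! ### The Raychaudhuri inequality in the absence of critical points -/

namespace LorentzMetric

variable {n : ℕ} {M : Type*} [TopologicalSpace M]
  [ChartedSpace (EuclideanSpace ℝ (Fin (n + 1))) M]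
  [IsManifold (𝓡 (n + 1)) ∞ M] {g : LorentzMetric n M} {τ : M → ℝ}

lemma chartMetric_mfderiv (g : LorentzMetric n M) {x₀ x : M}
    (hx : x ∈ (extChartAt (𝓡 (n + 1)) x₀).source) (v w : TangentSpace (𝓡 (n + 1)) x) :
    g.chartMetric x₀ (extChartAt (𝓡 (n + 1)) x₀ x)
      (mfderiv (𝓡 (n + 1)) 𝓘(ℝ, CoordSpace n) (extChartAt (𝓡 (n + 1)) x₀) x v)
      (mfderiv (𝓡 (n + 1)) 𝓘(ℝ, CoordSpace n) (extChartAt (𝓡 (n + 1)) x₀) x w) = g.val x v w := by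
  have h := g.chartMetric_chartField x₀ (fun _ ↦ (v : CoordSpace n)) (fun _ ↦ (w : CoordSpace n))
    ((extChartAt (𝓡 (n + 1)) x₀).map_source hx)
  refine (congrArg₂ (fun a b ↦ g.chartMetric x₀ (extChartAt (𝓡 (n + 1)) x₀ x) a b)
    (chartField_extChartAt hx _).symm (chartField_extChartAt hx _).symm).trans (h.trans ?_)
  exact congrArg (fun z ↦ g.val z (v : CoordSpace n) (w : CoordSpace n))
    ((extChartAt (𝓡 (n + 1)) x₀).left_inv hx)

variable [T2Space M]

/-- Where the exponential map is not critical, the Jacobi tensor is invertible: its image is that of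
the differential of the exponential map of the time slice. -/
lemma IsRegularAt.isUnit_normalJacobi {p x₀ : M} {t : ℝ} (h : g.IsRegularAt τ p x₀ t)
    (hτ : g.IsTimeFunction τ) (hcrit : ¬ g.IsCriticalPoint τ t p) :
    IsUnit (g.normalJacobi τ p x₀ t) := by
  set y₀ := extChartAt (𝓡 (n + 1)) p p with hy₀
  have hpsrc : p ∈ (extChartAt (𝓡 (n + 1)) p).source := mem_extChartAt_source p
  obtain ⟨hd, hformula⟩ := h.mfderiv_normalExp
  have hsurj : ∀ v : TangentSpace (𝓡 (n + 1)) (g.normalExp τ (t, p)),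
      ∃ (s : ℝ) (w : TangentSpace (𝓡 (n + 1)) p), mfderiv (𝓡 (n + 1)) 𝓘(ℝ, ℝ) τ p w = 0 ∧
      mfderiv (𝓘(ℝ, ℝ).prod (𝓡 (n + 1))) (𝓡 (n + 1)) (g.normalExp τ) (t, p) (s, w) = v := by
    by_contra hcon
    exact hcrit ⟨h.mem.1, hd, hcon⟩
  have hJsurj : Function.Surjective (g.normalJacobi τ p x₀ t) := by
    intro u
    obtain ⟨σ, w, hw, hσw⟩ := hsurj (mfderiv 𝓘(ℝ, CoordSpace n) (𝓡 (n + 1))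
      (extChartAt (𝓡 (n + 1)) x₀).symm (g.normalState τ p x₀ t y₀).1 u : CoordSpace n)
    have h1 := (hformula σ w).symm.trans hσw
    set w' : CoordSpace n :=
      mfderiv (𝓡 (n + 1)) 𝓘(ℝ, CoordSpace n) (extChartAt (𝓡 (n + 1)) p) p w with hw'
    have h2 : σ • (g.normalState τ p x₀ t y₀).2 + (fderiv ℝ (g.normalState τ p x₀ t) y₀ w').1 = u := by
      have := congrArg (fun v : CoordSpace n ↦ (mfderiv (𝓡 (n + 1)) 𝓘(ℝ, CoordSpace n)
        (extChartAt (𝓡 (n + 1)) x₀) ((extChartAt (𝓡 (n + 1)) x₀).symm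
          (g.normalState τ p x₀ t y₀).1) v : CoordSpace n)) h1
      exact (mfderiv_mfderiv_symm x₀ h.normalState_mem _).symm.trans
        (this.trans (mfderiv_mfderiv_symm x₀ h.normalState_mem u))
    have hker : g.normalForm τ p w' = 0 := by
      rw [hτ.normalForm_eq_zero_iff, fderiv_comp_extChartAt_symm hτ.1 p (mem_extChartAt_target p)]
      have key : ∀ q, q = p → ∀ u : CoordSpace n, u = w →
          (mfderiv (𝓡 (n + 1)) 𝓘(ℝ, ℝ) τ q u : ℝ) = mfderiv (𝓡 (n + 1)) 𝓘(ℝ, ℝ) τ p w := by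
        rintro q rfl u rfl
        rfl
      exact (key _ (extChartAt_to_inv p) _ (mfderiv_symm_mfderiv p hpsrc w)).trans hw
    refine ⟨w' + σ • chartField p (g.unitNormal τ) y₀, ?_⟩
    rw [map_add, map_smul, hτ.normalJacobi_unitNormal, normalJacobi, jacobiTensor_apply, hker]
    rw [← h2]
    simp [hy₀, add_comm]
  exact ContinuousLinearMap.isUnit_iff_bijective.2
    ⟨LinearMap.injective_iff_surjective.2 hJsurj, hJsurj⟩

/-- Along a normal geodesic without critical points the expansion satisfies the Riccati
inequality, by the strong energy condition. -/
lemma IsTimeFunction.exists_hasDerivAt_normalExpansion [SecondCountableTopology M]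
    (hτ : g.IsTimeFunction τ) (hsec : g.StrongEnergyCondition) {p : M} {A B t : ℝ}
    (hc : g.IsNormalGeodesic τ p (g.normalCurve τ p) A B) (ht : t ∈ Ioo A B)
    (hu : IsUnit (g.normalJacobi τ p (g.normalExp τ (t, p)) t)) :
    ∃ θ', HasDerivAt (fun s ↦ g.normalExpansion τ p (g.normalExp τ (s, p)) s) θ' t ∧
      n * θ' + g.normalExpansion τ p (g.normalExp τ (t, p)) t ^ 2 ≤ 0 := by
  set x₁ := g.normalExp τ (t, p) with hx₁
  have hsrc : g.normalExp τ (t, p) ∈ (extChartAt (𝓡 (n + 1)) x₁).source := mem_extChartAt_source x₁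
  have hreg : ∀ s ∈ Ioo A B, ∀ x₀, g.normalExp τ (s, p) ∈ (extChartAt (𝓡 (n + 1)) x₀).source →
      g.IsRegularAt τ p x₀ s := fun s hs x₀ hx₀ ↦ hτ.isRegularAt hc hs hx₀
  have h1 := hreg t ht x₁ hsrc
  have h0 : (0 : ℝ) ∈ Ioo A B := ⟨hc.1, hc.2.1⟩
  have hW : ∀ a b, g.normalWronskian τ p a b x₁ t = 0 := fun a b ↦ by
    rw [hc.eq_of_hasDerivAt_zero (f := g.normalWronskian τ p a b)
      (fun s hs y₀ y₁ hy₀ hy₁ ↦ (hreg s hs y₀ hy₀).normalWronskian_chartChange hy₁ a b)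
      (fun s hs ↦ (hreg s hs _ (mem_extChartAt_source _)).hasDerivAt_normalWronskian hc hs a b)
      ht hsrc, hτ.normalWronskian_zero]
  have hE : g.normalEnergy τ p x₁ t = -1 := by
    rw [hc.eq_of_hasDerivAt_zero (f := g.normalEnergy τ p)
      (fun s hs y₀ y₁ hy₀ hy₁ ↦ (hreg s hs y₀ hy₀).normalEnergy_chartChange hy₁)
      (fun s hs ↦ (hreg s hs _ (mem_extChartAt_source _)).hasDerivAt_normalEnergy hc hs)
      ht hsrc, hτ.normalEnergy_zero]
  obtain ⟨θ', hθ', hle⟩ := h1.exists_hasDerivAt_normalExpansion hτ hc ht hu hW hE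
  refine ⟨θ', hθ'.congr_of_eventuallyEq ?_, ?_⟩
  -- near `t` the expansion may be computed in the fixed chart at `x₁`
  · have hU : ∀ᶠ s in 𝓝 t, IsUnit (g.normalJacobi τ p x₁ s) :=
      (h1.hasDerivAt_normalJacobi hc ht).continuousAt.eventually_mem (Units.isOpen.mem_nhds hu)
    filter_upwards [hU, isOpen_Ioo.mem_nhds ht,
      (hc.2.2.1.isGeodesicAt ht).1.continuousAt.eventually_mem
      ((isOpen_extChartAt_source _).mem_nhds hsrc)] with s hs hsI hs'
    exact (hreg s hsI x₁ hs').normalExpansion_chartChange (mem_extChartAt_source _) hs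
  · have hstate := normalState_extChartAt g τ p x₁ t
    have hv := hasDerivAt_extChartAt_comp (hc.2.2.1.isGeodesicAt ht).mdifferentiableAt hsrc
    have hz2 : (g.normalState τ p x₁ t (extChartAt (𝓡 (n + 1)) p p)).2 =
        mfderiv (𝓡 (n + 1)) 𝓘(ℝ, CoordSpace n) (extChartAt (𝓡 (n + 1)) x₁) x₁
          (velocity (n := n) (g.normalCurve τ p) t) := by
      rw [hstate]
      exact hv.deriv
    have hz1 : (g.normalState τ p x₁ t (extChartAt (𝓡 (n + 1)) p p)).1 =
        extChartAt (𝓡 (n + 1)) x₁ x₁ := by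
      rw [hstate]
      rfl
    have htl : g.IsTimelike (x := x₁) (velocity (n := n) (g.normalCurve τ p) t) := by
      rw [IsTimelike, ← g.chartMetric_mfderiv hsrc, ← hx₁, ← hz2, ← hz1]
      exact hE.trans_lt (by norm_num)
    have hric := hsec.ricci_nonneg hτ htl
    have hR : g.ricci x₁ (velocity (n := n) (g.normalCurve τ p) t)
        (velocity (n := n) (g.normalCurve τ p) t) =
        ContinuousLinearMap.traceL (CoordSpace n) (jacobiOperator (g.chartGamma x₁)
          (g.normalState τ p x₁ t (extChartAt (𝓡 (n + 1)) p p)).1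
          (g.normalState τ p x₁ t (extChartAt (𝓡 (n + 1)) p p)).2) := by
      rw [hz1, hz2]
      exact g.ricci_self_eq_trace x₁ _
    rw [hR] at hric
    have := mul_nonneg (Nat.cast_nonneg (α := ℝ) n) hric
    linarith

end LorentzMetric

end

theorem mainTheorem4 {n : ℕ} {M : Type*} [TopologicalSpace M] [T2Space M]
    [SecondCountableTopology M] [ChartedSpace (EuclideanSpace ℝ (Fin (n + 1))) M]
    [IsManifold (𝓡 (n + 1)) ∞ M] (g : LorentzMetric n M)
    (hgh : g.GloballyHyperbolic) (hsec : g.StrongEnergyCondition)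
    (τ : M → ℝ) (hτ : g.IsTimeFunction τ) (a : ℝ)
    (p : M) (hp : p ∈ LorentzMetric.timeSlice τ a)
    (θ₀ : ℝ) (hθ : g.HasExpansionAt τ a p θ₀) (hneg : θ₀ < 0)
    (hext : (-(n : ℝ) / θ₀, p) ∈ g.expDomain τ) :
    ∃ t : ℝ, 0 < t ∧ t ≤ -(n : ℝ) / θ₀ ∧ g.IsCriticalPoint τ t p ∧
      g.normalExp τ (t, p) ∈ g.conjugatePoints τ a := by
  by_contra hcon
  have hcrit : ∀ t : ℝ, 0 < t → t ≤ -(n : ℝ) / θ₀ → ¬ g.IsCriticalPoint τ t p :=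
    fun t h0 hT hcr ↦ hcon ⟨t, h0, hT, hcr, t, p, hp, hcr, rfl⟩
  obtain ⟨V, X, hpV, hX, hdiv⟩ := hθ
  obtain ⟨A, B, hc, hTI⟩ := LorentzMetric.exists_isNormalGeodesic_normalCurve hext
  have hp0 : g.normalExp τ (0, p) = p := hc.2.2.2.1
  refine not_riccati_inequality
    (θ := fun s ↦ g.normalExpansion τ p (g.normalExp τ (s, p)) s) (n := n) hneg ?_ fun t ht ↦ ?_
  · simp only [hp0]
    rw [← hX.divergence_eq_normalExpansion hτ hpV hp, hdiv]
  · have htI : t ∈ Ioo A B := ⟨hc.1.trans_le ht.1, ht.2.trans_lt hTI.2⟩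
    refine hτ.exists_hasDerivAt_normalExpansion hsec hc htI ?_
    rcases ht.1.eq_or_lt with rfl | h0
    · rw [hp0, hτ.normalJacobi_zero]
      exact isUnit_one
    · exact (hτ.isRegularAt hc htI (mem_extChartAt_source _)).isUnit_normalJacobi hτ
        (hcrit t h0 ht.2)
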